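/- Let $K$ be an algebraically closed field and let $A$ be a finite-dimensional indecomposable symmetric $K$-algebra whose Grothendieck group $K_0(A)$ has rank at least $2$. Suppose that there is a Brauer graph algebra $B_\Gamma$ over $K$ such that $A$ is socle equivalent to $B_\Gamma$, that is $A/\mathrm{soc}(A)\cong B_\Gamma/\mathrm{soc}(B_\Gamma)$ as $K$-algebras, but $A\not\cong B_\Gamma$. Then: (i) $\operatorname{char}(K)=2$, and (ii) $A$ is isomorphic to an idempotent algebra $\bar e\bar B\bar e$, where $\bar B=B(S,\vec T,m_\bullet,b_\bullet)$ is a socle deformed biserial weighted surface algebra, $S$ is a surface with non-empty boundary, $T$ is a triangulation of $S$ without self-folded triangles, $\vec T$ is a choice of orientations of the triangles, $m_\bullet$ is a weight function and $b_\bullet$ is a non-zero border function. Here a Brauer graph $\Gamma$ is a finite connected graph with at least one edge (loops and multiple edges allowed), with a cyclic ordering of the edges around each vertex $v$ (a loop counted twice) and a multiplicity $e(v)\ge 1$. Its Brauer quiver has the edges of $\Gamma$ as vertices and an arrow $i\to j$ whenever $j$ is the successor of $i$ in the cyclic ordering around a vertex $v=v(\alpha)$. For an arrow $\alpha$ let $C_\alpha$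 be the cycle of arrows around $v(\alpha)$ starting with $\alpha$, and $\bar\alpha$ the other arrow with the same source. Then $B_\Gamma$ is the path algebra over $K$ of the Brauer quiver modulo the ideal generated by all paths $\alpha\beta$ of length $2$ for which $\beta$ is not the successor of $\alpha$ in the cycle around $v(\alpha)$, and all $C_\alpha^{e(v(\alpha))}-C_{\bar\alpha}^{e(v(\bar\alpha))}$. A surface is a connected compact $2$-dimensional real manifold, with or without boundary, orientable or not. A triangulation is a finite cell structure on it with at least two edges, whose $2$-cells are triangles, such that each edge is either a side of exactly two triangles, or the self-folded edge of one triangle (two of its sides), or lies on the boundary and is a side of exactly one triangle. The quiver $Q=Q(S,\vec T)$ has the edges of $T$ as vertices; an oriented triangle with sides $(a\,b\,c)$ gives arrows $a\to b\to c\to a$, which the permutation $f$ rotates in this order, and a boundary edge gives a loop fixed by $f$ (a border loop). Each vertex is the source of exactly two arrows; let $\bar\alpha$ be the other arrow with the same source as $\alpha$, put $g(\alpha)=\overline{f(\alpha)}$, and let $n_\alpha$ be the length of the $g$-orbit of $\alpha$. A weight function $m_\bullet$ assigns a positive integer to each $g$-orbit, and a border function $b_\bullet$ assigns an element of $K$ to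 each boundary edge. With $B_\alpha=(\alpha g(\alpha)\cdots g^{n_\alpha-1}(\alpha))^{m_\alpha}$, the algebra $B(S,\vec T,m_\bullet,b_\bullet)$ is $KQ$ modulo the ideal generated by $\alpha f(\alpha)$ for all arrows $\alpha$ that are not border loops, $\alpha^2-b_{s(\alpha)}B_\alpha$ for all border loops $\alpha$, and $B_\alpha-B_{\bar\alpha}$ for all arrows $\alpha$. -/

import Mathlib

open scoped Manifold

noncomputable section

/-! ### Algebras: symmetric, indecomposable, socle, Grothendieck group, corner algebras -/

/-- A `K`-algebra is symmetric if it carries an associative, symmetric, nondegenerate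
`K`-bilinear form. -/
def HasSymmetrizingForm (K A : Type*) [Field K] [Ring A] [Algebra K A] : Prop :=
  ∃ B : LinearMap.BilinForm K A,
    (∀ x y z : A, B (x * y) z = B x (y * z)) ∧ (∀ x y : A, B x y = B y x) ∧ B.Nondegenerate

/-- An algebra is indecomposable if it is nonzero and not a product of two nonzero algebras,
that is, `0` and `1` are its only central idempotents. -/
def IsIndecomposableAlgebra (A : Type*) [Ring A] : Prop :=
  Nontrivial A ∧ ∀ e ∈ Subring.center A, IsIdempotentElem e → e = 0 ∨ e = 1

/-- The socle of `A` as a right module over itself: the sum of all minimal right ideals. -/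
def rightSocle (A : Type*) [Ring A] : Submodule Aᵐᵒᵖ A :=
  sSup {I : Submodule Aᵐᵒᵖ A | IsSimpleModule Aᵐᵒᵖ I}

theorem mul_mem_rightSocle {A : Type*} [Ring A] (x : A) {y : A} (hy : y ∈ rightSocle A) :
    x * y ∈ rightSocle A := by
  let φ : A →ₗ[Aᵐᵒᵖ] A :=
    { toFun := fun z => x * z
      map_add' := fun a b => mul_add x a b
      map_smul' := fun c a => by
        simp [← mul_assoc] }
  suffices h : rightSocle A ≤ (rightSocle A).comap φ from h hy
  refine sSup_le ?_
  intro I hI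
  have hI' : IsSimpleModule Aᵐᵒᵖ I := hI
  intro z hz
  show φ z ∈ rightSocle A
  let ψ : I →ₗ[Aᵐᵒᵖ] A := φ.comp I.subtype
  have hz' : φ z ∈ LinearMap.range ψ := ⟨⟨z, hz⟩, rfl⟩
  rcases LinearMap.injective_or_eq_zero ψ with h | h
  · have hs : IsSimpleModule Aᵐᵒᵖ (LinearMap.range ψ) :=
      IsSimpleModule.congr (LinearEquiv.ofInjective ψ h).symm
    exact (le_sSup (show LinearMap.range ψ ∈ {I : Submodule Aᵐᵒᵖ A | IsSimpleModule Aᵐᵒᵖ I}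
      from hs)) hz'
  · rw [h, LinearMap.range_zero, Submodule.mem_bot] at hz'
    rw [hz']
    exact Submodule.zero_mem _

/-- The socle `soc A`, as a two-sided ideal. -/
def socleIdeal (A : Type*) [Ring A] : TwoSidedIdeal A :=
  TwoSidedIdeal.mk' (rightSocle A : Set A)
    (Submodule.zero_mem _) (fun hx hy => Submodule.add_mem _ hx hy)
    (fun hx => Submodule.neg_mem _ hx) (fun hy => mul_mem_rightSocle _ hy)
    (fun {_ y} hx => Submodule.smul_mem _ (MulOpposite.op y) hx)

/-- Socle equivalence: `A / soc A` and `B / soc B` are isomorphic `K`-algebras. -/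
def SocleEquivalent (K A B : Type*) [Field K] [Ring A] [Algebra K A] [Ring B] [Algebra K B] :
    Prop :=
  Nonempty ((socleIdeal A).ringCon.Quotient ≃ₐ[K] (socleIdeal B).ringCon.Quotient)

/-- The finitely generated right `A`-modules; over a finite-dimensional algebra these are
the finite-dimensional ones. -/
def FinRightMod.{v} (A : Type v) [Ring A] : Type (v + 1) :=
  {M : ModuleCat.{v} Aᵐᵒᵖ // Module.Finite Aᵐᵒᵖ M}

/-- The relations `[M] = [L] + [N]`, one for each short exact sequence `0 → L → M → N → 0`. -/
def grothendieckRelations.{v} (A : Type v) [Ring A] :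
    AddSubgroup (FreeAbelianGroup (FinRightMod A)) :=
  AddSubgroup.closure {x | ∃ (L M N : FinRightMod A)
    (i : L.1 →ₗ[Aᵐᵒᵖ] M.1) (p : M.1 →ₗ[Aᵐᵒᵖ] N.1),
    Function.Injective i ∧ Function.Surjective p ∧ Function.Exact i p ∧
      x = FreeAbelianGroup.of M - FreeAbelianGroup.of L - FreeAbelianGroup.of N}

/-- The Grothendieck group `K₀(A)` of the category of finitely generated right `A`-modules. -/
def GrothendieckK0.{v} (A : Type v) [Ring A] : Type (v + 1) :=
  FreeAbelianGroup (FinRightMod A) ⧸ grothendieckRelations A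

instance GrothendieckK0.instAddCommGroup.{v} (A : Type v) [Ring A] :
    AddCommGroup (GrothendieckK0 A) :=
  inferInstanceAs (AddCommGroup (FreeAbelianGroup (FinRightMod A) ⧸ grothendieckRelations A))

/-- The `K`-algebra structure of the idempotent algebra `e R e`; `c : K` acts as in `R`. -/
instance cornerAlgebra {K R : Type*} [Field K] [Ring R] [Algebra K R] {e : R}
    (he : IsIdempotentElem e) : Algebra K he.Corner where
  smul c x := ⟨c • x.1, by
    obtain ⟨y, hy⟩ := x.2
    exact ⟨c • y, by simp [← hy]⟩⟩
  algebraMap :=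
    { toFun := fun c => ⟨c • e, c • 1, by simp [he.eq]⟩
      map_one' := Subtype.ext (one_smul K e)
      map_zero' := Subtype.ext (zero_smul K e)
      map_mul' := fun c d => Subtype.ext (by
        show (c * d) • e = (c • e) * (d • e)
        rw [smul_mul_smul_comm, he.eq])
      map_add' := fun c d => Subtype.ext (add_smul c d e) }
  commutes' c x := Subtype.ext (by
    show (c • e) * x.1 = x.1 * (c • e)
    have hx := (Subsemigroup.mem_corner_iff he).1 x.2
    rw [smul_mul_assoc, mul_smul_comm, hx.1, hx.2])
  smul_def' c x := Subtype.ext (by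
    show c • x.1 = (c • e) * x.1
    have hx := (Subsemigroup.mem_corner_iff he).1 x.2
    rw [smul_mul_assoc, hx.1])

/-- `A` is isomorphic, as a `K`-algebra, to an idempotent algebra `e R e` of `R`. -/
def IsIsoIdempotentAlgebra (K A R : Type*) [Field K] [Ring A] [Algebra K A] [Ring R]
    [Algebra K R] : Prop :=
  ∃ (e : R) (he : IsIdempotentElem e), Nonempty (A ≃ₐ[K] he.Corner)

/-! ### Quivers and path algebras -/

/-- A finite quiver. -/
structure FinQuiver where
  Vertex : Type
  Arrow : Type
  [fintypeVertex : Fintype Vertex]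
  [fintypeArrow : Fintype Arrow]
  src : Arrow → Vertex
  tgt : Arrow → Vertex

attribute [instance] FinQuiver.fintypeVertex FinQuiver.fintypeArrow

/-- The defining relations of the path algebra on the trivial paths (`Sum.inl`) and the
arrows (`Sum.inr`). Paths are composed from left to right. -/
inductive FinQuiver.PathRel (K : Type*) [Field K] (Q : FinQuiver) :
    FreeAlgebra K (Q.Vertex ⊕ Q.Arrow) → FreeAlgebra K (Q.Vertex ⊕ Q.Arrow) → Prop
  | idem (v : Q.Vertex) :
      PathRel K Q (FreeAlgebra.ι K (Sum.inl v) * FreeAlgebra.ι K (Sum.inl v))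
        (FreeAlgebra.ι K (Sum.inl v))
  | orth (v w : Q.Vertex) (h : v ≠ w) :
      PathRel K Q (FreeAlgebra.ι K (Sum.inl v) * FreeAlgebra.ι K (Sum.inl w)) 0
  | one : PathRel K Q (∑ v : Q.Vertex, FreeAlgebra.ι K (Sum.inl v)) 1
  | src_mul (a : Q.Arrow) :
      PathRel K Q (FreeAlgebra.ι K (Sum.inl (Q.src a)) * FreeAlgebra.ι K (Sum.inr a))
        (FreeAlgebra.ι K (Sum.inr a))
  | mul_tgt (a : Q.Arrow) :
      PathRel K Q (FreeAlgebra.ι K (Sum.inr a) * FreeAlgebra.ι K (Sum.inl (Q.tgt a)))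
        (FreeAlgebra.ι K (Sum.inr a))

/-- The path algebra `K Q`: generated by the trivial paths `e_v` and the arrows, where the `e_v`
are orthogonal idempotents with sum `1` and `e_{s(a)} a = a = a e_{t(a)}`. A product `a b` of
arrows is the path "first `a`, then `b`" if `t(a) = s(b)`, and `0` otherwise. -/
abbrev FinQuiver.PathAlgebra (K : Type*) [Field K] (Q : FinQuiver) : Type _ :=
  RingQuot (FinQuiver.PathRel K Q)

/-- An arrow as an element of the path algebra. -/
def FinQuiver.arrow (K : Type*) [Field K] (Q : FinQuiver) (a : Q.Arrow) : Q.PathAlgebra K :=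
  RingQuot.mkAlgHom K (FinQuiver.PathRel K Q) (FreeAlgebra.ι K (Sum.inr a))

/-- For a self-map `σ` of the arrows, the product `a σ(a) σ²(a) ⋯` of the arrows of the
`σ`-cycle of `a`, each taken once. -/
def FinQuiver.cycle (K : Type*) [Field K] (Q : FinQuiver) (σ : Q.Arrow → Q.Arrow)
    (a : Q.Arrow) : Q.PathAlgebra K :=
  ((List.range (Function.minimalPeriod σ a)).map (fun i => Q.arrow K (σ^[i] a))).prod

/-! ### Brauer graph algebras -/

/-- A Brauer graph: a finite connected graph with at least one edge (loops and multiple edges are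
allowed), with a cyclic ordering of the edges around each vertex (a loop occurs twice) and a
multiplicity `≥ 1` at each vertex. The two ends of the edge `e` are the half-edges `(e, false)`
and `(e, true)`; the cyclic orderings are the cycles of `next`. -/
structure BrauerGraph where
  Vertex : Type
  Edge : Type
  [fintypeVertex : Fintype Vertex]
  [fintypeEdge : Fintype Edge]
  [nonemptyEdge : Nonempty Edge]
  /-- the vertex to which a half-edge is attached -/
  vert : Edge × Bool → Vertex
  connected : ∀ v w : Vertex,
    Relation.EqvGen (fun x y => ∃ e : Edge, vert (e, false) = x ∧ vert (e, true) = y) v w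
  /-- the successor of a half-edge in the cyclic ordering around its vertex -/
  next : Equiv.Perm (Edge × Bool)
  /-- the half-edges attached to one vertex form one cycle of `next` -/
  sameCycle_iff : ∀ h k, next.SameCycle h k ↔ vert h = vert k
  mult : Vertex → ℕ
  mult_pos : ∀ v, 0 < mult v

attribute [instance] BrauerGraph.fintypeVertex BrauerGraph.fintypeEdge BrauerGraph.nonemptyEdge

namespace BrauerGraph

/-- The Brauer quiver: its vertices are the edges of the graph, and each half-edge `h` gives an
arrow from its edge to the next edge around the vertex of `h`. -/
def quiver (Γ : BrauerGraph) : FinQuiver where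
  Vertex := Γ.Edge
  Arrow := Γ.Edge × Bool
  src h := h.1
  tgt h := (Γ.next h).1

/-- The other half-edge of the same edge, i.e. the other arrow with the same source. -/
def other (Γ : BrauerGraph) (h : Γ.Edge × Bool) : Γ.Edge × Bool := (h.1, !h.2)

/-- The element `C_h ^ e(v(h))`. -/
def cyclePow (K : Type*) [Field K] (Γ : BrauerGraph) (h : Γ.Edge × Bool) :
    Γ.quiver.PathAlgebra K :=
  Γ.quiver.cycle K Γ.next h ^ Γ.mult (Γ.vert h)

/-- The relations of the Brauer graph algebra: paths of length two which do not follow the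
cyclic ordering around a vertex are zero, and
`C_h ^ e(v(h)) = C_{h'} ^ e(v(h'))` for the two half-edges `h`, `h'` of an edge. -/
inductive Rel (K : Type*) [Field K] (Γ : BrauerGraph) :
    Γ.quiver.PathAlgebra K → Γ.quiver.PathAlgebra K → Prop
  | zero (h k : Γ.Edge × Bool) (hk : Γ.quiver.tgt h = Γ.quiver.src k) (hne : k ≠ Γ.next h) :
      Rel K Γ (Γ.quiver.arrow K h * Γ.quiver.arrow K k) 0
  | comm (h : Γ.Edge × Bool) : Rel K Γ (Γ.cyclePow K h) (Γ.cyclePow K (Γ.other h))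

/-- The Brauer graph algebra. -/
abbrev algebra (K : Type*) [Field K] (Γ : BrauerGraph) : Type _ := RingQuot (BrauerGraph.Rel K Γ)

end BrauerGraph

/-! ### The algebras `B(Q, f, m, b)` -/

/-- A 2-regular quiver with a permutation `f` of its arrows with `s(f(a)) = t(a)`. The latter makes
`f` a bijection from the arrows ending at `v` to the arrows starting at `v`, so that every vertex
is the target of exactly two arrows, too. -/
structure TwoRegularQuiver extends FinQuiver where
  f : Equiv.Perm Arrow
  src_f : ∀ a, src (f a) = tgt a
  out_two : ∀ v, {a | src a = v}.ncard = 2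

namespace TwoRegularQuiver

theorem exists_other (Q : TwoRegularQuiver) (a : Q.Arrow) : ∃ b, b ≠ a ∧ Q.src b = Q.src a := by
  obtain ⟨x, y, hxy, h⟩ := Set.ncard_eq_two.1 (Q.out_two (Q.src a))
  have hx : x ∈ {b | Q.src b = Q.src a} := by rw [h]; simp
  have hy : y ∈ {b | Q.src b = Q.src a} := by rw [h]; simp
  by_cases hax : x = a
  · exact ⟨y, fun hya => hxy (hax.trans hya.symm), hy⟩
  · exact ⟨x, hax, hx⟩

/-- The other arrow starting at the source of `a`. -/
def bar (Q : TwoRegularQuiver) (a : Q.Arrow) : Q.Arrow := (Q.exists_other a).choose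

theorem bar_ne (Q : TwoRegularQuiver) (a : Q.Arrow) : Q.bar a ≠ a :=
  (Q.exists_other a).choose_spec.1

theorem src_bar (Q : TwoRegularQuiver) (a : Q.Arrow) : Q.src (Q.bar a) = Q.src a :=
  (Q.exists_other a).choose_spec.2

/-- The permutation `g(a)`, the other arrow starting where `f(a)` starts. -/
def g (Q : TwoRegularQuiver) (a : Q.Arrow) : Q.Arrow := Q.bar (Q.f a)

/-- A weight function: a positive integer for each `g`-orbit. -/
structure WeightFunction (Q : TwoRegularQuiver) where
  toFun : Q.Arrow → ℕ
  pos : ∀ a, 0 < toFun a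
  map_g : ∀ a, toFun (Q.g a) = toFun a

/-- The border: the vertices with a loop fixed by `f`. (An arrow fixed by `f` is a loop.) -/
def border (Q : TwoRegularQuiver) : Set Q.Vertex := {v | ∃ a, Q.src a = v ∧ Q.f a = a}

/-- The element `B_a = (a g(a) ⋯ g^{n_a - 1}(a)) ^ {m_a}`, where `n_a` is the length of the
`g`-orbit of `a`. -/
def cyclePow (K : Type*) [Field K] (Q : TwoRegularQuiver) (m : Q.WeightFunction) (a : Q.Arrow) :
    Q.PathAlgebra K :=
  Q.cycle K Q.g a ^ m.toFun a

/-- The relations of `B(Q, f, m, b)`, for a weight function `m` and a border function `b`. -/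
inductive Rel {K : Type*} [Field K] (Q : TwoRegularQuiver) (m : Q.WeightFunction)
    (b : Q.border → K) : Q.PathAlgebra K → Q.PathAlgebra K → Prop
  | zero (a : Q.Arrow) (h : Q.f a ≠ a) : Rel Q m b (Q.arrow K a * Q.arrow K (Q.f a)) 0
  | border (a : Q.Arrow) (h : Q.f a = a) :
      Rel Q m b (Q.arrow K a * Q.arrow K a) (b ⟨Q.src a, a, rfl, h⟩ • Q.cyclePow K m a)
  | comm (a : Q.Arrow) : Rel Q m b (Q.cyclePow K m a) (Q.cyclePow K m (Q.bar a))

/-- The algebra `B(Q, f, m, b)`. -/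
abbrev algebra {K : Type*} [Field K] (Q : TwoRegularQuiver) (m : Q.WeightFunction)
    (b : Q.border → K) : Type _ :=
  RingQuot (TwoRegularQuiver.Rel Q m b)

end TwoRegularQuiver

/-! ### Directed triangulated surfaces -/

/-- The interior of the standard `n`-simplex. -/
def simplexInterior (n : ℕ) : Set (stdSimplex ℝ (Fin (n + 1))) := {x | ∀ i, 0 < x.1 i}

/-- The open side opposite to the corner `i` of the standard triangle. -/
def openSide (i : Fin 3) : Set (stdSimplex ℝ (Fin 3)) := {x | x.1 i = 0 ∧ ∀ j, j ≠ i → 0 < x.1 j}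

/-- A directed triangulated surface: a compact connected topological surface, with or without
boundary, orientable or not, with a finite triangular cell structure and an arbitrary
orientation of each triangle. The closed cells of dimension `0`, `1`, `2` are parametrized by a
point, a segment and a triangle. Triangles need not be embedded: corners may coincide, and two
sides of a triangle may be the same edge. -/
structure DirectedTriangulatedSurface where
  /-- the underlying surface: a compact connected Hausdorff space locally homeomorphic to the
  half-plane -/
  S : Type
  [topologicalSpace : TopologicalSpace S]
  [t2Space : T2Space S]
  [compactSpace : CompactSpace S]
  [connectedSpace : ConnectedSpace S]
  [chartedSpace : ChartedSpace (EuclideanHalfSpace 2) S]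
  /-- the `0`-cells -/
  Vertex : Type
  /-- the `1`-cells -/
  Edge : Type
  /-- the `2`-cells -/
  Triangle : Type
  [fintypeVertex : Fintype Vertex]
  [fintypeEdge : Fintype Edge]
  [fintypeTriangle : Fintype Triangle]
  vertexMap : Vertex → S
  edgeMap : Edge → stdSimplex ℝ (Fin 2) → S
  triangleMap : Triangle → stdSimplex ℝ (Fin 3) → S
  edgeMap_continuous : ∀ e, Continuous (edgeMap e)
  triangleMap_continuous : ∀ t, Continuous (triangleMap t)
  /-- the characteristic maps are homeomorphisms from the open simplices onto the open cells -/
  edgeMap_isEmbedding : ∀ e, Topology.IsEmbedding ((simplexInterior 1).domRestrict (edgeMap e))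
  triangleMap_isEmbedding :
    ∀ t, Topology.IsEmbedding ((simplexInterior 2).domRestrict (triangleMap t))
  /-- `S` is the disjoint union of the open cells -/
  existsUnique_cell : ∀ p : S, ∃! c : Vertex ⊕ Edge ⊕ Triangle,
    p ∈ Sum.elim (fun v => {vertexMap v}) (Sum.elim (fun e => edgeMap e '' simplexInterior 1)
      (fun t => triangleMap t '' simplexInterior 2)) c
  /-- the end points of edges are vertices -/
  edgeMap_end : ∀ e x, (∃ i, x.1 i = 1) → edgeMap e x ∈ Set.range vertexMap
  /-- the corners of triangles are vertices -/
  triangleMap_corner : ∀ t x, (∃ i, x.1 i = 1) → triangleMap t x ∈ Set.range vertexMap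
  /-- `side t i` is the edge of the triangle `t` opposite to the corner `i` -/
  side : Triangle → Fin 3 → Edge
  /-- each open side of a triangle is mapped bijectively onto an open edge -/
  triangleMap_side : ∀ t i,
    Set.BijOn (triangleMap t) (openSide i) (edgeMap (side t i) '' simplexInterior 1)
  /-- a triangle has two or three different edges -/
  side_ne : ∀ t, ∃ i j, side t i ≠ side t j
  /-- an edge either is a side of two triangles, or two sides of one (self-folded) triangle,
  or is a side of exactly one triangle and lies on the boundary of the surface -/
  edge_incidence : ∀ e,
    ({p : Triangle × Fin 3 | side p.1 p.2 = e}.ncard = 2 ∧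
      ¬ edgeMap e '' simplexInterior 1 ⊆ (𝓡∂ 2).boundary S) ∨
    ({p : Triangle × Fin 3 | side p.1 p.2 = e}.ncard = 1 ∧
      edgeMap e '' simplexInterior 1 ⊆ (𝓡∂ 2).boundary S)
  /-- there are at least two different edges -/
  [nontrivialEdge : Nontrivial Edge]
  /-- the orientation of each triangle: its sides are cyclically ordered as `(0 1 2)` if
  `orientation t` is `true` and as `(2 1 0)` otherwise -/
  orientation : Triangle → Bool

attribute [instance] DirectedTriangulatedSurface.topologicalSpace
  DirectedTriangulatedSurface.t2Space DirectedTriangulatedSurface.compactSpace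
  DirectedTriangulatedSurface.connectedSpace DirectedTriangulatedSurface.chartedSpace
  DirectedTriangulatedSurface.fintypeVertex DirectedTriangulatedSurface.fintypeEdge
  DirectedTriangulatedSurface.fintypeTriangle DirectedTriangulatedSurface.nontrivialEdge

namespace DirectedTriangulatedSurface

/-- The surface has nonempty boundary. -/
def HasBoundary (T : DirectedTriangulatedSurface) : Prop := ((𝓡∂ 2).boundary T.S).Nonempty

/-- No triangle is self-folded: the three sides of each triangle are pairwise different edges. -/
def NoSelfFolded (T : DirectedTriangulatedSurface) : Prop :=
  ∀ t, Function.Injective (T.side t)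

/-- The boundary edges: the edges lying on the boundary of the surface. -/
def boundaryEdges (T : DirectedTriangulatedSurface) : Set T.Edge :=
  {e | T.edgeMap e '' simplexInterior 1 ⊆ (𝓡∂ 2).boundary T.S}

/-- The step in the cyclic order of the sides of an oriented triangle. -/
def step (T : DirectedTriangulatedSurface) (t : T.Triangle) : Fin 3 :=
  if T.orientation t then 1 else -1

/-- The rotation of the sides of the oriented triangles. -/
def rotate (T : DirectedTriangulatedSurface) : Equiv.Perm (T.Triangle × Fin 3) where
  toFun p := (p.1, p.2 + T.step p.1)
  invFun p := (p.1, p.2 - T.step p.1)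
  left_inv p := by simp
  right_inv p := by simp

theorem ncard_src (T : DirectedTriangulatedSurface) (e : T.Edge) :
    {a : (T.Triangle × Fin 3) ⊕ T.boundaryEdges |
      Sum.elim (fun p => T.side p.1 p.2) (fun d => d.1) a = e}.ncard = 2 := by
  have hset : {a : (T.Triangle × Fin 3) ⊕ T.boundaryEdges |
      Sum.elim (fun p => T.side p.1 p.2) (fun d => d.1) a = e} =
      (Sum.inl '' {p : T.Triangle × Fin 3 | T.side p.1 p.2 = e}) ∪
        (Sum.inr '' {d : T.boundaryEdges | d.1 = e}) := by
    ext a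
    rcases a with p | d <;> simp
  have hdisj : Disjoint
      ((Sum.inl '' {p : T.Triangle × Fin 3 | T.side p.1 p.2 = e}) :
        Set ((T.Triangle × Fin 3) ⊕ T.boundaryEdges))
      (Sum.inr '' {d : T.boundaryEdges | d.1 = e}) := by
    rw [Set.disjoint_left]
    rintro _ ⟨p, -, rfl⟩ ⟨d, -, h⟩
    cases h
  rw [hset, Set.ncard_union_eq hdisj (Set.toFinite _) (Set.toFinite _),
    Set.ncard_image_of_injective _ Sum.inl_injective,
    Set.ncard_image_of_injective _ Sum.inr_injective]
  rcases T.edge_incidence e with ⟨h2, hb⟩ | ⟨h1, hb⟩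
  · have : {d : T.boundaryEdges | d.1 = e} = ∅ := by
      ext d
      simp only [Set.mem_ofPred_eq, Set.mem_empty_iff_false, iff_false]
      intro h
      exact hb (h ▸ d.2)
    rw [h2, this, Set.ncard_empty]
  · have : {d : T.boundaryEdges | d.1 = e} = {⟨e, hb⟩} := by
      ext d
      simp [Subtype.ext_iff]
    rw [h1, this, Set.ncard_singleton]

/-- The quiver `Q(S, T)` with its permutation `f`. The vertices are the edges of the
triangulation. An oriented triangle with sides `a, b, c` in this cyclic order gives three arrows
`a → b → c → a`, which are permuted cyclically by `f`; a boundary edge `a` gives a loop at `a`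
which is fixed by `f`. -/
def quiver (T : DirectedTriangulatedSurface) : TwoRegularQuiver where
  Vertex := T.Edge
  Arrow := (T.Triangle × Fin 3) ⊕ T.boundaryEdges
  fintypeArrow := Fintype.ofFinite _
  src := Sum.elim (fun p => T.side p.1 p.2) (fun d => d.1)
  tgt := Sum.elim (fun p => T.side (T.rotate p).1 (T.rotate p).2) (fun d => d.1)
  f := Equiv.sumCongr T.rotate (Equiv.refl _)
  src_f a := by rcases a with p | d <;> rfl
  out_two := T.ncard_src

end DirectedTriangulatedSurface

end

/-! Put g = successor in the cyclic order and f = the other half-edge of that successor. Then the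
Brauer quiver is a 2-regular quiver Q, and B_Γ is B(Q, f, m, 0) (`BrauerGraph.algEquiv`). The
theorem splits into two halves: A ≅ B(Q, f, m, b) for some b, where b = 0 can be achieved if 2 ≠ 0
in K; and Q sits inside the quiver of a triangulated surface.

Algebraic half. As A is symmetric, indecomposable and not semisimple, soc(A)² = 0
(`mul_eq_zero_of_mem_rightSocle`), so the idempotents and arrows of Q lift from A/soc(A) to A, and
the relations hold up to socle elements. The symmetrizing trace t identifies the socle of each e_v A
with K, so every defect of a relation is a scalar. A nonzero defect x_a x_{f a} occurs only if the
path a, f a is closed. It is removed by subtracting from x_a a multiple of the parallel path P for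
which P x_{f a} is a full cycle B (`modified`, `coef_eq`). This works with two exceptions. For an
f-fixed loop the correction enters from both sides, and the equation is t(x_a²) = 2c·t(B_a); when 2
= 0 a multiple of B_a may survive in x_a², and this is the only source of b. For a 2-cycle of f with
both cycles B of length two there is no suitable P; then Q has just two vertices and four arrows,
and a change of basis among parallel arrows works (`exists_weakRep_of_len_eq_two`). Finally roots in
K rescale all B_a to the normalized socle generators (`exists_isRep`).

The resulting map B(Q, f, m, b) → A is injective because it does not kill the socle elements
(`injective_of_socElt_ne_zero`), and the dimensions agree since B(Q, f, m, b) has a basis of g-paths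
independent of b (`coordEquiv`). That basis comes from an explicit regular representation
(`isRep_arrowMul`). The condition on K₀ excludes a Brauer graph with one edge, because A would then
be local. With two edges or more, connectedness prevents two loops at one vertex, hence B_a has
length at least three for an f-fixed loop a. Now b = 0 would give A ≅ B_Γ; so b ≠ 0, and therefore 2
= 0.

Geometric half. The cycles of f need not have length three. Each arrow h moved by f is replaced by a
strip of five triangles leading from the segment of the source of h to that of f(h). The links of
all vertices are paths, so the strips form a surface with boundary. The vertices of Q are certain
edges of it, the f-fixed loops are border loops, and g is the first return map of the g of the
surface (`firstReturn`). Hence B(Q, f, m, b) is the corner algebra at the sum of the idempotents of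
these edges (`nonempty_algEquiv_corner`). -/

noncomputable section

/-! ### Combinatorics of f, g and bar; universal properties of path algebras and of B(Q, f, m, b).
-/

namespace TwoRegularQuiver

/-! ### Combinatorics of the permutations `f`, `g` and the involution `bar` -/

section Combinatorics

variable {Q : TwoRegularQuiver}

theorem eq_or_eq_bar {a b : Q.Arrow} (h : Q.src b = Q.src a) : b = a ∨ b = Q.bar a := by
  obtain ⟨x, y, hxy, hs⟩ := Set.ncard_eq_two.1 (Q.out_two (Q.src a))
  have key : ∀ c, Q.src c = Q.src a → c = x ∨ c = y := fun c hc => by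
    have : c ∈ {b | Q.src b = Q.src a} := hc
    rw [hs] at this
    simpa using this
  have h1 := key a rfl
  have h2 := key b h
  have h3 := key _ (Q.src_bar a)
  have h4 := Q.bar_ne a
  grind

theorem bar_eq_of_ne {a b : Q.Arrow} (h : Q.src b = Q.src a) (hne : b ≠ a) : Q.bar a = b :=
  ((eq_or_eq_bar h).resolve_left hne).symm

@[simp] theorem bar_bar (a : Q.Arrow) : Q.bar (Q.bar a) = a :=
  bar_eq_of_ne (Q.src_bar a).symm (Q.bar_ne a).symm

theorem bar_injective : Function.Injective Q.bar := fun a b h => by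
  rw [← bar_bar a, h, bar_bar]

@[simp] theorem src_g (a : Q.Arrow) : Q.src (Q.g a) = Q.tgt a := by
  rw [g, src_bar, src_f]

@[simp] theorem bar_g (a : Q.Arrow) : Q.bar (Q.g a) = Q.f a := bar_bar _

theorem g_ne_f (a : Q.Arrow) : Q.g a ≠ Q.f a := Q.bar_ne _

theorem g_injective : Function.Injective Q.g := fun _ _ h => Q.f.injective (bar_injective h)

theorem g_surjective : Function.Surjective Q.g := fun a =>
  ⟨Q.f.symm (Q.bar a), by simp [g]⟩

theorem eq_g_or_eq_f {a b : Q.Arrow} (h : Q.src b = Q.tgt a) : b = Q.g a ∨ b = Q.f a := by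
  rw [← Q.src_f] at h
  exact (eq_or_eq_bar h).symm

theorem tgt_eq_src_of_f_eq {a : Q.Arrow} (h : Q.f a = a) : Q.tgt a = Q.src a := by
  rw [← Q.src_f, h]

theorem g_eq_bar_of_f_eq {a : Q.Arrow} (h : Q.f a = a) : Q.g a = Q.bar a := by rw [g, h]

/-- No vertex carries two loops. -/
def NoDoubleLoop (Q : TwoRegularQuiver) : Prop :=
  ∀ a, Q.tgt a = Q.src a → Q.tgt (Q.bar a) ≠ Q.src a

theorem NoDoubleLoop.f_bar_ne (hQ : Q.NoDoubleLoop) {a : Q.Arrow} (h : Q.f a = a) :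
    Q.f (Q.bar a) ≠ Q.bar a := fun h' =>
  hQ a (tgt_eq_src_of_f_eq h) (by rw [tgt_eq_src_of_f_eq h', src_bar])

variable (m : Q.WeightFunction)

/-- The length `m_a n_a` of the path `B_a`. -/
def len (a : Q.Arrow) : ℕ := Function.minimalPeriod Q.g a * m.toFun a

theorem minimalPeriod_pos (a : Q.Arrow) : 0 < Function.minimalPeriod Q.g a :=
  Function.minimalPeriod_pos_of_mem_periodicPts (g_injective.mem_periodicPts a)

theorem len_pos (a : Q.Arrow) : 0 < len m a := Nat.mul_pos (minimalPeriod_pos a) (m.pos a)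

theorem minimalPeriod_g (a : Q.Arrow) :
    Function.minimalPeriod Q.g (Q.g a) = Function.minimalPeriod Q.g a :=
  Function.minimalPeriod_apply (g_injective.mem_periodicPts a)

@[simp] theorem len_g (a : Q.Arrow) : len m (Q.g a) = len m a := by
  rw [len, len, minimalPeriod_g, m.map_g]

@[simp] theorem len_iterate (a : Q.Arrow) (i : ℕ) : len m (Q.g^[i] a) = len m a := by
  induction i with
  | zero => rfl
  | succ i ih => rw [Function.iterate_succ_apply', len_g, ih]

@[simp] theorem iterate_len (a : Q.Arrow) : Q.g^[len m a] a = a :=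
  (Function.isPeriodicPt_minimalPeriod Q.g a).mul_const _

theorem g_iterate_len_sub_one (a : Q.Arrow) : Q.g (Q.g^[len m a - 1] a) = a := by
  rw [← Function.iterate_succ_apply' Q.g, Nat.succ_eq_add_one, Nat.sub_add_cancel (len_pos m a),
    iterate_len]

theorem g_eq_of_len_eq_one {a : Q.Arrow} (h : len m a = 1) : Q.g a = a := by
  have := iterate_len m a
  rwa [h] at this

theorem g_g_eq_of_len_eq_two {a : Q.Arrow} (h : len m a = 2) : Q.g (Q.g a) = a := by
  have := iterate_len m a
  rwa [h] at this

/-- The g-orbit of an f-fixed loop a starts with a, bar a. Length one would give bar a = a, and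
length two would make bar a a second loop. So the relation a² = b·B_a sends a² strictly deeper than
degree two. -/
theorem NoDoubleLoop.three_le_len (hQ : Q.NoDoubleLoop) {a : Q.Arrow} (h : Q.f a = a) :
    3 ≤ len m a := by
  have hb := g_eq_bar_of_f_eq h
  have h0 := len_pos m a
  by_contra hlt
  obtain h1 | h2 : len m a = 1 ∨ len m a = 2 := by omega
  · exact Q.bar_ne a (hb ▸ g_eq_of_len_eq_one m h1)
  · have h2 := g_g_eq_of_len_eq_two m h2
    rw [hb] at h2
    refine hQ a (tgt_eq_src_of_f_eq h) ?_
    rw [← src_g, h2]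

end Combinatorics

/-! ### Products along `g`-paths -/

section PathProd

variable {Q : TwoRegularQuiver} {R : Type*} [Monoid R]

/-- The product `x_h x_{g(h)} ⋯ x_{g^{i-1}(h)}`. -/
def pathProd (x : Q.Arrow → R) (h : Q.Arrow) (i : ℕ) : R :=
  ((List.range i).map (fun j => x (Q.g^[j] h))).prod

variable (x : Q.Arrow → R) (h : Q.Arrow)

@[simp] theorem pathProd_zero : pathProd x h 0 = 1 := rfl

theorem pathProd_succ (i : ℕ) : pathProd x h (i + 1) = x h * pathProd x (Q.g h) i := by
  simp [pathProd, List.range_succ_eq_map, Function.comp_def]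

@[simp] theorem pathProd_one : pathProd x h 1 = x h := by simp [pathProd_succ]

theorem pathProd_add (i j : ℕ) :
    pathProd x h (i + j) = pathProd x h i * pathProd x (Q.g^[i] h) j := by
  induction i generalizing h with
  | zero => simp
  | succ i ih =>
    rw [Nat.add_right_comm, pathProd_succ, ih, pathProd_succ, mul_assoc, Function.iterate_succ_apply]

theorem pathProd_succ' (i : ℕ) : pathProd x h (i + 1) = pathProd x h i * x (Q.g^[i] h) := by
  rw [pathProd_add, pathProd_one]

theorem map_pathProd {S F : Type*} [Monoid S] [FunLike F R S] [MonoidHomClass F R S] (φ : F) (i : ℕ) :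
    φ (pathProd x h i) = pathProd (fun a => φ (x a)) h i := by
  simp [pathProd, map_list_prod, Function.comp_def]

theorem pathProd_len (m : Q.WeightFunction) :
    pathProd x h (len m h) = pathProd x h (Function.minimalPeriod Q.g h) ^ m.toFun h := by
  rw [len]
  generalize m.toFun h = k
  induction k with
  | zero => simp
  | succ k ih =>
    rw [Nat.mul_succ, pathProd_add, ih, pow_succ,
      ((Function.isPeriodicPt_minimalPeriod Q.g h).mul_const k).eq]

end PathProd

end TwoRegularQuiver

/-! ### Universal property of the path algebra -/

namespace FinQuiver

/-- A trivial path as an element of the path algebra. -/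
def triv (K : Type*) [Field K] (Q : FinQuiver) (v : Q.Vertex) : Q.PathAlgebra K :=
  RingQuot.mkAlgHom K (FinQuiver.PathRel K Q) (FreeAlgebra.ι K (Sum.inl v))

/-- Elements `e v`, `x a` of a ring which satisfy the relations of the path algebra. -/
structure IsRep (Q : FinQuiver) {R : Type*} [Ring R] (e : Q.Vertex → R) (x : Q.Arrow → R) :
    Prop where
  idem : ∀ v, e v * e v = e v
  orth : ∀ v w, v ≠ w → e v * e w = 0
  sum : ∑ v, e v = 1
  src_mul : ∀ a, e (Q.src a) * x a = x a
  mul_tgt : ∀ a, x a * e (Q.tgt a) = x a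

namespace IsRep

variable {Q : FinQuiver} {R : Type*} [Ring R] {e : Q.Vertex → R} {x : Q.Arrow → R}

theorem mul_eq_zero (h : Q.IsRep e x) {a b : Q.Arrow} (hab : Q.src b ≠ Q.tgt a) :
    x a * x b = 0 := by
  rw [← h.mul_tgt a, ← h.src_mul b, mul_assoc, ← mul_assoc (e _) (e _), h.orth _ _ hab.symm,
    zero_mul, mul_zero]

theorem e_mul_eq_zero (h : Q.IsRep e x) {v : Q.Vertex} {a : Q.Arrow} (hab : Q.src a ≠ v) :
    e v * x a = 0 := by
  rw [← h.src_mul a, ← mul_assoc, h.orth _ _ hab.symm, zero_mul]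

theorem mul_e_eq_zero (h : Q.IsRep e x) {v : Q.Vertex} {a : Q.Arrow} (hab : Q.tgt a ≠ v) :
    x a * e v = 0 := by
  rw [← h.mul_tgt a, mul_assoc, h.orth _ _ hab, mul_zero]

theorem map (h : Q.IsRep e x) {S F : Type*} [Ring S] [FunLike F R S] [RingHomClass F R S] (φ : F) :
    Q.IsRep (fun v => φ (e v)) (fun a => φ (x a)) where
  idem v := by rw [← map_mul, h.idem]
  orth v w hvw := by rw [← map_mul, h.orth v w hvw, map_zero]
  sum := by rw [← map_sum, h.sum, map_one]
  src_mul a := by rw [← map_mul, h.src_mul]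
  mul_tgt a := by rw [← map_mul, h.mul_tgt]

variable {K : Type*} [Field K] [Algebra K R]

/-- The algebra homomorphism from the path algebra defined by a family satisfying its relations. -/
def lift (h : Q.IsRep e x) : Q.PathAlgebra K →ₐ[K] R :=
  RingQuot.liftAlgHom K ⟨FreeAlgebra.lift K (Sum.elim e x), by
    intro a b hab
    induction hab with
    | idem v => simp [h.idem]
    | orth v w hvw => simp [h.orth v w hvw]
    | one => simp [h.sum]
    | src_mul a => simp [h.src_mul]
    | mul_tgt a => simp [h.mul_tgt]⟩

@[simp] theorem lift_triv (h : Q.IsRep e x) (v : Q.Vertex) : h.lift (Q.triv K v) = e v := by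
  simp [lift, triv]

@[simp] theorem lift_arrow (h : Q.IsRep e x) (a : Q.Arrow) : h.lift (Q.arrow K a) = x a := by
  simp [lift, arrow]

end IsRep

variable {Q : FinQuiver} (K : Type*) [Field K]

theorem isRep_path : Q.IsRep (Q.triv K) (Q.arrow K) where
  idem v := by
    simp only [triv, ← map_mul]; exact RingQuot.mkAlgHom_rel K (.idem v)
  orth v w h := by
    simp only [triv, ← map_mul]; rw [RingQuot.mkAlgHom_rel K (.orth v w h), map_zero]
  sum := by
    simp only [triv, ← map_sum]; rw [RingQuot.mkAlgHom_rel K .one, map_one]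
  src_mul a := by
    simp only [triv, arrow, ← map_mul]; exact RingQuot.mkAlgHom_rel K (.src_mul a)
  mul_tgt a := by
    simp only [triv, arrow, ← map_mul]; exact RingQuot.mkAlgHom_rel K (.mul_tgt a)

theorem mem_of_triv_of_arrow (S : Subalgebra K (Q.PathAlgebra K)) (h1 : ∀ v, Q.triv K v ∈ S)
    (h2 : ∀ a, Q.arrow K a ∈ S) (x : Q.PathAlgebra K) : x ∈ S := by
  obtain ⟨y, rfl⟩ := RingQuot.mkAlgHom_surjective K (FinQuiver.PathRel K Q) x
  induction y using FreeAlgebra.induction with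
  | grade0 r => simp
  | grade1 i => rcases i with v | a; exacts [h1 v, h2 a]
  | mul a b ha hb => rw [map_mul]; exact S.mul_mem ha hb
  | add a b ha hb => rw [map_add]; exact S.add_mem ha hb

end FinQuiver

namespace TwoRegularQuiver

/-! ### Universal property of `B(Q, f, m, b)` -/

variable {K : Type*} [Field K] {Q : TwoRegularQuiver} {m : Q.WeightFunction}

/-- Elements `e v`, `x a` of an algebra which satisfy the relations of `B(Q, f, m, b)`. -/
structure IsRep (m : Q.WeightFunction) (b : Q.border → K) {R : Type*} [Ring R] [Algebra K R]
    (e : Q.Vertex → R) (x : Q.Arrow → R) : Prop extends Q.toFinQuiver.IsRep e x where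
  zero : ∀ a, Q.f a ≠ a → x a * x (Q.f a) = 0
  border : ∀ a (h : Q.f a = a), x a * x a = b ⟨Q.src a, a, rfl, h⟩ • pathProd x a (len m a)
  comm : ∀ a, pathProd x a (len m a) = pathProd x (Q.bar a) (len m (Q.bar a))

theorem cyclePow_eq (a : Q.Arrow) : Q.cyclePow K m a = pathProd (Q.arrow K) a (len m a) := by
  rw [pathProd_len]; rfl

/-- The algebra homomorphism from `B(Q, f, m, b)` defined by a family satisfying its relations. -/
def IsRep.lift {b : Q.border → K} {R : Type*} [Ring R] [Algebra K R] {e : Q.Vertex → R}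
    {x : Q.Arrow → R} (h : IsRep m b e x) : Q.algebra m b →ₐ[K] R :=
  RingQuot.liftAlgHom K ⟨h.toIsRep.lift, by
    have key : ∀ a, h.toIsRep.lift (Q.cyclePow K m a) = pathProd x a (len m a) := fun a => by
      rw [cyclePow_eq, map_pathProd]
      simp
    intro y z hyz
    induction hyz with
    | zero a ha => simp [h.zero a ha]
    | border a ha => simp [h.border a ha, key]
    | comm a => rw [key, key, h.comm]⟩

variable (m) (b : Q.border → K)

/-- The primitive idempotent of `B(Q, f, m, b)` at a vertex. -/
def idem (v : Q.Vertex) : Q.algebra m b := RingQuot.mkAlgHom K (Rel Q m b) (Q.triv K v)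

/-- An arrow as an element of `B(Q, f, m, b)`. -/
def gen (a : Q.Arrow) : Q.algebra m b := RingQuot.mkAlgHom K (Rel Q m b) (Q.arrow K a)

theorem isRep_gen : IsRep m b (idem m b) (gen m b) where
  toIsRep := (FinQuiver.isRep_path K).map (RingQuot.mkAlgHom K (Rel Q m b))
  zero a h := by
    simp only [gen, ← map_mul]
    rw [RingQuot.mkAlgHom_rel K (Rel.zero a h), map_zero]
  border a h := by
    have := RingQuot.mkAlgHom_rel K (Rel.border (Q := Q) (m := m) (b := b) a h)
    rw [cyclePow_eq, map_smul, map_pathProd, map_mul] at this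
    exact this
  comm a := by
    have := RingQuot.mkAlgHom_rel K (Rel.comm (Q := Q) (m := m) (b := b) a)
    rw [cyclePow_eq, cyclePow_eq, map_pathProd, map_pathProd] at this
    exact this

variable {m b}

@[simp] theorem IsRep.lift_idem {R : Type*} [Ring R] [Algebra K R] {e : Q.Vertex → R}
    {x : Q.Arrow → R} (h : IsRep m b e x) (v : Q.Vertex) : h.lift (idem m b v) = e v := by
  simp [lift, idem]

@[simp] theorem IsRep.lift_gen {R : Type*} [Ring R] [Algebra K R] {e : Q.Vertex → R}
    {x : Q.Arrow → R} (h : IsRep m b e x) (a : Q.Arrow) : h.lift (gen m b a) = x a := by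
  simp [lift, gen]

theorem IsRep.lift_pathProd {R : Type*} [Ring R] [Algebra K R] {e : Q.Vertex → R}
    {x : Q.Arrow → R} (h : IsRep m b e x) (a : Q.Arrow) (i : ℕ) :
    h.lift (pathProd (gen m b) a i) = pathProd x a i := by
  rw [map_pathProd]
  simp

theorem mem_of_idem_of_gen (S : Subalgebra K (Q.algebra m b)) (h1 : ∀ v, idem m b v ∈ S)
    (h2 : ∀ a, gen m b a ∈ S) (x : Q.algebra m b) : x ∈ S := by
  obtain ⟨y, rfl⟩ := RingQuot.mkAlgHom_surjective K (Rel Q m b) x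
  exact FinQuiver.mem_of_triv_of_arrow K (S.comap (RingQuot.mkAlgHom K (Rel Q m b))) h1 h2 y

end TwoRegularQuiver

end

/-! ### The left regular representation of B(Q, f, m, b) on coordinate vectors. -/

noncomputable section

namespace TwoRegularQuiver

open scoped Classical in
theorem exists_src (Q : TwoRegularQuiver) (v : Q.Vertex) : ∃ a, Q.src a = v := by
  obtain ⟨x, y, -, h⟩ := Set.ncard_eq_two.1 (Q.out_two v)
  have hx : x ∈ {b | Q.src b = v} := by rw [h]; simp
  exact ⟨x, hx⟩

/-- An arrow starting at `v`. -/
def out (Q : TwoRegularQuiver) (v : Q.Vertex) : Q.Arrow := (Q.exists_src v).choose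

@[simp] theorem src_out (Q : TwoRegularQuiver) (v : Q.Vertex) : Q.src (Q.out v) = v :=
  (Q.exists_src v).choose_spec

/-! ### The left regular representation -/

/-- Labels for a basis of `B(Q, f, m, b)`: trivial paths, socle elements, and the paths
`h g(h) ⋯ g^i(h)` of length `i + 1`. -/
inductive BasisIndex (Q : TwoRegularQuiver) where
  | top (v : Q.Vertex)
  | soc (v : Q.Vertex)
  | mid (h : Q.Arrow) (i : ℕ)

open BasisIndex
open scoped Classical

variable {K : Type*} [Field K] {Q : TwoRegularQuiver} (m : Q.WeightFunction) (b : Q.border → K)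

/-- The basis vector corresponding to `h g(h) ⋯ g^{i-1}(h)`. -/
def word (K : Type*) [Field K] (h : Q.Arrow) (i : ℕ) : BasisIndex Q →₀ K :=
  -- A path of length `i` has index `i - 1`. The indices `mid h j` with `len m h ≤ j + 1` are
  -- spurious: no word uses them, and `coordSpace` leaves them out.
  if i = 0 then .single (top (Q.src h)) 1 else if i < len m h then .single (mid h (i - 1)) 1
  else if i = len m h then .single (soc (Q.src h)) 1 else 0

theorem word_mid {h : Q.Arrow} {i : ℕ} (h0 : i ≠ 0) (hi : i < len m h) :
    word m K h i = .single (mid h (i - 1)) 1 := by simp [word, h0, hi]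

theorem word_len (h : Q.Arrow) : word m K h (len m h) = .single (soc (Q.src h)) 1 := by
  simp [word, (len_pos m h).ne']

theorem word_eq_zero {h : Q.Arrow} {i : ℕ} (hi : len m h < i) : word m K h i = 0 := by
  have := len_pos m h
  simp [word, show i ≠ 0 by omega, show ¬ i < len m h by omega, show i ≠ len m h by omega]

/-- The coefficient of `B_a` in `a * a`: the value of the border function if `a` is a border loop,
and `0` otherwise. -/
def borderCoef (a : Q.Arrow) : K := if h : Q.f a = a then b ⟨Q.src a, a, rfl, h⟩ else 0

theorem borderCoef_of_ne {a : Q.Arrow} (h : Q.f a ≠ a) : borderCoef b a = 0 := dif_neg h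

/-- Left multiplication by an arrow. -/
def arrowMul (a : Q.Arrow) : (BasisIndex Q →₀ K) →ₗ[K] (BasisIndex Q →₀ K) :=
  Finsupp.linearCombination K fun
    | top v => if Q.tgt a = v then word m K a 1 else 0
    | soc _ => 0
    | mid h i => if Q.g a = h then word m K a (i + 2) else
        if h = a ∧ i = 0 then .single (soc (Q.src a)) (borderCoef b a) else 0

/-- Left multiplication by a trivial path. -/
def idemMul (K : Type*) [Field K] (v : Q.Vertex) :
    (BasisIndex Q →₀ K) →ₗ[K] (BasisIndex Q →₀ K) :=
  Finsupp.linearCombination K fun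
    | top u => if u = v then .single (top u) 1 else 0
    | soc u => if u = v then .single (soc u) 1 else 0
    | mid h i => if Q.src h = v then .single (mid h i) 1 else 0

theorem arrowMul_top (a : Q.Arrow) (v : Q.Vertex) :
    arrowMul m b a (.single (top v) 1) = if Q.tgt a = v then word m K a 1 else 0 := by
  simp [arrowMul]

theorem arrowMul_soc (a : Q.Arrow) (v : Q.Vertex) (c : K) :
    arrowMul m b a (.single (soc v) c) = 0 := by
  simp [arrowMul]

theorem arrowMul_mid (a h : Q.Arrow) (i : ℕ) :
    arrowMul m b a (.single (mid h i) 1) = if Q.g a = h then word m K a (i + 2) else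
        if h = a ∧ i = 0 then .single (soc (Q.src a)) (borderCoef b a) else 0 := by
  simp [arrowMul]

theorem two_le_len {a : Q.Arrow} (h : Q.f a = a) : 2 ≤ len m a := by
  have h0 := len_pos m a
  by_contra hlt
  have h1 := g_eq_of_len_eq_one m (show len m a = 1 by omega)
  exact Q.g_ne_f a (h1.trans h.symm)

/-- Truncation at `len m h` is compatible with multiplication because `len` is constant on g-orbits.
The border branch concerns words of length one, which are not yet in the socle, since an f-fixed
loop has `len` at least two. -/
theorem arrowMul_word (a h : Q.Arrow) {i : ℕ} (hi : i ≠ 0) :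
    arrowMul m b a (word m K h i) = if Q.g a = h then word m K a (i + 1) else
        if h = a ∧ i = 1 then .single (soc (Q.src a)) (borderCoef b a) else 0 := by
  rcases lt_or_ge i (len m h) with hlt | hge
  · obtain ⟨i, rfl⟩ := Nat.exists_eq_succ_of_ne_zero hi
    rw [word_mid m hi hlt, arrowMul_mid]
    simp
  · have h0 : arrowMul m b a (word m K h i) = 0 := by
      rcases hge.eq_or_lt with rfl | hgt
      · rw [word_len, arrowMul_soc]
      · rw [word_eq_zero m hgt, map_zero]
    rw [h0]
    split_ifs with h1 h2
    · rw [word_eq_zero]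
      rw [← len_g, h1]; omega
    · obtain ⟨rfl, rfl⟩ := h2
      by_cases h3 : Q.f h = h
      · have := two_le_len m h3
        omega
      · simp [borderCoef_of_ne b h3]
    · rfl

theorem arrowMul_mid_eq (a h : Q.Arrow) (i : ℕ) :
    arrowMul m b a (.single (mid h i) 1) = arrowMul m b a (word m K h (i + 1)) := by
  rw [arrowMul_mid, arrowMul_word _ _ _ _ i.succ_ne_zero]
  simp

/-- A product of two or more arrows never sees the border term: that term is a socle vector, and the
next arrow on the left kills it. -/
theorem pathProd_arrowMul_word (a h : Q.Arrow) {i : ℕ} (hi : i ≠ 0) (j : ℕ) :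
    pathProd (arrowMul m b) a (j + 2) (word m K h i) =
      if Q.g^[j + 2] a = h then word m K a (i + (j + 2)) else 0 := by
  induction j generalizing a with
  | zero =>
    rw [pathProd_succ, pathProd_one, Module.End.mul_apply, arrowMul_word _ _ _ _ hi]
    by_cases h1 : Q.g (Q.g a) = h
    · simp [h1, arrowMul_word, add_assoc]
    · simp only [h1, if_false]
      split_ifs <;> simp_all [arrowMul_soc, -src_g]
  | succ j ih =>
    rw [pathProd_succ, Module.End.mul_apply, ih]
    rw [← Function.iterate_succ_apply, show (j + 2).succ = j + 1 + 2 from rfl]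
    split_ifs
    · rw [arrowMul_word _ _ _ _ (by omega), if_pos rfl]
      rfl
    · exact map_zero _

theorem pathProd_arrowMul_top (a : Q.Arrow) (v : Q.Vertex) (j : ℕ) :
    pathProd (arrowMul m b) a (j + 1) (.single (top v) 1) =
      if Q.src (Q.g^[j + 1] a) = v then word m K a (j + 1) else 0 := by
  induction j generalizing a with
  | zero => simp [arrowMul_top]
  | succ j ih =>
    rw [pathProd_succ, Module.End.mul_apply, ih]
    rw [← Function.iterate_succ_apply, Nat.succ_eq_add_one]
    split_ifs
    · rw [arrowMul_word _ _ _ _ (by omega), if_pos rfl]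
    · exact map_zero _

theorem pathProd_len_arrowMul_top (a : Q.Arrow) (v : Q.Vertex) :
    pathProd (arrowMul m b) a (len m a) (.single (top v) 1) =
      if Q.src a = v then .single (soc (Q.src a)) 1 else 0 := by
  obtain ⟨j, hj⟩ := Nat.exists_eq_succ_of_ne_zero (len_pos m a).ne'
  have := pathProd_arrowMul_top m b a v j
  rwa [← Nat.succ_eq_add_one, ← hj, iterate_len, word_len] at this

theorem pathProd_len_arrowMul_word (a h : Q.Arrow) {i : ℕ} (hi : i ≠ 0) :
    pathProd (arrowMul m b) a (len m a) (word m K h i) = 0 := by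
  obtain ⟨j, hj⟩ | h1 : (∃ j, len m a = j + 2) ∨ len m a = 1 := by
    have := len_pos m a
    rcases h : len m a with _ | _ | j
    · omega
    · simp
    · exact .inl ⟨j, rfl⟩
  · rw [hj, pathProd_arrowMul_word _ _ _ _ hi, word_eq_zero _ (by omega), ite_self]
  · have hf : Q.f a ≠ a := fun h2 => by
      have := two_le_len m h2
      omega
    rw [h1, pathProd_one, arrowMul_word _ _ _ _ hi, word_eq_zero _ (by omega),
      borderCoef_of_ne b hf, Finsupp.single_zero, ite_self, ite_self]

theorem pathProd_len_arrowMul_soc (a : Q.Arrow) (v : Q.Vertex) :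
    pathProd (arrowMul m b) a (len m a) (.single (soc v) 1) = 0 := by
  rw [← src_out Q v, ← word_len m, pathProd_len_arrowMul_word]
  exact (len_pos m _).ne'

theorem pathProd_arrowMul_mid (a h : Q.Arrow) (i : ℕ) {j : ℕ} (hj : j ≠ 0) :
    pathProd (arrowMul m b) a j (.single (mid h i) 1) =
      pathProd (arrowMul m b) a j (word m K h (i + 1)) := by
  obtain ⟨j, rfl⟩ := Nat.exists_eq_succ_of_ne_zero hj
  rw [pathProd_succ', Module.End.mul_apply, Module.End.mul_apply, arrowMul_mid_eq]

theorem hom_ext_word {φ ψ : (BasisIndex Q →₀ K) →ₗ[K] (BasisIndex Q →₀ K)}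
    (h1 : ∀ v, φ (.single (top v) 1) = ψ (.single (top v) 1))
    (h2 : ∀ v, φ (.single (soc v) 1) = ψ (.single (soc v) 1))
    (h3 : ∀ h i, φ (.single (mid h i) 1) = ψ (.single (mid h i) 1)) : φ = ψ := by
  refine Finsupp.lhom_ext' fun j => LinearMap.ext_ring ?_
  rcases j with v | v | ⟨h, i⟩
  exacts [h1 v, h2 v, h3 h i]

theorem idemMul_word (v : Q.Vertex) (h : Q.Arrow) (i : ℕ) :
    idemMul K v (word m K h i) = if Q.src h = v then word m K h i else 0 := by
  rw [word]
  split_ifs <;> simp_all [idemMul]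

theorem idemMul_soc (v u : Q.Vertex) (c : K) :
    idemMul K v (.single (soc u) c) = if u = v then .single (soc u) c else 0 := by
  split_ifs <;> simp_all [idemMul]

theorem idemMul_mul_arrowMul (a : Q.Arrow) (v : Q.Vertex) : idemMul K v * arrowMul m b a =
    if Q.src a = v then arrowMul m b a else 0 := by
  refine hom_ext_word (fun u => ?_) (fun u => ?_) (fun h i => ?_)
  · rw [Module.End.mul_apply, arrowMul_top]
    split_ifs <;> simp_all [idemMul_word, arrowMul_top]
  · rw [Module.End.mul_apply, arrowMul_soc]
    split_ifs <;> simp_all [arrowMul_soc]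
  · rw [Module.End.mul_apply, show (if Q.src a = v then arrowMul m b a else 0)
      (.single (mid h i) 1) = if Q.src a = v then arrowMul m b a (.single (mid h i) 1) else 0 by
        split_ifs <;> rfl, arrowMul_mid]
    split_ifs <;> simp_all [idemMul_word, idemMul_soc]

/-- The defining relations hold on all vectors, even the spurious ones, and for every `b`. This
makes the g-paths of B(Q, f, m, b) linearly independent. -/
theorem isRep_arrowMul : IsRep m b (idemMul K) (arrowMul m b) where
  idem v := hom_ext_word (fun u => by by_cases h : u = v <;> simp [idemMul, h])
    (fun u => by by_cases h : u = v <;> simp [idemMul, h])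
    (fun h i => by by_cases h : Q.src h = v <;> simp [idemMul, h])
  orth v w hvw := hom_ext_word
    (fun u => by by_cases h : u = w <;> simp [idemMul, h]; exact hvw.symm)
    (fun u => by by_cases h : u = w <;> simp [idemMul, h]; exact hvw.symm)
    (fun h i => by by_cases h : Q.src h = w <;> simp [idemMul, h]; exact hvw.symm)
  sum := hom_ext_word (fun u => by simp [idemMul])
    (fun u => by simp [idemMul]) (fun h i => by simp [idemMul])
  src_mul a := by rw [idemMul_mul_arrowMul, if_pos rfl]
  mul_tgt a := hom_ext_word
    (fun u => by by_cases h : u = Q.tgt a <;> simp [idemMul, arrowMul, h, eq_comm])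
    (fun u => by by_cases h : u = Q.tgt a <;> simp [idemMul, arrowMul, h])
    (fun h i => by
      rw [Module.End.mul_apply, arrowMul_mid]
      have hm : idemMul K (Q.tgt a) (.single (mid h i) 1) =
        if Q.src h = Q.tgt a then .single (mid h i) 1 else 0 := by simp [idemMul]
      rw [hm]
      by_cases h1 : Q.src h = Q.tgt a
      · rw [if_pos h1, arrowMul_mid]
      · rw [if_neg h1, map_zero, if_neg (fun h2 => h1 (by rw [← h2, src_g]))]
        split_ifs with h3
        · obtain ⟨rfl, -⟩ := h3
          rw [borderCoef_of_ne, Finsupp.single_zero]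
          exact fun h4 => h1 (tgt_eq_src_of_f_eq h4).symm
        · rfl)
  zero a ha := by
    refine hom_ext_word (fun u => ?_) (fun u => ?_) (fun h i => ?_)
    · rw [Module.End.mul_apply, arrowMul_top]
      split_ifs
      · rw [arrowMul_word _ _ _ _ one_ne_zero, if_neg (Q.g_ne_f a), if_neg (fun h => ha h.1)]
        rfl
      · simp
    · rw [Module.End.mul_apply, arrowMul_soc, map_zero]; rfl
    · rw [Module.End.mul_apply, arrowMul_mid]
      split_ifs
      · rw [arrowMul_word _ _ _ _ (by omega), if_neg (Q.g_ne_f a), if_neg (fun h => ha h.1)]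
        rfl
      · rw [arrowMul_soc]; rfl
      · simp
  border a ha := by
    have hg : Q.g a ≠ a := fun h => Q.g_ne_f a (h.trans ha.symm)
    refine hom_ext_word (fun u => ?_) (fun u => ?_) (fun h i => ?_)
    · rw [Module.End.mul_apply, arrowMul_top, LinearMap.smul_apply, pathProd_len_arrowMul_top,
        tgt_eq_src_of_f_eq ha]
      split_ifs
      · rw [arrowMul_word _ _ _ _ one_ne_zero, if_neg hg, if_pos ⟨rfl, rfl⟩]
        simp [borderCoef, ha]
      · simp
    · rw [Module.End.mul_apply, arrowMul_soc, LinearMap.smul_apply, pathProd_len_arrowMul_soc]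
      simp
    · rw [LinearMap.smul_apply, pathProd_arrowMul_mid _ _ _ _ _ (len_pos m a).ne',
        pathProd_len_arrowMul_word _ _ _ _ i.succ_ne_zero, smul_zero, Module.End.mul_apply,
        arrowMul_mid]
      split_ifs
      · rw [arrowMul_word _ _ _ _ (by omega), if_neg hg, if_neg (by omega)]
      · rw [arrowMul_soc]
      · simp
  comm a := by
    refine hom_ext_word (fun u => ?_) (fun u => ?_) (fun h i => ?_)
    · simp only [pathProd_len_arrowMul_top, src_bar]
    · simp only [pathProd_len_arrowMul_soc]
    · rw [pathProd_arrowMul_mid _ _ _ _ _ (len_pos m a).ne',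
        pathProd_arrowMul_mid _ _ _ _ _ (len_pos m _).ne',
        pathProd_len_arrowMul_word _ _ _ _ i.succ_ne_zero,
        pathProd_len_arrowMul_word _ _ _ _ i.succ_ne_zero]

end TwoRegularQuiver

end

/-! ### A basis of B(Q, f, m, b) consisting of g-paths. -/

noncomputable section

namespace TwoRegularQuiver

open BasisIndex
open scoped Classical

variable {K : Type*} [Field K] {Q : TwoRegularQuiver}

/-! ### Multiplication of `g`-paths in `B(Q, f, m, b)` -/

section Relations

variable {m : Q.WeightFunction} {b : Q.border → K} {R : Type*} [Ring R] [Algebra K R]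
  {e : Q.Vertex → R} {x : Q.Arrow → R}

theorem IsRep.mul_f (h : IsRep m b e x) (a : Q.Arrow) :
    x a * x (Q.f a) = borderCoef b a • pathProd x a (len m a) := by
  by_cases ha : Q.f a = a
  · rw [ha, h.border a ha, borderCoef, dif_pos ha]
  · rw [h.zero a ha, borderCoef_of_ne b ha, zero_smul]

theorem IsRep.pathProd_len_eq (h : IsRep m b e x) {a c : Q.Arrow} (hac : Q.src a = Q.src c) :
    pathProd x a (len m a) = pathProd x c (len m c) := by
  rcases eq_or_eq_bar hac with rfl | rfl
  · rfl
  · exact (h.comm c).symm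

theorem pathProd_ne_zero_succ {M : Type*} [Monoid M] (x : Q.Arrow → M) (h : Q.Arrow) {i : ℕ}
    (hi : i ≠ 0) : pathProd x h i = x h * pathProd x (Q.g h) (i - 1) := by
  obtain ⟨i, rfl⟩ := Nat.exists_eq_succ_of_ne_zero hi
  exact pathProd_succ x h i

theorem pathProd_ne_zero_succ' {M : Type*} [Monoid M] (x : Q.Arrow → M) (h : Q.Arrow) {i : ℕ}
    (hi : i ≠ 0) : pathProd x h i = pathProd x h (i - 1) * x (Q.g^[i - 1] h) := by
  obtain ⟨i, rfl⟩ := Nat.exists_eq_succ_of_ne_zero hi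
  exact pathProd_succ' x h i

theorem borderCoef_zero (a : Q.Arrow) : borderCoef (0 : Q.border → K) a = 0 := by
  unfold borderCoef
  split_ifs <;> rfl

/-- As g a and f a have the same source, x_a B_{g a} = x_a B_{f a}, which contains x_a x_{f a}. If f
a = a, this is b_a B_a x_{g a}⋯, and the last arrow l of B_a satisfies f(l) = g a with l not
f-fixed, so x_l x_{g a} = 0. -/
theorem IsRep.pathProd_len_succ (h : IsRep m b e x) (hQ : Q.NoDoubleLoop ∨ b = 0) (a : Q.Arrow) :
    pathProd x a (len m a + 1) = 0 := by
  rw [pathProd_succ, ← len_g, h.pathProd_len_eq (show Q.src (Q.g a) = Q.src (Q.f a) by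
    rw [src_g, src_f]), pathProd_ne_zero_succ x _ (len_pos m _).ne', ← mul_assoc]
  by_cases ha : Q.f a = a
  · rcases hQ with hQ | rfl
    swap
    · rw [h.mul_f a, borderCoef_zero, zero_smul, zero_mul]
    rw [h.mul_f a, ha, pathProd_ne_zero_succ' x a (len_pos m _).ne', smul_mul_assoc,
      mul_assoc, pathProd_ne_zero_succ x (Q.g a), ← mul_assoc (x _)]
    · have hf : Q.f (Q.g^[len m a - 1] a) = Q.g a := by
        rw [← bar_g, g_iterate_len_sub_one, g_eq_bar_of_f_eq ha]
      have h0 := h.mul_f (Q.g^[len m a - 1] a)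
      rw [borderCoef_of_ne, zero_smul, hf] at h0
      · rw [h0, zero_mul, mul_zero, smul_zero]
      · intro h1
        rw [hf, g_eq_bar_of_f_eq ha] at h1
        refine hQ.f_bar_ne ha ?_
        rw [h1, hf, g_eq_bar_of_f_eq ha, h1]
    · have := hQ.three_le_len m ha
      omega
  · rw [h.zero a ha, zero_mul]

theorem IsRep.pathProd_eq_zero (h : IsRep m b e x) (hQ : Q.NoDoubleLoop ∨ b = 0) {a : Q.Arrow} {i : ℕ}
    (hi : len m a < i) : pathProd x a i = 0 := by
  obtain ⟨j, rfl⟩ := Nat.exists_eq_add_of_le (Nat.succ_le_of_lt hi)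
  rw [pathProd_add, Nat.succ_eq_add_one, h.pathProd_len_succ hQ, zero_mul]

/-- Multiplication table mirrored by `arrowMul`. Apart from c = g a only c = f a is composable, and
then x_a x_c is 0 or b_a B_a; in the latter case B_a = B_{g a}, and a further factor x_{g a} kills
it. -/
theorem IsRep.mul_pathProd (h : IsRep m b e x) (hQ : Q.NoDoubleLoop ∨ b = 0) (a c : Q.Arrow) {i : ℕ}
    (hi : i ≠ 0) : x a * pathProd x c i = if Q.g a = c then pathProd x a (i + 1) else
      if c = a ∧ i = 1 then borderCoef b a • pathProd x a (len m a) else 0 := by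
  split_ifs with h1 h2
  · rw [pathProd_succ, h1]
  · obtain ⟨rfl, rfl⟩ := h2
    rw [pathProd_one]
    by_cases h3 : Q.src c = Q.tgt c
    · rcases eq_g_or_eq_f h3 with h4 | h4
      · exact absurd h4.symm h1
      · have := h.mul_f c
        rwa [← h4] at this
    · rw [h.toIsRep.mul_eq_zero h3, borderCoef_of_ne, zero_smul]
      exact fun h4 => h3 (tgt_eq_src_of_f_eq h4).symm
  · rw [pathProd_ne_zero_succ x c hi, ← mul_assoc]
    by_cases h3 : Q.src c = Q.tgt a
    · rcases eq_g_or_eq_f h3 with rfl | rfl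
      · exact absurd rfl h1
      · by_cases h4 : Q.f a = a
        · have h5 : i ≠ 1 := fun h5 => h2 ⟨h4, h5⟩
          rw [h.mul_f a, h4, smul_mul_assoc, h.comm a, ← g_eq_bar_of_f_eq h4,
            pathProd_ne_zero_succ x (Q.g a) (i := i - 1) (by omega), ← mul_assoc]
          have := pathProd_succ' x (Q.g a) (len m (Q.g a))
          rw [iterate_len] at this
          rw [← this, h.pathProd_len_succ hQ, zero_mul, smul_zero]
        · rw [h.zero a h4, zero_mul]
    · rw [h.toIsRep.mul_eq_zero h3, zero_mul]

end Relations

variable (m : Q.WeightFunction) (b : Q.border → K)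

/-- The socle element `B_a` for the arrows `a` starting at `v`. -/
def socElt (v : Q.Vertex) : Q.algebra m b := pathProd (gen m b) (Q.out v) (len m (Q.out v))

theorem pathProd_gen_len (a : Q.Arrow) :
    pathProd (gen m b) a (len m a) = socElt m b (Q.src a) :=
  (isRep_gen m b).pathProd_len_eq (src_out Q _).symm

theorem IsRep.lift_socElt {m : Q.WeightFunction} {b : Q.border → K} {R : Type*} [Ring R]
    [Algebra K R] {e : Q.Vertex → R} {x : Q.Arrow → R} (h : IsRep m b e x) (a : Q.Arrow) :
    h.lift (socElt m b (Q.src a)) = pathProd x a (len m a) := by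
  rw [← pathProd_gen_len, h.lift_pathProd]

theorem gen_mul_idem (a : Q.Arrow) (v : Q.Vertex) :
    gen m b a * idem m b v = if Q.tgt a = v then gen m b a else 0 := by
  split_ifs with h
  · rw [← h, (isRep_gen m b).mul_tgt]
  · exact (isRep_gen m b).toIsRep.mul_e_eq_zero h

theorem idem_mul_gen (a : Q.Arrow) (v : Q.Vertex) :
    idem m b v * gen m b a = if Q.src a = v then gen m b a else 0 := by
  split_ifs with h
  · rw [← h, (isRep_gen m b).src_mul]
  · exact (isRep_gen m b).toIsRep.e_mul_eq_zero h

theorem idem_mul_pathProd (a : Q.Arrow) (v : Q.Vertex) {i : ℕ} (hi : i ≠ 0) :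
    idem m b v * pathProd (gen m b) a i = if Q.src a = v then pathProd (gen m b) a i else 0 := by
  rw [pathProd_ne_zero_succ _ _ hi, ← mul_assoc, idem_mul_gen]
  split_ifs
  · rfl
  · rw [zero_mul]

theorem idem_mul_socElt (v u : Q.Vertex) :
    idem m b v * socElt m b u = if u = v then socElt m b u else 0 := by
  rw [socElt, idem_mul_pathProd _ _ _ _ (len_pos m _).ne', src_out]

theorem gen_mul_socElt (hQ : Q.NoDoubleLoop ∨ b = 0) (a : Q.Arrow) (v : Q.Vertex) :
    gen m b a * socElt m b v = 0 := by
  rw [socElt, (isRep_gen m b).mul_pathProd hQ _ _ (len_pos m _).ne']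
  split_ifs with h1 h2
  · exact (isRep_gen m b).pathProd_eq_zero hQ (by rw [← h1, len_g]; omega)
  · rw [borderCoef_of_ne, zero_smul]
    intro h3
    have := two_le_len m h3
    rw [← h2.1] at this
    omega
  · rfl

/-! ### A basis of `B(Q, f, m, b)` -/

/-- The element of `B(Q, f, m, b)` with given coordinates. -/
def ofCoords : (BasisIndex Q →₀ K) →ₗ[K] Q.algebra m b :=
  Finsupp.linearCombination K fun
    | top v => idem m b v
    | soc v => socElt m b v
    | mid h i => pathProd (gen m b) h (i + 1)

theorem ofCoords_top (v : Q.Vertex) : ofCoords m b (.single (top v) 1) = idem m b v := by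
  simp [ofCoords]

theorem ofCoords_soc (v : Q.Vertex) (c : K) :
    ofCoords m b (.single (soc v) c) = c • socElt m b v := by
  simp [ofCoords]

theorem ofCoords_mid (h : Q.Arrow) (i : ℕ) :
    ofCoords m b (.single (mid h i) 1) = pathProd (gen m b) h (i + 1) := by
  simp [ofCoords]

theorem ofCoords_word (hQ : Q.NoDoubleLoop ∨ b = 0) (h : Q.Arrow) {i : ℕ} (hi : i ≠ 0) :
    ofCoords m b (word m K h i) = pathProd (gen m b) h i := by
  rcases lt_trichotomy i (len m h) with hlt | rfl | hlt
  · rw [word_mid m hi hlt, ofCoords_mid, Nat.sub_add_cancel (by omega)]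
  · rw [word_len, ofCoords_soc, one_smul, pathProd_gen_len]
  · rw [word_eq_zero m hlt, map_zero, (isRep_gen m b).pathProd_eq_zero hQ hlt]

theorem linearMap_ext_basisIndex {N : Type*} [AddCommGroup N] [Module K N]
    {φ ψ : (BasisIndex Q →₀ K) →ₗ[K] N}
    (h1 : ∀ v, φ (.single (top v) 1) = ψ (.single (top v) 1))
    (h2 : ∀ v, φ (.single (soc v) 1) = ψ (.single (soc v) 1))
    (h3 : ∀ h i, φ (.single (mid h i) 1) = ψ (.single (mid h i) 1)) : φ = ψ := by
  refine Finsupp.lhom_ext' fun j => LinearMap.ext_ring ?_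
  rcases j with v | v | ⟨h, i⟩
  exacts [h1 v, h2 v, h3 h i]

theorem ofCoords_arrowMul (hQ : Q.NoDoubleLoop ∨ b = 0) (a : Q.Arrow) (w : BasisIndex Q →₀ K) :
    ofCoords m b (arrowMul m b a w) = gen m b a * ofCoords m b w := by
  suffices h : (ofCoords m b).comp (arrowMul m b a) =
      (LinearMap.mulLeft K (gen m b a)).comp (ofCoords m b) by
    have := DFunLike.congr_fun h w
    exact this
  refine linearMap_ext_basisIndex (N := Q.algebra m b) (fun v => ?_) (fun v => ?_) (fun h i => ?_)
  · simp only [LinearMap.comp_apply, LinearMap.mulLeft_apply, arrowMul_top, ofCoords_top,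
      gen_mul_idem]
    split_ifs
    · rw [ofCoords_word m b hQ _ one_ne_zero, pathProd_one]
    · exact map_zero _
  · simp only [LinearMap.comp_apply, LinearMap.mulLeft_apply, arrowMul_soc, ofCoords_soc, map_zero,
      one_smul, gen_mul_socElt m b hQ]
  · simp only [LinearMap.comp_apply, LinearMap.mulLeft_apply, arrowMul_mid, ofCoords_mid]
    rw [(isRep_gen m b).mul_pathProd hQ _ _ i.succ_ne_zero]
    split_ifs with h1 h2 h3 h4
    · exact ofCoords_word m b hQ _ (by omega)
    · rw [ofCoords_soc, pathProd_gen_len]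
    · simp_all
    · simp_all
    · exact map_zero _

theorem ofCoords_idemMul (v : Q.Vertex) (w : BasisIndex Q →₀ K) :
    ofCoords m b (idemMul K v w) = idem m b v * ofCoords m b w := by
  suffices h : (ofCoords m b).comp (idemMul K v) =
      (LinearMap.mulLeft K (idem m b v)).comp (ofCoords m b) by
    have := DFunLike.congr_fun h w
    exact this
  refine linearMap_ext_basisIndex (N := Q.algebra m b) (fun u => ?_) (fun u => ?_) (fun h i => ?_)
  · simp only [LinearMap.comp_apply, LinearMap.mulLeft_apply, ofCoords_top]
    by_cases h : u = v
    · simp [h, idemMul, ofCoords_top, (isRep_gen m b).idem]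
    · simp [h, idemMul, (isRep_gen m b).orth v u (Ne.symm h)]
  · simp only [LinearMap.comp_apply, LinearMap.mulLeft_apply, ofCoords_soc, idemMul_soc, one_smul,
      idem_mul_socElt]
    split_ifs <;> simp [ofCoords_soc]
  · simp only [LinearMap.comp_apply, LinearMap.mulLeft_apply, ofCoords_mid]
    rw [idem_mul_pathProd _ _ _ _ i.succ_ne_zero]
    by_cases h' : Q.src h = v
    · simp [h', idemMul, ofCoords_mid]
    · simp [h', idemMul]

/-- The left regular representation of `B(Q, f, m, b)` in coordinates. -/
def leftRep : Q.algebra m b →ₐ[K] Module.End K (BasisIndex Q →₀ K) := (isRep_arrowMul m b).lift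

theorem ofCoords_leftRep (hQ : Q.NoDoubleLoop ∨ b = 0) (y : Q.algebra m b) (w : BasisIndex Q →₀ K) :
    ofCoords m b (leftRep m b y w) = y * ofCoords m b w := by
  let S : Subalgebra K (Q.algebra m b) :=
    { carrier := {y | ∀ w, ofCoords m b (leftRep m b y w) = y * ofCoords m b w}
      mul_mem' := fun {y z} hy hz w => by
        rw [map_mul, Module.End.mul_apply, hy, hz, mul_assoc]
      add_mem' := fun {y z} hy hz w => by
        rw [map_add, LinearMap.add_apply, map_add, hy, hz, add_mul]
      algebraMap_mem' := fun c w => by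
        rw [AlgHom.commutes, Module.algebraMap_end_apply, map_smul, Algebra.smul_def] }
  refine mem_of_idem_of_gen S (fun v w => ?_) (fun a w => ?_) y w
  · rw [leftRep, IsRep.lift_idem, ofCoords_idemMul]
  · rw [leftRep, IsRep.lift_gen, ofCoords_arrowMul m b hQ]

/-- The coordinates of an element of `B(Q, f, m, b)`. -/
def coords : Q.algebra m b →ₗ[K] (BasisIndex Q →₀ K) :=
  LinearMap.applyₗ (∑ v, .single (top v) 1) ∘ₗ (leftRep m b).toLinearMap

theorem coords_apply (y : Q.algebra m b) :
    coords m b y = leftRep m b y (∑ v, .single (top v) 1) := rfl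

theorem coords_mul (y z : Q.algebra m b) : coords m b (y * z) = leftRep m b y (coords m b z) := by
  rw [coords_apply, map_mul, Module.End.mul_apply, coords_apply]

theorem coords_gen_mul (a : Q.Arrow) (z : Q.algebra m b) :
    coords m b (gen m b a * z) = arrowMul m b a (coords m b z) := by
  rw [coords_mul, leftRep, IsRep.lift_gen]

/-- The vector `∑ v, top v` represents 1, so applying `leftRep y` to it and mapping back yields y ·
1. -/
theorem ofCoords_coords (hQ : Q.NoDoubleLoop ∨ b = 0) (y : Q.algebra m b) :
    ofCoords m b (coords m b y) = y := by
  rw [coords_apply, ofCoords_leftRep m b hQ, map_sum]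
  simp [ofCoords_top, (isRep_gen m b).sum]

theorem coords_idem (v : Q.Vertex) : coords m b (idem m b v) = .single (top v) 1 := by
  rw [coords_apply, leftRep, IsRep.lift_idem, map_sum, Finset.sum_eq_single v]
  · simp [idemMul]
  · intro u _ hu
    simp [idemMul, hu]
  · simp

theorem coords_pathProd (h : Q.Arrow) {i : ℕ} (hi : i ≠ 0) :
    coords m b (pathProd (gen m b) h i) = word m K h i := by
  obtain ⟨i, rfl⟩ := Nat.exists_eq_succ_of_ne_zero hi
  rw [coords_apply, leftRep, IsRep.lift_pathProd, map_sum]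
  simp only [Nat.succ_eq_add_one, pathProd_arrowMul_top]
  rw [Finset.sum_eq_single (Q.src (Q.g^[i + 1] h)), if_pos rfl]
  · exact fun v _ hv => if_neg hv.symm
  · simp

theorem coords_socElt (v : Q.Vertex) : coords m b (socElt m b v) = .single (soc v) 1 := by
  rw [socElt, coords_pathProd _ _ _ (len_pos m _).ne', word_len, src_out]

/-- The subspace of coordinate vectors of elements of `B(Q, f, m, b)`. -/
def coordSpace (K : Type*) [Field K] (m : Q.WeightFunction) : Submodule K (BasisIndex Q →₀ K) :=
  Submodule.span K (Set.range (fun v => .single (top v) 1) ∪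
    {w | ∃ h i, i ≠ 0 ∧ w = word m K h i})

theorem ofCoords_mem (w : BasisIndex Q →₀ K) :
    ofCoords m b w ∈ Submodule.span K (Set.range (idem m b) ∪
      {y | ∃ h i, i ≠ 0 ∧ y = pathProd (gen m b) h i}) := by
  rw [ofCoords, Finsupp.linearCombination_apply]
  refine Submodule.sum_mem _ fun j _ => Submodule.smul_mem _ _ (Submodule.subset_span ?_)
  rcases j with v | v | ⟨h, i⟩
  · exact .inl ⟨v, rfl⟩
  · exact .inr ⟨_, _, (len_pos m _).ne', rfl⟩
  · exact .inr ⟨h, i + 1, i.succ_ne_zero, rfl⟩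

theorem span_paths_eq_top (hQ : Q.NoDoubleLoop ∨ b = 0) :
    Submodule.span K (Set.range (idem m b) ∪
      {y | ∃ h i, i ≠ 0 ∧ y = pathProd (gen m b) h i}) = ⊤ := by
  rw [eq_top_iff]
  intro y _
  rw [← ofCoords_coords m b hQ y]
  exact ofCoords_mem m b _

theorem coords_mem (hQ : Q.NoDoubleLoop ∨ b = 0) (y : Q.algebra m b) :
    coords m b y ∈ coordSpace K m := by
  have hy : y ∈ Submodule.span K _ := (span_paths_eq_top m b hQ).symm ▸ Submodule.mem_top
  have := Submodule.mem_map_of_mem (f := coords m b) hy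
  rw [Submodule.map_span] at this
  refine Submodule.span_mono ?_ this
  rintro _ ⟨y, ⟨v, rfl⟩ | ⟨h, i, hi, rfl⟩, rfl⟩
  · exact .inl ⟨v, (coords_idem m b v).symm⟩
  · exact .inr ⟨h, i, hi, coords_pathProd m b h hi⟩

theorem coords_ofCoords (hQ : Q.NoDoubleLoop ∨ b = 0) {w : BasisIndex Q →₀ K}
    (hw : w ∈ coordSpace K m) : coords m b (ofCoords m b w) = w := by
  induction hw using Submodule.span_induction with
  | mem w hw =>
    obtain ⟨v, rfl⟩ | ⟨h, i, hi, rfl⟩ := hw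
    · simp only [ofCoords_top, coords_idem]
    · rw [ofCoords_word m b hQ h hi, coords_pathProd m b h hi]
  | zero => simp
  | add w w' _ _ h h' => rw [map_add, map_add, h, h']
  | smul c w _ h => rw [map_smul, map_smul, h]

/-- The coordinates as a linear isomorphism. -/
def coordEquiv (hQ : Q.NoDoubleLoop ∨ b = 0) : Q.algebra m b ≃ₗ[K] coordSpace K m where
  __ := (coords m b).codRestrict (coordSpace K m) (coords_mem m b hQ)
  invFun w := ofCoords m b w
  left_inv := ofCoords_coords m b hQ
  right_inv w := Subtype.ext (coords_ofCoords m b hQ w.2)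

/-- The coordinate space depends on `m` only, not on the border function. -/
theorem finrank_algebra_eq (hQ : Q.NoDoubleLoop) (b b' : Q.border → K) :
    Module.finrank K (Q.algebra m b) = Module.finrank K (Q.algebra m b') :=
  ((coordEquiv m b (.inl hQ)).trans (coordEquiv m b' (.inl hQ)).symm).finrank_eq

end TwoRegularQuiver

end

/-! ### The left socle, the arrow ideal and a criterion for injectivity. -/

noncomputable section

namespace TwoRegularQuiver

open BasisIndex
open scoped Classical

variable {K : Type*} [Field K] {Q : TwoRegularQuiver} (m : Q.WeightFunction) (b : Q.border → K)

/-! ### The socle of `B(Q, f, m, b)` -/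

theorem eq_zero_of_mem_coordSpace {w : BasisIndex Q →₀ K} (hw : w ∈ coordSpace K m) {h : Q.Arrow}
    {i : ℕ} (hi : len m h ≤ i + 1) : w (mid h i) = 0 := by
  induction hw using Submodule.span_induction with
  | mem w hw =>
    obtain ⟨v, rfl⟩ | ⟨h', j, hj, rfl⟩ := hw
    · simp
    · rw [word, if_neg hj]
      split_ifs
      · rw [Finsupp.single_apply, if_neg]
        rintro ⟨⟩
        omega
      · simp
      · simp
  | zero => simp
  | add w w' _ _ h h' => simp [h, h']
  | smul c w _ h => simp [h]

theorem word_apply_mid (a h : Q.Arrow) {i : ℕ} (j : ℕ) (hi : i < len m h) (h0 : i ≠ 0) :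
    word m K h i (mid a j) = if h = a ∧ i = j + 1 then 1 else 0 := by
  rw [word_mid m h0 hi, Finsupp.single_apply]
  congr 1
  simp only [mid.injEq, eq_iff_iff, and_congr_right_iff]
  omega

theorem word_apply_mid_of_ne {a h : Q.Arrow} {i j : ℕ} (hne : h ≠ a ∨ i ≠ j + 1) :
    word m K h i (mid a j) = 0 := by
  rw [word]
  split_ifs with h1 h2
  · simp
  · rw [Finsupp.single_apply, if_neg]
    rintro ⟨⟩
    exact hne.elim (fun h => h rfl) (fun h => h (by omega))
  · simp
  · simp

theorem word_apply_soc (h : Q.Arrow) (i : ℕ) (v : Q.Vertex) :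
    word m K h i (soc v) = if i = len m h ∧ Q.src h = v then 1 else 0 := by
  have := len_pos m h
  rw [word]
  split_ifs with h1 h2 h3 h4 h5 <;> simp_all

theorem arrowMul_apply_mid_succ {a : Q.Arrow} {i : ℕ} (hi : i + 2 < len m a)
    (w : BasisIndex Q →₀ K) : arrowMul m b a w (mid a (i + 1)) = w (mid (Q.g a) i) := by
  suffices h : (Finsupp.lapply (mid a (i + 1))).comp (arrowMul m b a) =
      (Finsupp.lapply (mid (Q.g a) i) : _ →ₗ[K] K) from DFunLike.congr_fun h w
  refine linearMap_ext_basisIndex (N := K) (fun v => ?_) (fun v => ?_) (fun h j => ?_)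
  · simp only [LinearMap.comp_apply, Finsupp.lapply_apply, arrowMul_top]
    split_ifs
    · rw [word_apply_mid_of_ne _ (.inr (by omega))]; simp
    · simp
  · simp [arrowMul_soc]
  · simp only [LinearMap.comp_apply, Finsupp.lapply_apply, arrowMul_mid]
    by_cases h1 : Q.g a = h
    · rw [if_pos h1]
      by_cases h2 : i = j
      · rw [word_apply_mid _ _ _ _ (by omega) (by omega)]
        simp [h1, h2]
      · rw [word_apply_mid_of_ne _ (.inr (by omega))]
        simp [Ne.symm h2]
    · rw [if_neg h1, Finsupp.single_apply, if_neg (c := mid h j = _)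
        (fun h2 => h1 (by injection h2 with h2; exact h2.symm))]
      split_ifs <;> simp

theorem arrowMul_apply_mid_zero {a : Q.Arrow} (hi : 1 < len m a)
    (w : BasisIndex Q →₀ K) : arrowMul m b a w (mid a 0) = w (top (Q.tgt a)) := by
  suffices h : (Finsupp.lapply (mid a 0)).comp (arrowMul m b a) =
      (Finsupp.lapply (top (Q.tgt a)) : _ →ₗ[K] K) from DFunLike.congr_fun h w
  refine linearMap_ext_basisIndex (N := K) (fun v => ?_) (fun v => ?_) (fun h j => ?_)
  · simp only [LinearMap.comp_apply, Finsupp.lapply_apply, arrowMul_top]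
    by_cases h1 : Q.tgt a = v
    · rw [if_pos h1, word_apply_mid _ _ _ _ hi one_ne_zero]
      simp [h1]
    · simp [h1]
  · simp [arrowMul_soc]
  · simp only [LinearMap.comp_apply, Finsupp.lapply_apply, arrowMul_mid]
    split_ifs
    · rw [word_apply_mid_of_ne _ (.inr (by omega))]
      simp
    · simp
    · simp

theorem arrowMul_apply_soc {a : Q.Arrow} (hi : 1 < len m a) (w : BasisIndex Q →₀ K) :
    arrowMul m b a w (soc (Q.src a)) =
      w (mid (Q.g a) (len m a - 2)) + borderCoef b a * w (mid a 0) := by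
  suffices h : (Finsupp.lapply (soc (Q.src a))).comp (arrowMul m b a) =
      Finsupp.lapply (mid (Q.g a) (len m a - 2)) + borderCoef b a •
        (Finsupp.lapply (mid a 0) : _ →ₗ[K] K) from DFunLike.congr_fun h w
  refine linearMap_ext_basisIndex (N := K) (fun v => ?_) (fun v => ?_) (fun h j => ?_)
  · simp only [LinearMap.comp_apply, Finsupp.lapply_apply, arrowMul_top]
    split_ifs
    · rw [word_apply_soc, if_neg (by omega)]
      simp
    · simp
  · simp [arrowMul_soc]
  · simp only [LinearMap.comp_apply, Finsupp.lapply_apply, arrowMul_mid, LinearMap.add_apply,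
      LinearMap.smul_apply, Finsupp.single_apply, mid.injEq, smul_eq_mul]
    by_cases h1 : Q.g a = h
    · rw [if_pos h1, word_apply_soc]
      by_cases h3 : h = a
      · rw [borderCoef_of_ne]
        · subst h1
          simp
          congr 1
          simp; omega
        · intro h4
          exact Q.g_ne_f a (h1.trans (h3.trans h4.symm))
      · subst h1
        simp [h3]
        congr 1
        simp; omega
    · rw [if_neg h1, if_neg (c := h = Q.g a ∧ _) (fun h4 => h1 h4.1.symm)]
      split_ifs <;> simp

theorem arrowMul_apply_soc_of_len {a : Q.Arrow} (hi : len m a = 1) (w : BasisIndex Q →₀ K) :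
    arrowMul m b a w (soc (Q.src a)) = w (top (Q.tgt a)) := by
  suffices h : (Finsupp.lapply (soc (Q.src a))).comp (arrowMul m b a) =
      (Finsupp.lapply (top (Q.tgt a)) : _ →ₗ[K] K) from DFunLike.congr_fun h w
  refine linearMap_ext_basisIndex (N := K) (fun v => ?_) (fun v => ?_) (fun h j => ?_)
  · simp only [LinearMap.comp_apply, Finsupp.lapply_apply, arrowMul_top]
    by_cases h1 : Q.tgt a = v
    · rw [if_pos h1, word_apply_soc]
      simp [h1, hi]
    · simp [h1]
  · simp [arrowMul_soc]
  · simp only [LinearMap.comp_apply, Finsupp.lapply_apply, arrowMul_mid]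
    split_ifs with h1 h2
    · rw [word_apply_soc, if_neg (by omega)]
      simp
    · obtain ⟨rfl, -⟩ := h2
      rw [borderCoef_of_ne]
      · simp
      · intro h3
        have := two_le_len m h3
        omega
    · simp

theorem exists_tgt (v : Q.Vertex) : ∃ a, Q.tgt a = v := by
  obtain ⟨a, ha⟩ := g_surjective (Q.out v)
  exact ⟨a, by rw [← src_g, ha, src_out]⟩

theorem eq_sum_socElt_of_coords (hQ : Q.NoDoubleLoop) {z : Q.algebra m b}
    (h1 : ∀ v, coords m b z (top v) = 0)
    (h2 : ∀ h i, i + 1 < len m h → coords m b z (mid h i) = 0) :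
    z = ∑ v, coords m b z (soc v) • socElt m b v := by
  have h3 : coords m b z = ∑ v, .single (soc v) (coords m b z (soc v)) := by
    ext j
    rw [Finsupp.finsetSum_apply]
    rcases j with v | v | ⟨h, i⟩
    · simp [h1]
    · rw [Finset.sum_eq_single v] <;> simp +contextual
    · rcases lt_or_ge (i + 1) (len m h) with hi | hi
      · simp [h2 h i hi]
      · rw [eq_zero_of_mem_coordSpace m (coords_mem m b (.inl hQ) z) hi]
        simp
  conv_lhs => rw [← ofCoords_coords m b (.inl hQ) z, h3, map_sum]
  simp only [ofCoords_soc]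

/-- The left socle of `B(Q, f, m, b)`. -/
theorem eq_sum_socElt_of_gen_mul (hQ : Q.NoDoubleLoop) {z : Q.algebra m b}
    (hz : ∀ a, gen m b a * z = 0) : z = ∑ v, coords m b z (soc v) • socElt m b v := by
  have h0 : ∀ a, arrowMul m b a (coords m b z) = 0 := fun a => by
    rw [← coords_gen_mul, hz, map_zero]
  have hm : ∀ a i, i + 2 < len m a → coords m b z (mid (Q.g a) i) = 0 := fun a i hi => by
    rw [← arrowMul_apply_mid_succ m b hi, h0]; rfl
  refine eq_sum_socElt_of_coords m b hQ (fun v => ?_) (fun h i hi => ?_)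
  · obtain ⟨a, rfl⟩ := exists_tgt v
    have := len_pos m a
    rcases (show 1 < len m a ∨ len m a = 1 by omega) with h1 | h1
    · rw [← arrowMul_apply_mid_zero m b h1, h0]; rfl
    · rw [← arrowMul_apply_soc_of_len m b h1, h0]; rfl
  · obtain ⟨a, rfl⟩ := g_surjective h
    rw [len_g] at hi
    rcases (show i + 2 < len m a ∨ i = len m a - 2 by omega) with h1 | rfl
    · exact hm a i h1
    · have h2 := arrowMul_apply_soc m b (show 1 < len m a by omega) (coords m b z)
      rw [h0] at h2
      -- For an f-fixed loop the socle coordinate of a·z mixes the wanted coefficient with b_a times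
      -- the coefficient of a itself. The latter already vanishes by the predecessor c of a, because
      -- the orbit has `len` at least three.
      by_cases h3 : Q.f a = a
      · obtain ⟨c, hc⟩ := g_surjective a
        have h4 := hm c 0 (by
          rw [← len_g, hc]
          have := hQ.three_le_len m h3
          omega)
        rw [hc] at h4
        rw [h4, mul_zero, add_zero] at h2
        exact h2.symm
      · rw [borderCoef_of_ne b h3, zero_mul, add_zero] at h2
        exact h2.symm

/-! ### The ideal generated by the arrows -/

/-- The span of the `g`-paths of length at least `k`. -/
def pathIdeal (k : ℕ) : Submodule K (Q.algebra m b) :=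
  Submodule.span K {y | ∃ h i, k ≤ i ∧ y = pathProd (gen m b) h i}

/-- The border term arises only from a path of length one, hence only for k = 1, and B_a then has
length at least two. -/
theorem gen_mul_mem_pathIdeal (hQ : Q.NoDoubleLoop ∨ b = 0) (a : Q.Arrow) {k : ℕ} (hk : k ≠ 0)
    {y : Q.algebra m b} (hy : y ∈ pathIdeal m b k) : gen m b a * y ∈ pathIdeal m b (k + 1) := by
  induction hy using Submodule.span_induction with
  | mem y hy =>
    obtain ⟨h, i, hi, rfl⟩ := hy
    rw [(isRep_gen m b).mul_pathProd hQ _ _ (by omega)]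
    split_ifs with h1 h2
    · exact Submodule.subset_span ⟨a, i + 1, by omega, rfl⟩
    · by_cases h3 : Q.f a = a
      · exact Submodule.smul_mem _ _ (Submodule.subset_span ⟨a, len m a, by
          have := two_le_len m h3
          omega, rfl⟩)
      · rw [borderCoef_of_ne b h3, zero_smul]
        exact Submodule.zero_mem _
    · exact Submodule.zero_mem _
  | zero => simp
  | add y z _ _ h h' => rw [mul_add]; exact Submodule.add_mem _ h h'
  | smul c y _ h => rw [mul_smul_comm]; exact Submodule.smul_mem _ _ h

theorem gen_mem_pathIdeal (a : Q.Arrow) : gen m b a ∈ pathIdeal m b 1 :=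
  Submodule.subset_span ⟨a, 1, le_rfl, by rw [pathProd_one]⟩

theorem pathProd_mem_pathIdeal (h : Q.Arrow) (i : ℕ) :
    pathProd (gen m b) h i ∈ pathIdeal m b i := Submodule.subset_span ⟨h, i, le_rfl, rfl⟩

theorem pathIdeal_antitone : Antitone (pathIdeal m b) := fun _ _ hkl =>
  Submodule.span_mono fun _ ⟨h, i, hi, hy⟩ => ⟨h, i, hkl.trans hi, hy⟩

theorem gen_mul_mem_pathIdeal_one (hQ : Q.NoDoubleLoop ∨ b = 0) (a : Q.Arrow) (x : Q.algebra m b) :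
    gen m b a * x ∈ pathIdeal m b 1 := by
  have hx : x ∈ Submodule.span K _ := (span_paths_eq_top m b hQ).symm ▸ Submodule.mem_top
  induction hx using Submodule.span_induction with
  | mem x hx =>
    obtain ⟨v, rfl⟩ | ⟨h, i, hi, rfl⟩ := hx
    · rw [gen_mul_idem]
      split_ifs
      exacts [gen_mem_pathIdeal m b a, Submodule.zero_mem _]
    · exact pathIdeal_antitone m b (by omega) (gen_mul_mem_pathIdeal m b hQ a hi
        (pathProd_mem_pathIdeal m b h i))
  | zero => simp
  | add y z _ _ h h' => rw [mul_add]; exact Submodule.add_mem _ h h'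
  | smul c y _ h => rw [mul_smul_comm]; exact Submodule.smul_mem _ _ h

theorem pathIdeal_one_mul (hQ : Q.NoDoubleLoop ∨ b = 0) {k : ℕ} (hk : k ≠ 0) :
    pathIdeal m b 1 * pathIdeal m b k ≤ pathIdeal m b (k + 1) := by
  rw [Submodule.mul_le]
  intro x hx y hy
  induction hx using Submodule.span_induction with
  | mem x hx =>
    obtain ⟨h, i, hi, rfl⟩ := hx
    have : ∀ i h, pathProd (gen m b) h i * y ∈ pathIdeal m b (k + i) := by
      intro i
      induction i with
      | zero => intro h; simpa using hy
      | succ i ih =>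
        intro h
        rw [pathProd_succ, mul_assoc, ← add_assoc]
        exact gen_mul_mem_pathIdeal m b hQ _ (by omega) (ih _)
    exact pathIdeal_antitone m b (by omega) (this i h)
  | zero => simp
  | add y z _ _ h h' => rw [add_mul]; exact Submodule.add_mem _ h h'
  | smul c y _ h => rw [smul_mul_assoc]; exact Submodule.smul_mem _ _ h

theorem pathIdeal_one_pow_le (hQ : Q.NoDoubleLoop ∨ b = 0) (k : ℕ) :
    pathIdeal m b 1 ^ (k + 1) ≤ pathIdeal m b (k + 1) := by
  induction k with
  | zero => simp
  | succ k ih =>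
    rw [pow_succ' _ (k + 1)]
    exact (mul_le_mul_right ih _).trans (pathIdeal_one_mul m b hQ (by omega))

theorem exists_pathIdeal_eq_bot (hQ : Q.NoDoubleLoop ∨ b = 0) : ∃ L, pathIdeal m b L = ⊥ := by
  refine ⟨(∑ a, len m a) + 1, ?_⟩
  rw [pathIdeal, Submodule.span_eq_bot]
  rintro _ ⟨h, i, hi, rfl⟩
  refine (isRep_gen m b).pathProd_eq_zero hQ ?_
  have := Finset.single_le_sum (f := len m) (fun _ _ => Nat.zero_le _) (Finset.mem_univ h)
  omega

theorem exists_pow_pathIdeal_eq_bot (hQ : Q.NoDoubleLoop ∨ b = 0) : ∃ L, pathIdeal m b 1 ^ L = ⊥ := by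
  obtain ⟨L, hL⟩ := exists_pathIdeal_eq_bot m b hQ
  exact ⟨L + 1, le_bot_iff.1 ((pathIdeal_one_pow_le m b hQ L).trans
    ((pathIdeal_antitone m b L.le_succ).trans hL.le))⟩

/-- Multiply by arrows from the left as long as the product is nonzero; each step raises the path
length, and long paths vanish. So every nonzero left ideal meets the left annihilated part. -/
theorem exists_mul_ne_zero_of_mem (hQ : Q.NoDoubleLoop) {x : Q.algebra m b} (hx : x ≠ 0) :
    ∃ y, y * x ≠ 0 ∧ ∀ a, gen m b a * (y * x) = 0 := by
  obtain ⟨L, hL⟩ := exists_pathIdeal_eq_bot m b (.inl hQ)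
  have key : ∀ n k, k + n = L → k ≠ 0 → ∀ x ∈ pathIdeal m b k, x ≠ 0 →
      ∃ y, y * x ≠ 0 ∧ ∀ a, gen m b a * (y * x) = 0 := by
    intro n
    induction n with
    | zero =>
      intro k hk _ x hx h0
      obtain rfl : k = L := by omega
      rw [hL, Submodule.mem_bot] at hx
      exact absurd hx h0
    | succ n ih =>
      intro k hk hk0 x hx h0
      by_cases h : ∀ a, gen m b a * x = 0
      · exact ⟨1, by rwa [one_mul], by simpa using h⟩
      · push Not at h
        obtain ⟨a, ha⟩ := h
        obtain ⟨y, hy, hy'⟩ := ih (k + 1) (by omega) (by omega) _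
          (gen_mul_mem_pathIdeal m b (.inl hQ) a hk0 hx) ha
        exact ⟨y * gen m b a, by rwa [mul_assoc], by simpa only [mul_assoc] using hy'⟩
  by_cases h : ∀ a, gen m b a * x = 0
  · exact ⟨1, by rwa [one_mul], by simpa using h⟩
  · push Not at h
    obtain ⟨a, ha⟩ := h
    have hmem := gen_mul_mem_pathIdeal_one m b (.inl hQ) a x
    rcases Nat.eq_zero_or_pos L with rfl | hL0
    · have := pathIdeal_antitone m b (Nat.zero_le 1) hmem
      rw [hL, Submodule.mem_bot] at this
      exact absurd this ha
    · obtain ⟨y, hy, hy'⟩ := key (L - 1) 1 (by omega) one_ne_zero _ hmem ha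
      exact ⟨y * gen m b a, by rwa [mul_assoc], by simpa only [mul_assoc] using hy'⟩

/-- A nonzero kernel contains a nonzero element annihilated on the left by all arrows, hence a
combination of the `socElt v`; multiplication by an idempotent isolates one of them. -/
theorem injective_of_socElt_ne_zero (hQ : Q.NoDoubleLoop) {R : Type*} [Ring R] [Algebra K R]
    (φ : Q.algebra m b →ₐ[K] R) (h : ∀ v, φ (socElt m b v) ≠ 0) : Function.Injective φ := by
  rw [injective_iff_map_eq_zero]
  intro x hx
  by_contra hx0
  obtain ⟨y, hy, hy'⟩ := exists_mul_ne_zero_of_mem m b hQ hx0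
  have hsum := eq_sum_socElt_of_gen_mul m b hQ hy'
  refine hy ?_
  rw [hsum]
  refine Finset.sum_eq_zero fun v _ => ?_
  suffices h0 : coords m b (y * x) (soc v) = 0 by rw [h0, zero_smul]
  have h1 : idem m b v * (y * x) = coords m b (y * x) (soc v) • socElt m b v := by
    conv_lhs => rw [hsum, Finset.mul_sum]
    rw [Finset.sum_eq_single v]
    · rw [mul_smul_comm, idem_mul_socElt, if_pos rfl]
    · intro u _ hu
      rw [mul_smul_comm, idem_mul_socElt, if_neg hu, smul_zero]
    · simp
  have h2 := congrArg φ h1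
  rw [map_mul, map_mul, hx, mul_zero, mul_zero, map_smul] at h2
  exact (smul_eq_zero.1 h2.symm).resolve_right (h v)

end TwoRegularQuiver

end

/-! ### The augmentation and the right socle of B(Q, f, m, 0). -/

noncomputable section

/-! ### Elements of the right socle -/

theorem mem_rightSocle_of_mul_eq_smul {K A : Type*} [Field K] [Ring A] [Algebra K A] {x : A}
    (h : ∀ a, ∃ c : K, x * a = c • x) : x ∈ rightSocle A := by
  by_cases hx : x = 0
  · rw [hx]; exact Submodule.zero_mem _
  have hs : IsSimpleModule Aᵐᵒᵖ (Submodule.span Aᵐᵒᵖ {x}) := by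
    rw [isSimpleModule_iff_isAtom]
    refine ⟨by simpa using hx, fun I hI => ?_⟩
    by_contra hI0
    obtain ⟨y, hy, hy0⟩ := Submodule.exists_mem_ne_zero_of_ne_bot hI0
    obtain ⟨a, rfl⟩ := Submodule.mem_span_singleton.1 (hI.le hy)
    obtain ⟨c, hc⟩ := h a.unop
    have hax : a • x = c • x := hc
    have hc0 : c ≠ 0 := fun h0 => hy0 (by rw [hax, h0, zero_smul])
    refine hI.not_ge ((Submodule.span_singleton_le_iff_mem _ _).2 ?_)
    have := I.smul_mem (MulOpposite.op (algebraMap K A c⁻¹)) hy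
    rwa [hax, op_smul_eq_mul, ← Algebra.commutes, ← Algebra.smul_def, smul_smul,
      inv_mul_cancel₀ hc0, one_smul] at this
  have hle : Submodule.span Aᵐᵒᵖ {x} ≤ rightSocle A := le_sSup hs
  exact hle (Submodule.mem_span_singleton_self x)

/-- Nakayama-type argument: if y j ≠ 0 for y in a simple right ideal, then y = y(jc) for some c,
hence y = y(jc)ⁿ = 0, as jc is nilpotent. -/
theorem rightSocle_mul_eq_zero {A : Type*} [Ring A] {J : Set A}
    (hr : ∀ j ∈ J, ∀ a, j * a ∈ J) (hl : ∀ j ∈ J, ∀ a, a * j ∈ J)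
    (hn : ∀ j ∈ J, IsNilpotent j) {x j : A} (hx : x ∈ rightSocle A) (hj : j ∈ J) : x * j = 0 := by
  let N : Submodule Aᵐᵒᵖ A :=
    { carrier := {x | ∀ j ∈ J, x * j = 0}
      add_mem' := fun ha hb j hj => by rw [add_mul, ha j hj, hb j hj, add_zero]
      zero_mem' := fun j _ => zero_mul j
      smul_mem' := fun c x hx j hj => by
        rw [← MulOpposite.op_unop c, op_smul_eq_mul, mul_assoc]
        exact hx _ (hl j hj _) }
  suffices h : rightSocle A ≤ N from h hx j hj
  refine sSup_le fun I (hI : IsSimpleModule Aᵐᵒᵖ I) y hy j hj => ?_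
  by_contra h0
  have hmem : y * j ∈ I := I.smul_mem (MulOpposite.op j) hy
  have hspan : y ∈ Submodule.span Aᵐᵒᵖ {y * j} := by
    rcases (isSimpleModule_iff_isAtom.1 hI).le_iff.1
      ((Submodule.span_singleton_le_iff_mem _ _).2 hmem) with h | h
    · exact absurd (Submodule.span_singleton_eq_bot.1 h) h0
    · rwa [h]
  obtain ⟨c, hc⟩ := Submodule.mem_span_singleton.1 hspan
  rw [← MulOpposite.op_unop c, op_smul_eq_mul, mul_assoc] at hc
  obtain ⟨n, hn⟩ := hn _ (hr j hj c.unop)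
  have hpow : ∀ n, y * (j * c.unop) ^ n = y := fun n => by
    induction n with
    | zero => simp
    | succ n ih => rw [pow_succ', ← mul_assoc, hc, ih]
  have h1 := hpow n
  rw [hn, mul_zero] at h1
  exact h0 (by rw [← h1, zero_mul])

namespace TwoRegularQuiver

open BasisIndex
open scoped Classical

variable {K : Type*} [Field K] {Q : TwoRegularQuiver} (m : Q.WeightFunction) (b : Q.border → K)

/-! ### The augmentation -/

theorem isRep_augmentation : IsRep m b (fun v => (Pi.single v 1 : Q.Vertex → K)) (fun _ => 0) where
  idem v := by rw [← Pi.single_mul, mul_one]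
  orth v w h := by
    ext u
    by_cases hu : u = v
    · subst hu; simp [h]
    · simp [hu]
  sum := by ext u; simp
  src_mul a := mul_zero _
  mul_tgt a := zero_mul _
  zero a _ := zero_mul _
  border a h := by
    rw [pathProd_ne_zero_succ _ _ (len_pos m a).ne', zero_mul, zero_mul, smul_zero]
  comm a := by
    rw [pathProd_ne_zero_succ _ _ (len_pos m a).ne', zero_mul,
      pathProd_ne_zero_succ _ _ (len_pos m _).ne', zero_mul]

/-- The augmentation of `B(Q, f, m, b)`, which sends the arrows to zero. -/
def augmentation : Q.algebra m b →ₐ[K] (Q.Vertex → K) := (isRep_augmentation m b).lift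

theorem augmentation_idem (v : Q.Vertex) :
    augmentation m b (idem m b v) = Pi.single v 1 := IsRep.lift_idem _ v

theorem augmentation_gen (a : Q.Arrow) : augmentation m b (gen m b a) = 0 := IsRep.lift_gen _ a

theorem augmentation_pathProd (a : Q.Arrow) {i : ℕ} (hi : i ≠ 0) :
    augmentation m b (pathProd (gen m b) a i) = 0 := by
  rw [pathProd_ne_zero_succ _ _ hi, map_mul, augmentation_gen, zero_mul]

theorem augmentation_socElt (v : Q.Vertex) : augmentation m b (socElt m b v) = 0 :=
  augmentation_pathProd m b _ (len_pos m _).ne'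

theorem augmentation_ofCoords (w : BasisIndex Q →₀ K) (v : Q.Vertex) :
    augmentation m b (ofCoords m b w) v = w (top v) := by
  suffices h : (LinearMap.proj v).comp ((augmentation m b).toLinearMap.comp (ofCoords m b)) =
      (Finsupp.lapply (top v) : _ →ₗ[K] K) from DFunLike.congr_fun h w
  refine linearMap_ext_basisIndex (N := K) (fun u => ?_) (fun u => ?_) (fun h j => ?_)
  · simp [ofCoords_top, augmentation_idem, Pi.single_apply, Finsupp.single_apply, eq_comm]
  · simp [ofCoords_soc, augmentation_socElt]
  · simp [ofCoords_mid, augmentation_pathProd]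

theorem mem_pathIdeal_one_iff (hQ : Q.NoDoubleLoop ∨ b = 0) {y : Q.algebra m b} :
    y ∈ pathIdeal m b 1 ↔ augmentation m b y = 0 := by
  constructor
  · intro hy
    induction hy using Submodule.span_induction with
    | mem y hy =>
      obtain ⟨h, i, hi, rfl⟩ := hy
      exact augmentation_pathProd m b h (by omega)
    | zero => exact map_zero _
    | add y z _ _ h h' => rw [map_add, h, h', add_zero]
    | smul c y _ h => rw [map_smul, h, smul_zero]
  · intro hy
    have htop : ∀ v, coords m b y (top v) = 0 := fun v => by
      rw [← augmentation_ofCoords m b, ofCoords_coords m b hQ, hy]; rfl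
    rw [← ofCoords_coords m b hQ y, ofCoords, Finsupp.linearCombination_apply]
    refine Submodule.sum_mem _ fun j _ => ?_
    rcases j with v | v | ⟨h, i⟩
    · simp [htop]
    · exact Submodule.smul_mem _ _ (pathIdeal_antitone m b (len_pos m _)
        (pathProd_mem_pathIdeal m b _ _))
    · exact Submodule.smul_mem _ _ (pathIdeal_antitone m b (by omega)
        (pathProd_mem_pathIdeal m b _ _))

theorem exists_eq_sum_gen_mul {y : Q.algebra m b} (hy : y ∈ pathIdeal m b 1) :
    ∃ c : Q.Arrow → Q.algebra m b, y = ∑ a, gen m b a * c a := by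
  induction hy using Submodule.span_induction with
  | mem y hy =>
    obtain ⟨h, i, hi, rfl⟩ := hy
    refine ⟨Pi.single h (pathProd (gen m b) (Q.g h) (i - 1)), ?_⟩
    rw [Finset.sum_eq_single h]
    · rw [Pi.single_eq_same, pathProd_ne_zero_succ _ _ (by omega)]
    · intro a _ ha
      rw [Pi.single_eq_of_ne ha, mul_zero]
    · simp
  | zero => exact ⟨0, by simp⟩
  | add y z _ _ h h' =>
    obtain ⟨c, rfl⟩ := h
    obtain ⟨c', rfl⟩ := h'
    exact ⟨c + c', by simp [mul_add, Finset.sum_add_distrib]⟩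
  | smul r y _ h =>
    obtain ⟨c, rfl⟩ := h
    exact ⟨r • c, by simp [Finset.smul_sum]⟩

theorem exists_eq_sum_mul_gen {y : Q.algebra m b} (hy : y ∈ pathIdeal m b 1) :
    ∃ c : Q.Arrow → Q.algebra m b, y = ∑ a, c a * gen m b a := by
  induction hy using Submodule.span_induction with
  | mem y hy =>
    obtain ⟨h, i, hi, rfl⟩ := hy
    refine ⟨Pi.single (Q.g^[i - 1] h) (pathProd (gen m b) h (i - 1)), ?_⟩
    rw [Finset.sum_eq_single (Q.g^[i - 1] h)]
    · rw [Pi.single_eq_same, pathProd_ne_zero_succ' _ _ (by omega)]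
    · intro a _ ha
      rw [Pi.single_eq_of_ne ha, zero_mul]
    · simp
  | zero => exact ⟨0, by simp⟩
  | add y z _ _ h h' =>
    obtain ⟨c, rfl⟩ := h
    obtain ⟨c', rfl⟩ := h'
    exact ⟨c + c', by simp [add_mul, Finset.sum_add_distrib]⟩
  | smul r y _ h =>
    obtain ⟨c, rfl⟩ := h
    exact ⟨r • c, by simp [Finset.smul_sum]⟩

theorem augmentation_isNilpotent (hQ : Q.NoDoubleLoop ∨ b = 0) {y : Q.algebra m b}
    (hy : augmentation m b y = 0) : IsNilpotent y := by
  obtain ⟨L, hL⟩ := exists_pow_pathIdeal_eq_bot m b hQ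
  exact ⟨L, by
    have := Submodule.pow_mem_pow _ ((mem_pathIdeal_one_iff m b hQ).2 hy) L
    rwa [hL, Submodule.mem_bot] at this⟩

/-! ### The right socle in the undeformed case -/

/-- Right multiplication by an arrow in coordinates, if `b = 0`. -/
def mulArrow (K : Type*) [Field K] (m : Q.WeightFunction) (a : Q.Arrow) :
    (BasisIndex Q →₀ K) →ₗ[K] (BasisIndex Q →₀ K) :=
  Finsupp.linearCombination K fun
    | top v => if Q.src a = v then word m K a 1 else 0
    | soc _ => 0
    | mid h i => if Q.g^[i + 1] h = a then word m K h (i + 2) else 0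

theorem mulArrow_top (a : Q.Arrow) (v : Q.Vertex) :
    mulArrow K m a (.single (top v) 1) = if Q.src a = v then word m K a 1 else 0 := by
  simp [mulArrow]

theorem mulArrow_soc (a : Q.Arrow) (v : Q.Vertex) :
    mulArrow K m a (.single (soc v) 1) = 0 := by
  simp [mulArrow]

theorem mulArrow_mid (a h : Q.Arrow) (i : ℕ) :
    mulArrow K m a (.single (mid h i) 1) =
      if Q.g^[i + 1] h = a then word m K h (i + 2) else 0 := by
  simp [mulArrow]

theorem mulArrow_mem (a : Q.Arrow) (w : BasisIndex Q →₀ K) :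
    mulArrow K m a w ∈ coordSpace K m := by
  rw [mulArrow, Finsupp.linearCombination_apply]
  refine Submodule.sum_mem _ fun j _ => Submodule.smul_mem _ _ ?_
  have hw : ∀ h i, word m K h (i + 1) ∈ coordSpace K m := fun h i =>
    Submodule.subset_span (.inr ⟨h, i + 1, i.succ_ne_zero, rfl⟩)
  rcases j with v | v | ⟨h, i⟩
  · dsimp only
    split_ifs
    exacts [hw _ _, Submodule.zero_mem _]
  · exact Submodule.zero_mem _
  · dsimp only
    split_ifs
    exacts [hw _ _, Submodule.zero_mem _]

theorem IsRep.pathProd_mul {R : Type*} [Ring R] [Algebra K R] {e : Q.Vertex → R} {x : Q.Arrow → R}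
    (h : IsRep m (0 : Q.border → K) e x) (c a : Q.Arrow) {i : ℕ} (hi : i ≠ 0) :
    pathProd x c i * x a = if Q.g^[i] c = a then pathProd x c (i + 1) else 0 := by
  split_ifs with h1
  · rw [pathProd_succ', h1]
  · obtain ⟨i, rfl⟩ := Nat.exists_eq_succ_of_ne_zero hi
    rw [Nat.succ_eq_add_one, pathProd_succ', mul_assoc]
    by_cases h2 : Q.src a = Q.tgt (Q.g^[i] c)
    · rcases eq_g_or_eq_f h2 with rfl | rfl
      · exact absurd (Function.iterate_succ_apply' _ _ _) h1
      · rw [h.mul_f, borderCoef]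
        simp
    · rw [h.toIsRep.mul_eq_zero h2, mul_zero]

theorem socElt_mul_gen (a : Q.Arrow) (v : Q.Vertex) :
    socElt m (0 : Q.border → K) v * gen m 0 a = 0 := by
  rw [socElt, (isRep_gen m 0).pathProd_mul _ _ _ (len_pos m _).ne',
    (isRep_gen m 0).pathProd_len_succ (.inr rfl), ite_self]

theorem ofCoords_mulArrow (a : Q.Arrow) (w : BasisIndex Q →₀ K) :
    ofCoords m 0 (mulArrow K m a w) = ofCoords m 0 w * gen m 0 a := by
  suffices h : (ofCoords m 0).comp (mulArrow K m a) =
      (LinearMap.mulRight K (gen m 0 a)).comp (ofCoords m 0) from DFunLike.congr_fun h w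
  refine linearMap_ext_basisIndex (N := Q.algebra m 0) (fun v => ?_) (fun v => ?_) (fun h i => ?_)
  · simp only [LinearMap.comp_apply, LinearMap.mulRight_apply, mulArrow_top, ofCoords_top,
      idem_mul_gen]
    split_ifs
    · rw [ofCoords_word m 0 (.inr rfl) _ one_ne_zero, pathProd_one]
    · exact map_zero _
  · simp only [LinearMap.comp_apply, LinearMap.mulRight_apply, mulArrow_soc, ofCoords_soc,
      map_zero, one_smul, socElt_mul_gen m]
  · simp only [LinearMap.comp_apply, LinearMap.mulRight_apply, mulArrow_mid, ofCoords_mid]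
    rw [(isRep_gen m 0).pathProd_mul _ _ _ i.succ_ne_zero]
    split_ifs
    · exact ofCoords_word m 0 (.inr rfl) _ (by omega)
    · exact map_zero _

theorem mulArrow_apply_mid_zero {a : Q.Arrow} (hi : 1 < len m a) (w : BasisIndex Q →₀ K) :
    mulArrow K m a w (mid a 0) = w (top (Q.src a)) := by
  suffices h : (Finsupp.lapply (mid a 0)).comp (mulArrow K m a) =
      (Finsupp.lapply (top (Q.src a)) : _ →ₗ[K] K) from DFunLike.congr_fun h w
  refine linearMap_ext_basisIndex (N := K) (fun v => ?_) (fun v => ?_) (fun h j => ?_)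
  · simp only [LinearMap.comp_apply, Finsupp.lapply_apply, mulArrow_top]
    by_cases h1 : Q.src a = v
    · rw [if_pos h1, word_apply_mid _ _ _ _ hi one_ne_zero]
      simp [h1]
    · simp [h1]
  · simp [mulArrow_soc]
  · simp only [LinearMap.comp_apply, Finsupp.lapply_apply, mulArrow_mid]
    split_ifs
    · rw [word_apply_mid_of_ne _ (.inr (by omega))]
      simp
    · simp

theorem mulArrow_apply_soc_of_len {a : Q.Arrow} (hi : len m a = 1) (w : BasisIndex Q →₀ K) :
    mulArrow K m a w (soc (Q.src a)) = w (top (Q.src a)) := by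
  suffices h : (Finsupp.lapply (soc (Q.src a))).comp (mulArrow K m a) =
      (Finsupp.lapply (top (Q.src a)) : _ →ₗ[K] K) from DFunLike.congr_fun h w
  refine linearMap_ext_basisIndex (N := K) (fun v => ?_) (fun v => ?_) (fun h j => ?_)
  · simp only [LinearMap.comp_apply, Finsupp.lapply_apply, mulArrow_top]
    by_cases h1 : Q.src a = v
    · rw [if_pos h1, word_apply_soc]
      simp [h1, hi]
    · simp [h1]
  · simp [mulArrow_soc]
  · simp only [LinearMap.comp_apply, Finsupp.lapply_apply, mulArrow_mid]
    split_ifs with h1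
    · rw [← h1, len_iterate] at hi
      rw [word_eq_zero _ (by omega)]
      simp
    · simp

theorem mulArrow_apply_mid_succ {h : Q.Arrow} {i : ℕ} (hi : i + 2 < len m h)
    (w : BasisIndex Q →₀ K) :
    mulArrow K m (Q.g^[i + 1] h) w (mid h (i + 1)) = w (mid h i) := by
  suffices h : (Finsupp.lapply (mid h (i + 1))).comp (mulArrow K m (Q.g^[i + 1] h)) =
      (Finsupp.lapply (mid h i) : _ →ₗ[K] K) from DFunLike.congr_fun h w
  refine linearMap_ext_basisIndex (N := K) (fun v => ?_) (fun v => ?_) (fun h' j => ?_)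
  · simp only [LinearMap.comp_apply, Finsupp.lapply_apply, mulArrow_top]
    split_ifs
    · rw [word_apply_mid_of_ne _ (.inr (by omega))]
      simp
    · simp
  · simp [mulArrow_soc]
  · simp only [LinearMap.comp_apply, Finsupp.lapply_apply, mulArrow_mid]
    by_cases h1 : h' = h ∧ j = i
    · obtain ⟨rfl, rfl⟩ := h1
      rw [if_pos rfl, word_apply_mid _ _ _ _ hi (by omega)]
      simp
    · rw [Finsupp.single_apply, if_neg (c := mid h' j = mid h i) (fun h2 => h1 (by
        injection h2 with h2 h3; exact ⟨h2, h3⟩))]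
      split_ifs
      · exact word_apply_mid_of_ne _ (by
          by_contra h2
          push Not at h2
          exact h1 ⟨h2.1, by omega⟩)
      · rfl

theorem mulArrow_apply_soc {h : Q.Arrow} {i : ℕ} (hi : i + 2 = len m h)
    (w : BasisIndex Q →₀ K) :
    mulArrow K m (Q.g^[i + 1] h) w (soc (Q.src h)) = w (mid h i) := by
  suffices h : (Finsupp.lapply (soc (Q.src h))).comp (mulArrow K m (Q.g^[i + 1] h)) =
      (Finsupp.lapply (mid h i) : _ →ₗ[K] K) from DFunLike.congr_fun h w
  refine linearMap_ext_basisIndex (N := K) (fun v => ?_) (fun v => ?_) (fun h' j => ?_)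
  · simp only [LinearMap.comp_apply, Finsupp.lapply_apply, mulArrow_top]
    split_ifs
    · rw [word_apply_soc, if_neg (by rw [len_iterate]; omega)]
      simp
    · simp
  · simp [mulArrow_soc]
  · simp only [LinearMap.comp_apply, Finsupp.lapply_apply, mulArrow_mid]
    by_cases h1 : h' = h ∧ j = i
    · obtain ⟨rfl, rfl⟩ := h1
      rw [if_pos rfl, hi, word_len]
      simp
    · rw [Finsupp.single_apply, if_neg (c := mid h' j = mid h i) (fun h2 => h1 (by
        injection h2 with h2 h3; exact ⟨h2, h3⟩))]
      split_ifs with h2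
      · rw [word_apply_soc, if_neg]
        rintro ⟨h3, -⟩
        have h4 := congrArg (len m) h2
        rw [len_iterate, len_iterate] at h4
        obtain rfl : j = i := by omega
        exact h1 ⟨g_injective.iterate _ h2, rfl⟩
      · rfl

/-- The right annihilator of the arrows in `B(Q, f, m, 0)`. -/
theorem eq_sum_socElt_of_mul_gen (hQ : Q.NoDoubleLoop) {z : Q.algebra m (0 : Q.border → K)}
    (hz : ∀ a, z * gen m 0 a = 0) : z = ∑ v, coords m 0 z (soc v) • socElt m 0 v := by
  have h0 : ∀ a, mulArrow K m a (coords m 0 z) = 0 := fun a => by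
    rw [← coords_ofCoords m 0 (.inr rfl) (mulArrow_mem m a _), ofCoords_mulArrow m,
      ofCoords_coords m 0 (.inr rfl), hz, map_zero]
  refine eq_sum_socElt_of_coords m 0 hQ (fun v => ?_) (fun h i hi => ?_)
  · rw [← src_out Q v]
    have := len_pos m (Q.out v)
    rcases (show 1 < len m (Q.out v) ∨ len m (Q.out v) = 1 by omega) with h1 | h1
    · rw [← mulArrow_apply_mid_zero m h1, h0]; rfl
    · rw [← mulArrow_apply_soc_of_len m h1, h0]; rfl
  · rcases (show i + 2 < len m h ∨ i + 2 = len m h by omega) with h1 | h1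
    · rw [← mulArrow_apply_mid_succ m h1, h0]; rfl
    · rw [← mulArrow_apply_soc m h1, h0]; rfl

theorem socElt_mem_rightSocle (v : Q.Vertex) :
    socElt m (0 : Q.border → K) v ∈ rightSocle (Q.algebra m (0 : Q.border → K)) := by
  refine mem_rightSocle_of_mul_eq_smul (K := K) fun y => ?_
  have hy : y ∈ Submodule.span K _ :=
    (span_paths_eq_top m (0 : Q.border → K) (.inr rfl)).symm ▸ Submodule.mem_top
  induction hy using Submodule.span_induction with
  | mem y hy =>
    obtain ⟨u, rfl⟩ | ⟨h, i, hi, rfl⟩ := hy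
    · rw [socElt, pathProd_ne_zero_succ' _ _ (len_pos m _).ne', mul_assoc, gen_mul_idem]
      split_ifs
      · exact ⟨1, (one_smul _ _).symm⟩
      · exact ⟨0, by simp⟩
    · exact ⟨0, by
        rw [pathProd_ne_zero_succ _ _ hi, ← mul_assoc, socElt_mul_gen m, zero_mul, zero_smul]⟩
  | zero => exact ⟨0, by simp⟩
  | add y z _ _ h h' =>
    obtain ⟨c, hc⟩ := h
    obtain ⟨d, hd⟩ := h'
    exact ⟨c + d, by rw [mul_add, hc, hd, add_smul]⟩
  | smul r y _ h =>
    obtain ⟨c, hc⟩ := h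
    exact ⟨r * c, by rw [mul_smul_comm, hc, mul_smul]⟩

/-- The arrows lie in the nil kernel of the augmentation and so annihilate the socle from the right;
the elements with this property were found in coordinates. -/
theorem mem_rightSocle_iff (hQ : Q.NoDoubleLoop) {z : Q.algebra m (0 : Q.border → K)} :
    z ∈ rightSocle (Q.algebra m (0 : Q.border → K)) ↔
      z = ∑ v, coords m 0 z (soc v) • socElt m 0 v := by
  constructor
  · intro hz
    refine eq_sum_socElt_of_mul_gen m hQ fun a => ?_
    refine rightSocle_mul_eq_zero (J := {y | augmentation m 0 y = 0}) ?_ ?_ ?_ hz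
      (augmentation_gen m 0 a)
    · intro j (hj : augmentation m 0 j = 0) c
      show augmentation m 0 (j * c) = 0
      rw [map_mul, hj, zero_mul]
    · intro j (hj : augmentation m 0 j = 0) c
      show augmentation m 0 (c * j) = 0
      rw [map_mul, hj, mul_zero]
    · exact fun j hj => augmentation_isNilpotent m 0 (.inr rfl) hj
  · intro hz
    rw [hz]
    refine Submodule.sum_mem _ fun v _ => ?_
    have := (rightSocle (Q.algebra m (0 : Q.border → K))).smul_mem
      (MulOpposite.op (algebraMap K _ (coords m 0 z (soc v)))) (socElt_mem_rightSocle m v)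
    rwa [op_smul_eq_mul, ← Algebra.commutes, ← Algebra.smul_def] at this

end TwoRegularQuiver

end

/-! ### Minimal right ideals and the socle of a symmetric algebra. -/

noncomputable section

/-! ### Symmetric algebras -/

section MinimalRightIdeal

variable {A : Type*} [Ring A] {I : Submodule Aᵐᵒᵖ A}

theorem Submodule.mul_mem_of_op (I : Submodule Aᵐᵒᵖ A) {x : A} (hx : x ∈ I) (a : A) :
    x * a ∈ I :=
  I.smul_mem (MulOpposite.op a) hx

theorem exists_mul_eq_of_isSimpleModule (hI : IsSimpleModule Aᵐᵒᵖ I) {x y : A} (hx : x ∈ I)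
    (hx0 : x ≠ 0) (hy : y ∈ I) : ∃ a, x * a = y := by
  have hspan : y ∈ Submodule.span Aᵐᵒᵖ {x} := by
    rcases (isSimpleModule_iff_isAtom.1 hI).le_iff.1
      ((Submodule.span_singleton_le_iff_mem _ _).2 hx) with h | h
    · exact absurd (Submodule.span_singleton_eq_bot.1 h) hx0
    · rwa [h]
  obtain ⟨c, hc⟩ := Submodule.mem_span_singleton.1 hspan
  exact ⟨c.unop, hc⟩

theorem rightSocle_induction {p : A → Prop} {x : A} (hx : x ∈ rightSocle A)
    (mem : ∀ I : Submodule Aᵐᵒᵖ A, IsSimpleModule Aᵐᵒᵖ I → ∀ x ∈ I, p x) (zero : p 0)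
    (add : ∀ x y, p x → p y → p (x + y)) : p x := by
  rw [rightSocle, sSup_eq_iSup'] at hx
  exact Submodule.iSup_induction _ (motive := p) hx (fun I x hx => mem I.1 I.2 x hx) zero add

/-- Brauer's lemma. Choose a with u w a = u and put e = w a. Then u(e² − e) = 0, so if e² − e were
nonzero it would generate I, and u would kill w. -/
theorem exists_isIdempotentElem_of_mul_ne_zero (hI : IsSimpleModule Aᵐᵒᵖ I) {u w : A}
    (hu : u ∈ I) (hw : w ∈ I) (huw : u * w ≠ 0) : ∃ e ∈ I, e * e = e ∧ e ≠ 0 := by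
  obtain ⟨a, ha⟩ := exists_mul_eq_of_isSimpleModule hI (I.mul_mem_of_op hu w) huw hu
  rw [mul_assoc] at ha
  have he := I.mul_mem_of_op hw a
  refine ⟨w * a, he, ?_, fun h0 => huw ?_⟩
  · by_contra hne
    have h1 : w * a * (w * a) - w * a ∈ I := I.sub_mem (I.mul_mem_of_op he _) he
    obtain ⟨c, hc⟩ := exists_mul_eq_of_isSimpleModule hI h1 (sub_ne_zero.2 hne) hw
    refine huw ?_
    rw [← hc, ← mul_assoc, mul_sub, ← mul_assoc, ha, ha, sub_self, zero_mul]
  · rw [← ha, h0, mul_zero, zero_mul]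

/-- Reduction to one simple ideal: for u ∈ I and i ∈ I' with u i ≠ 0, write u = u i a; then u i =
u(i a)i, so the two elements i a and i of I' have a nonzero product. -/
theorem exists_isIdempotentElem_of_rightSocle {x y : A} (hx : x ∈ rightSocle A)
    (hy : y ∈ rightSocle A) (hxy : x * y ≠ 0) :
    ∃ I : Submodule Aᵐᵒᵖ A, IsSimpleModule Aᵐᵒᵖ I ∧ ∃ e ∈ I, e * e = e ∧ e ≠ 0 := by
  by_contra! hcon
  have key : ∀ I : Submodule Aᵐᵒᵖ A, IsSimpleModule Aᵐᵒᵖ I → ∀ u ∈ I, ∀ w ∈ I, u * w = 0 := by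
    intro I hI u hu w hw
    by_contra h0
    obtain ⟨e, he, hee, he0⟩ := exists_isIdempotentElem_of_mul_ne_zero hI hu hw h0
    exact he0 (hcon I hI e he hee)
  refine hxy (rightSocle_induction (p := fun x => x * y = 0) hx (fun I hI u hu => ?_)
    (zero_mul _) (fun a b ha hb => by rw [add_mul, ha, hb, add_zero]))
  refine rightSocle_induction (p := fun y => u * y = 0) hy (fun I' hI' i hi => ?_)
    (mul_zero _) (fun a b ha hb => by rw [mul_add, ha, hb, add_zero])
  by_contra h0
  obtain ⟨a, ha⟩ := exists_mul_eq_of_isSimpleModule hI (I.mul_mem_of_op hu i) h0 hu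
  refine h0 ?_
  rw [← ha, mul_assoc u, mul_assoc u, key I' hI' _ (I'.mul_mem_of_op hi a) i hi, mul_zero]

end MinimalRightIdeal

/-- Left multiplication as an endomorphism of the right regular module. -/
def lmulHom {A : Type*} [Ring A] (a : A) : A →ₗ[Aᵐᵒᵖ] A where
  toFun z := a * z
  map_add' := mul_add a
  map_smul' c z := by simp [← mul_assoc]

/-- In an indecomposable symmetric algebra which is not semisimple, the socle has square zero. -/
theorem mul_eq_zero_of_mem_rightSocle {K A : Type*} [Field K] [Ring A] [Algebra K A]
    [FiniteDimensional K A] (hsymm : HasSymmetrizingForm K A) (hindec : IsIndecomposableAlgebra A)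
    (htop : rightSocle A ≠ ⊤) {x y : A} (hx : x ∈ rightSocle A) (hy : y ∈ rightSocle A) :
    x * y = 0 := by
  obtain ⟨B, hassoc, hB, hnd⟩ := hsymm
  by_contra hxy
  obtain ⟨I, hI, e, he, hee, he0⟩ := exists_isIdempotentElem_of_rightSocle hx hy hxy
  -- R is a two-sided ideal inside the socle. The aim is to split it off as a direct factor, with
  -- the orthogonal complement as the other factor.
  let R := isotypicComponent Aᵐᵒᵖ A I
  have hRl : ∀ a, ∀ r ∈ R, a * r ∈ R := fun a r hr =>
    LinearMap.le_comap_isotypicComponent I (lmulHom a) hr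
  have hRr : ∀ a, ∀ r ∈ R, r * a ∈ R := fun a r hr => R.smul_mem (MulOpposite.op a) hr
  have hIR : I ≤ R := I.le_isotypicComponent
  have hR : R ≤ rightSocle A := sSup_le_sSup fun J ⟨φ⟩ => IsSimpleModule.congr φ
  let RK : Submodule K A :=
    { R.toAddSubmonoid with
      smul_mem' := fun c r hr => by
        rw [Algebra.smul_def]
        exact hRl _ _ hr }
  have hann : ∀ x, x ∈ B.orthogonal RK → ∀ r ∈ R, x * r = 0 ∧ r * x = 0 := by
    intro x hx r hr
    constructor
    · refine hnd.1 _ fun z => ?_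
      rw [hassoc, hB]
      exact hx _ (hRr z r hr)
    · refine hnd.1 _ fun z => ?_
      rw [hB, ← hassoc]
      exact hx _ (hRl z r hr)
  -- A nonzero x in the intersection generates a module containing a copy of I. There the element s
  -- corresponding to e satisfies s = s e, but s e ∈ x R = 0.
  have hdisj : Disjoint RK (B.orthogonal RK) := by
    rw [Submodule.disjoint_def]
    intro x hx hx'
    by_contra hx0
    have hle : Submodule.span Aᵐᵒᵖ {x} ≤ R := (Submodule.span_singleton_le_iff_mem _ _).2 hx
    have : IsSemisimpleModule Aᵐᵒᵖ (Submodule.span Aᵐᵒᵖ {x}) :=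
      IsSemisimpleModule.of_injective _ (Submodule.inclusion_injective hle)
    obtain ⟨S, hS, hS'⟩ := (IsSemisimpleModule.eq_bot_or_exists_simple_le
      (Submodule.span Aᵐᵒᵖ {x})).resolve_left (by simpa using hx0)
    obtain ⟨φ⟩ := isIsotypicOfType_submodule_iff.1 (IsIsotypicOfType.isotypicComponent Aᵐᵒᵖ A I) S
      (hS.trans hle)
    have h1 : φ.symm ⟨e, he⟩ = MulOpposite.op e • φ.symm ⟨e, he⟩ := by
      rw [← map_smul]
      congr 1
      exact Subtype.ext hee.symm
    obtain ⟨c, hc⟩ := Submodule.mem_span_singleton.1 (hS (φ.symm ⟨e, he⟩).2)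
    have h2 := congrArg Subtype.val h1
    rw [Submodule.coe_smul, ← hc, op_smul_eq_mul, ← MulOpposite.op_unop c, op_smul_eq_mul,
      mul_assoc, (hann x hx' _ (hRl _ e (hIR he))).1] at h2
    rw [← MulOpposite.op_unop c, op_smul_eq_mul, h2] at hc
    have h3 : φ.symm ⟨e, he⟩ = 0 := Subtype.ext hc.symm
    rw [LinearEquiv.map_eq_zero_iff] at h3
    exact he0 (congrArg Subtype.val h3)
  have hcompl := (LinearMap.BilinForm.isCompl_orthogonal_iff_disjoint
    (B := B) (W := RK) (fun x y h => by rw [hB, h])).2 hdisj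
  -- The component r of 1 in R is a central idempotent. If r = 0 then e = 0; if r = 1 then A is its
  -- own socle.
  obtain ⟨r, hr, s, hs, hrs⟩ := Submodule.mem_sup.1
    (hcompl.sup_eq_top ▸ Submodule.mem_top : (1 : A) ∈ RK ⊔ B.orthogonal RK)
  have hr1 : ∀ a ∈ R, r * a = a := fun a ha => by
    conv_rhs => rw [← one_mul a, ← hrs, add_mul, (hann s hs a ha).1, add_zero]
  have hr2 : ∀ a ∈ R, a * r = a := fun a ha => by
    conv_rhs => rw [← mul_one a, ← hrs, mul_add, (hann s hs a ha).2, add_zero]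
  rcases hindec.2 r (Subring.mem_center_iff.2 fun a => by
    rw [← hr1 _ (hRl a r hr), ← mul_assoc, hr2 _ (hRr a r hr)]) (hr1 r hr) with h0 | h1
  · exact he0 (by rw [← hr1 e (hIR he), h0, zero_mul])
  · refine htop (eq_top_iff.2 fun a _ => hR ?_)
    rw [← one_mul a, ← h1]
    exact hRr a r hr

end

/-! ### Lifting idempotents to A, normalized socle generators, and the dimension of A. -/

noncomputable section

theorem soc_mul {A : Type*} [Ring A] {u : A} (hu : u ∈ rightSocle A) (a : A) :
    u * a ∈ rightSocle A :=
  Submodule.mul_mem_of_op _ hu a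

theorem soc_smul {K A : Type*} [Field K] [Ring A] [Algebra K A] {u : A} (hu : u ∈ rightSocle A)
    (c : K) : c • u ∈ rightSocle A := by
  rw [Algebra.smul_def]; exact mul_mem_rightSocle _ hu

/-- The dimension of a space in terms of the image and the kernel of a linear map. -/
theorem finrank_eq_add_card_of_ker_equiv {K B C ι : Type*} [Field K] [AddCommMonoid B]
    [Module K B] [AddCommGroup C] [Module K C] [Fintype ι] [FiniteDimensional K C]
    (ρ : B →ₗ[K] C) (hρ : Function.Surjective ρ) (ψ : LinearMap.ker ρ ≃ₗ[K] (ι → K)) :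
    Module.finrank K B = Module.finrank K C + Fintype.card ι := by
  let : AddCommGroup B := Module.addCommMonoidToAddCommGroup K
  have hk : Module.Finite K (LinearMap.ker ρ) := Module.Finite.equiv ψ.symm
  have hB : Module.Finite K B := by
    have : Module.Finite K (B ⧸ LinearMap.ker ρ) :=
      Module.Finite.equiv (ρ.quotKerEquivOfSurjective hρ).symm
    exact Module.Finite.of_submodule_quotient (LinearMap.ker ρ)
  have h2 := ρ.finrank_range_add_finrank_ker
  rw [LinearMap.range_eq_top.2 hρ, ψ.finrank_eq, finrank_top, Module.finrank_pi] at h2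
  exact h2.symm

namespace TwoRegularQuiver

open BasisIndex
open scoped Classical

/-- A symmetric algebra `A` with `soc(A)² = 0`, and a common quotient `C` of `A` and of
`B(Q, f, m, 0)` by their socles. -/
structure SocleLift {K : Type*} [Field K] {Q : TwoRegularQuiver} (m : Q.WeightFunction)
    (A C : Type*) [Ring A] [Algebra K A] [Ring C] [Algebra K C] where
  π : A →ₐ[K] C
  ρ : Q.algebra m (0 : Q.border → K) →ₐ[K] C
  π_surj : Function.Surjective π
  ρ_surj : Function.Surjective ρ
  π_ker : ∀ {x}, π x = 0 ↔ x ∈ rightSocle A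
  ρ_ker : ∀ {y}, ρ y = 0 ↔ y ∈ rightSocle (Q.algebra m (0 : Q.border → K))
  t : A →ₗ[K] K
  t_comm : ∀ x y, t (x * y) = t (y * x)
  t_nondeg : ∀ x, (∀ y, t (x * y) = 0) → x = 0
  sq_zero : ∀ x ∈ rightSocle A, ∀ y ∈ rightSocle A, x * y = 0
  noDoubleLoop : Q.NoDoubleLoop

namespace SocleLift

variable {K : Type*} [Field K] {Q : TwoRegularQuiver} {m : Q.WeightFunction}
  {A C : Type*} [Ring A] [Algebra K A] [Ring C] [Algebra K C] (S : SocleLift (K := K) m A C)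

theorem coords_of_ρ_eq_zero {y : Q.algebra m (0 : Q.border → K)} (hy : S.ρ y = 0) :
    (∀ v, coords m 0 y (top v) = 0) ∧ ∀ h i, coords m 0 y (mid h i) = 0 := by
  rw [S.ρ_ker, mem_rightSocle_iff m S.noDoubleLoop] at hy
  constructor
  · intro v
    rw [hy, map_sum, Finsupp.finsetSum_apply]
    simp [coords_socElt]
  · intro h i
    rw [hy, map_sum, Finsupp.finsetSum_apply]
    simp [coords_socElt]

theorem ρ_socElt (v : Q.Vertex) : S.ρ (socElt m 0 v) = 0 :=
  S.ρ_ker.2 (socElt_mem_rightSocle m v)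

/-- The elements of `A` whose residue class is the class of a combination of nontrivial paths. -/
def rad : Submodule K A where
  carrier := {a | ∃ j, augmentation m (0 : Q.border → K) j = 0 ∧ S.π a = S.ρ j}
  add_mem' := by
    rintro a b ⟨j, hj, ha⟩ ⟨k, hk, hb⟩
    exact ⟨j + k, by rw [map_add, hj, hk, add_zero], by rw [map_add, map_add, ha, hb]⟩
  zero_mem' := ⟨0, map_zero _, by rw [map_zero, map_zero]⟩
  smul_mem' := by
    rintro c a ⟨j, hj, ha⟩
    exact ⟨c • j, by rw [map_smul, hj, smul_zero], by rw [map_smul, map_smul, ha]⟩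

variable {S}

theorem rad_mul {a : A} (ha : a ∈ S.rad) (b : A) : a * b ∈ S.rad := by
  obtain ⟨j, hj, ha⟩ := ha
  obtain ⟨k, hk⟩ := S.ρ_surj (S.π b)
  exact ⟨j * k, by rw [map_mul, hj, zero_mul], by rw [map_mul, map_mul, ha, hk]⟩

theorem mul_rad {a : A} (ha : a ∈ S.rad) (b : A) : b * a ∈ S.rad := by
  obtain ⟨j, hj, ha⟩ := ha
  obtain ⟨k, hk⟩ := S.ρ_surj (S.π b)
  exact ⟨k * j, by rw [map_mul, hj, mul_zero], by rw [map_mul, map_mul, ha, hk]⟩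

theorem isNilpotent_of_mem_rad {a : A} (ha : a ∈ S.rad) : IsNilpotent a := by
  obtain ⟨j, hj, ha⟩ := ha
  obtain ⟨n, hn⟩ := augmentation_isNilpotent m 0 (.inr rfl) hj
  have h1 : a ^ n ∈ rightSocle A := by rw [← S.π_ker, map_pow, ha, ← map_pow, hn, map_zero]
  exact ⟨n + n, by rw [pow_add, S.sq_zero _ h1 _ h1]⟩

theorem soc_mul_rad {u n : A} (hu : u ∈ rightSocle A) (hn : n ∈ S.rad) : u * n = 0 :=
  rightSocle_mul_eq_zero (J := (S.rad : Set A)) (fun _ hj a => rad_mul hj a)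
    (fun _ hj a => mul_rad hj a) (fun _ hj => isNilpotent_of_mem_rad hj) hu hn

/-- The trace moves n to the other side: t(n u y) = t(u (y n)) = 0. -/
theorem rad_mul_soc {u n : A} (hu : u ∈ rightSocle A) (hn : n ∈ S.rad) : n * u = 0 :=
  S.t_nondeg _ fun y => by
    rw [mul_assoc, S.t_comm, mul_assoc, soc_mul_rad hu (mul_rad hn y), map_zero]

variable (S)

/-- Primitive orthogonal idempotents of `A` which lift those of `B(Q, f, m, 0)`. -/
structure Idempotents (e : Q.Vertex → A) : Prop where
  complete : CompleteOrthogonalIdempotents e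
  π_e : ∀ v, S.π (e v) = S.ρ (idem m 0 v)

theorem exists_idempotents : ∃ e, S.Idempotents e := by
  have hc : CompleteOrthogonalIdempotents (fun v => S.ρ (idem m 0 v)) :=
    { idem := fun v => by
        rw [IsIdempotentElem, ← map_mul, (isRep_gen m 0).idem]
      ortho := fun v w h => by
        show S.ρ _ * S.ρ _ = 0
        rw [← map_mul, (isRep_gen m 0).orth v w h, map_zero]
      complete := by rw [← map_sum, (isRep_gen m 0).sum, map_one] }
  obtain ⟨e, he, hπ⟩ := CompleteOrthogonalIdempotents.lift_of_isNilpotent_ker S.π.toRingHom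
    (fun x hx => ⟨2, by
      have := S.π_ker.1 (RingHom.mem_ker.1 hx)
      rw [pow_two, S.sq_zero _ this _ this]⟩) hc (fun v => S.π_surj _)
  exact ⟨e, he, fun v => congrFun hπ v⟩

variable {S}

namespace Idempotents

variable {e : Q.Vertex → A} (he : S.Idempotents e)
include he

theorem exists_sub_mem_rad (a : A) : ∃ c : Q.Vertex → K, a - ∑ v, c v • e v ∈ S.rad := by
  obtain ⟨y, hy⟩ := S.ρ_surj (S.π a)
  refine ⟨augmentation m 0 y, y + (-1 : K) • ∑ v, augmentation m 0 y v • idem m 0 v, ?_, ?_⟩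
  · rw [map_add, map_smul, map_sum]
    ext w
    simp [augmentation_idem, Finset.sum_apply, Pi.single_apply]
  · rw [map_sub, map_add, hy, map_smul, map_sum, map_sum, neg_one_smul, sub_eq_add_neg]
    simp only [map_smul, he.π_e]

theorem mul_mul_mem_rad {v w : Q.Vertex} (h : v ≠ w) (a : A) : e v * a * e w ∈ S.rad := by
  obtain ⟨y, hy⟩ := S.ρ_surj (S.π a)
  refine ⟨idem m 0 v * y * idem m 0 w, ?_, ?_⟩
  · rw [map_mul, map_mul, augmentation_idem, augmentation_idem, mul_right_comm]
    ext u
    by_cases hu : u = w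
    · subst hu; simp [h.symm]
    · simp [hu]
  · rw [map_mul, map_mul, map_mul, map_mul, he.π_e, he.π_e, hy]

/-- Top and socle of e_v A agree: t(e_v u e_w y) = t(u e_w y e_v), and e_w y e_v lies in the radical
for v ≠ w. -/
theorem mul_soc_mul_eq_zero {v w : Q.Vertex} (h : v ≠ w) {u : A} (hu : u ∈ rightSocle A) :
    e v * u * e w = 0 :=
  S.t_nondeg _ fun y => by
    rw [mul_assoc, mul_assoc, S.t_comm, mul_assoc, soc_mul_rad hu (he.mul_mul_mem_rad h.symm y),
      map_zero]

theorem mul_eq_of_sum {u : A} (hu : u ∈ rightSocle A) (a : A) :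
    ∃ c : Q.Vertex → K, u * a = ∑ v, c v • (u * e v) := by
  obtain ⟨c, hc⟩ := he.exists_sub_mem_rad a
  refine ⟨c, ?_⟩
  have := soc_mul_rad hu hc
  rw [mul_sub, sub_eq_zero, Finset.mul_sum] at this
  simpa using this

/-- Since u kills the radical and u = u e_v, the right ideal u A is the line through u, so t
vanishes on it. This turns every relation with values in the socle into an equation between scalars.
-/
theorem eq_zero_of_t_eq_zero {v : Q.Vertex} {u : A} (hu : u ∈ rightSocle A)
    (huv : u * e v = u) (ht : S.t u = 0) : u = 0 :=
  S.t_nondeg _ fun y => by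
    obtain ⟨c, hc⟩ := he.mul_eq_of_sum hu y
    rw [hc, Finset.sum_eq_single v, huv, map_smul, ht, smul_zero]
    · intro w _ hw
      rw [← huv, mul_assoc, he.complete.ortho hw.symm, mul_zero, smul_zero]
    · simp

theorem mem_soc_of_mul_rad {x : A} (h : ∀ n ∈ S.rad, x * n = 0) : x ∈ rightSocle A := by
  have hx : x = ∑ v, x * e v := by rw [← Finset.mul_sum, he.complete.complete, mul_one]
  rw [hx]
  refine Submodule.sum_mem _ fun v _ => mem_rightSocle_of_mul_eq_smul (K := K) fun a => ?_
  obtain ⟨c, hc⟩ := he.exists_sub_mem_rad (e v * a)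
  refine ⟨c v, ?_⟩
  have h1 := h _ (mul_rad hc (e v))
  rw [mul_sub, ← mul_assoc, (he.complete.idem v).eq, Finset.mul_sum, mul_sub, sub_eq_zero,
    Finset.sum_eq_single v, mul_smul_comm, (he.complete.idem v).eq, mul_smul_comm, ← mul_assoc] at h1
  · exact h1
  · intro w _ hw
    rw [mul_smul_comm, he.complete.ortho hw.symm, smul_zero]
  · simp

theorem e_ne_zero (v : Q.Vertex) : e v ≠ 0 := fun h => by
  have h1 := he.π_e v
  rw [h, map_zero] at h1
  have h2 := (S.coords_of_ρ_eq_zero h1.symm).1 v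
  rw [coords_idem] at h2
  simp at h2

variable [FiniteDimensional K A]

/-- A minimal right ideal in e_v A exists because A is artinian. Its elements lie in e_v A e_v, and
t is nonzero on each nonzero one, which permits the normalization. -/
theorem exists_socle_generator (v : Q.Vertex) :
    ∃ σ ∈ rightSocle A, e v * σ = σ ∧ σ * e v = σ ∧ S.t σ = 1 := by
  have : IsArtinian K A := inferInstance
  have : IsArtinian Aᵐᵒᵖ A := isArtinian_of_tower K inferInstance
  obtain h | ⟨I, hI, hle⟩ := eq_bot_or_exists_atom_le (Submodule.span Aᵐᵒᵖ {e v})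
  · exact absurd (Submodule.span_singleton_eq_bot.1 h) (he.e_ne_zero v)
  obtain ⟨u, hu, hu0⟩ := Submodule.exists_mem_ne_zero_of_ne_bot hI.1
  have hsoc : u ∈ rightSocle A :=
    (le_sSup (show I ∈ {I : Submodule Aᵐᵒᵖ A | IsSimpleModule Aᵐᵒᵖ I} from
      isSimpleModule_iff_isAtom.2 hI) : I ≤ rightSocle A) hu
  have hev : e v * u = u := by
    obtain ⟨c, rfl⟩ := Submodule.mem_span_singleton.1 (hle hu)
    rw [← MulOpposite.op_unop c, op_smul_eq_mul, ← mul_assoc, (he.complete.idem v).eq]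
  have hue : u * e v = u := by
    conv_rhs => rw [← mul_one u, ← he.complete.complete, Finset.mul_sum]
    rw [Finset.sum_eq_single v]
    · intro w _ hw
      rw [← hev, he.mul_soc_mul_eq_zero hw.symm hsoc]
    · simp
  have ht : S.t u ≠ 0 := fun h => hu0 (he.eq_zero_of_t_eq_zero hsoc hue h)
  refine ⟨(S.t u)⁻¹ • u, soc_smul hsoc _, ?_, ?_, ?_⟩
  · rw [mul_smul_comm, hev]
  · rw [smul_mul_assoc, hue]
  · rw [map_smul, smul_eq_mul, inv_mul_cancel₀ ht]

/-- The generator of the socle of `e_v A` normalized by the symmetrizing form. -/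
def σ (v : Q.Vertex) : A := (he.exists_socle_generator v).choose

theorem σ_mem (v : Q.Vertex) : he.σ v ∈ rightSocle A := (he.exists_socle_generator v).choose_spec.1

theorem e_mul_σ (v : Q.Vertex) : e v * he.σ v = he.σ v :=
  (he.exists_socle_generator v).choose_spec.2.1

theorem σ_mul_e (v : Q.Vertex) : he.σ v * e v = he.σ v :=
  (he.exists_socle_generator v).choose_spec.2.2.1

theorem t_σ (v : Q.Vertex) : S.t (he.σ v) = 1 := (he.exists_socle_generator v).choose_spec.2.2.2

theorem σ_ne_zero (v : Q.Vertex) : he.σ v ≠ 0 := fun h => by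
  have := he.t_σ v
  rw [h, map_zero] at this
  exact zero_ne_one this

theorem eq_t_smul_σ {v : Q.Vertex} {u : A} (hu : u ∈ rightSocle A) (huv : u * e v = u) :
    u = S.t u • he.σ v := by
  rw [← sub_eq_zero]
  refine he.eq_zero_of_t_eq_zero (v := v) (Submodule.sub_mem _ hu (soc_smul (he.σ_mem v) _)) ?_ ?_
  · rw [sub_mul, huv, smul_mul_assoc, he.σ_mul_e]
  · rw [map_sub, map_smul, he.t_σ, smul_eq_mul, mul_one, sub_self]

end Idempotents

variable (S)

theorem nonempty_ker_π_equiv [FiniteDimensional K A] :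
    Nonempty (LinearMap.ker S.π.toLinearMap ≃ₗ[K] (Q.Vertex → K)) := by
  obtain ⟨e, he⟩ := S.exists_idempotents
  exact ⟨
    { toFun := fun u v => S.t (u.1 * e v)
      map_add' := fun u w => by ext v; simp [add_mul]
      map_smul' := fun c u => by ext v; simp
      invFun := fun c => ⟨∑ v, c v • he.σ v, S.π_ker.2 (Submodule.sum_mem _ fun v _ =>
        soc_smul (he.σ_mem v) _)⟩
      left_inv := fun u => Subtype.ext <| by
        have hu : u.1 ∈ rightSocle A := S.π_ker.1 u.2
        conv_rhs => rw [← mul_one u.1, ← he.complete.complete, Finset.mul_sum]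
        refine Finset.sum_congr rfl fun v _ => (he.eq_t_smul_σ (soc_mul hu _) ?_).symm
        rw [mul_assoc, (he.complete.idem v).eq]
      right_inv := fun c => by
        ext v
        show S.t ((∑ w, c w • he.σ w) * e v) = c v
        rw [Finset.sum_mul, Finset.sum_eq_single v, smul_mul_assoc, he.σ_mul_e, map_smul, he.t_σ,
          smul_eq_mul, mul_one]
        · intro w _ hw
          rw [smul_mul_assoc, ← he.σ_mul_e, mul_assoc, he.complete.ortho hw, mul_zero, smul_zero]
        · simp }⟩

theorem nonempty_ker_ρ_equiv :
    Nonempty (LinearMap.ker S.ρ.toLinearMap ≃ₗ[K] (Q.Vertex → K)) := ⟨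
    { toFun := fun u v => coords m 0 u.1 (soc v)
      map_add' := fun u w => by ext v; simp
      map_smul' := fun c u => by ext v; simp
      invFun := fun c => ⟨∑ v, c v • socElt m 0 v, by
        simp [S.ρ_socElt]⟩
      left_inv := fun u => Subtype.ext
        ((mem_rightSocle_iff m S.noDoubleLoop).1 (S.ρ_ker.1 u.2)).symm
      right_inv := fun c => by
        ext v
        show coords m 0 (∑ w, c w • socElt m 0 w) (soc v) = c v
        rw [map_sum, Finsupp.finsetSum_apply, Finset.sum_eq_single v]
        · simp [coords_socElt]
        · intro w _ hw
          simp [coords_socElt, hw]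
        · simp }⟩

/-- Both algebras are extensions of C by their socles, and each socle has one dimension for each
vertex. -/
theorem finrank_eq (S : SocleLift (K := K) m A C) [FiniteDimensional K A] :
    Module.finrank K A = Module.finrank K (Q.algebra m (0 : Q.border → K)) := by
  have hfC : Module.Finite K C := Module.Finite.of_surjective S.π.toLinearMap S.π_surj
  exact (finrank_eq_add_card_of_ker_equiv S.π.toLinearMap S.π_surj S.nonempty_ker_π_equiv.some).trans
    (finrank_eq_add_card_of_ker_equiv S.ρ.toLinearMap S.ρ_surj S.nonempty_ker_ρ_equiv.some).symm

end SocleLift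

end TwoRegularQuiver

end

/-! ### Rescaling lifted arrows so that the relations hold exactly. -/

noncomputable section

theorem FinQuiver.IsRep.smul {Q : FinQuiver} {K A : Type*} [Field K] [Ring A] [Algebra K A]
    {e : Q.Vertex → A} {x : Q.Arrow → A} (hx : Q.IsRep e x) (c : Q.Arrow → K) :
    Q.IsRep e (fun a => c a • x a) where
  idem := hx.idem
  orth := hx.orth
  sum := hx.sum
  src_mul a := by rw [mul_smul_comm, hx.src_mul]
  mul_tgt a := by rw [smul_mul_assoc, hx.mul_tgt]

namespace TwoRegularQuiver

open BasisIndex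
open scoped Classical

variable {K : Type*} [Field K] {Q : TwoRegularQuiver} {m : Q.WeightFunction}

section PathProd

variable {A : Type*} [Ring A] [Algebra K A] {e : Q.Vertex → A} {x : Q.Arrow → A}

theorem e_mul_pathProd (hx : Q.toFinQuiver.IsRep e x) (a : Q.Arrow) {i : ℕ} (hi : i ≠ 0) :
    e (Q.src a) * pathProd x a i = pathProd x a i := by
  rw [pathProd_ne_zero_succ x a hi, ← mul_assoc, hx.src_mul]

theorem pathProd_mul_e (hx : Q.toFinQuiver.IsRep e x) (a : Q.Arrow) {i : ℕ} (hi : i ≠ 0) :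
    pathProd x a i * e (Q.src (Q.g^[i] a)) = pathProd x a i := by
  obtain ⟨i, rfl⟩ := Nat.exists_eq_succ_of_ne_zero hi
  rw [pathProd_succ', mul_assoc, Nat.succ_eq_add_one, Function.iterate_succ_apply', src_g,
    hx.mul_tgt]

theorem pathProd_len_mul_e (hx : Q.toFinQuiver.IsRep e x) (a : Q.Arrow) :
    pathProd x a (len m a) * e (Q.src a) = pathProd x a (len m a) := by
  have := pathProd_mul_e hx a (len_pos m a).ne'
  rwa [iterate_len] at this

theorem pathProd_smul (c : Q.Arrow → K) (hc : ∀ a, c (Q.g a) = c a) (a : Q.Arrow) (i : ℕ) :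
    pathProd (fun a => c a • x a) a i = c a ^ i • pathProd x a i := by
  induction i generalizing a with
  | zero => simp
  | succ i ih => rw [pathProd_succ, pathProd_succ, ih, hc, smul_mul_smul_comm, pow_succ']

/-- B_{g a} is a cyclic rotation of B_a, and t is invariant under rotation. Hence scalars read off
by t are constant on g-orbits. -/
theorem t_pathProd_len_g (t : A →ₗ[K] K) (ht : ∀ x y, t (x * y) = t (y * x)) (a : Q.Arrow) :
    t (pathProd x (Q.g a) (len m (Q.g a))) = t (pathProd x a (len m a)) := by
  have h0 := (len_pos m a).ne'
  rw [len_g, pathProd_ne_zero_succ x a h0, pathProd_ne_zero_succ' x (Q.g a) h0, ht]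
  congr 3
  rw [← Function.iterate_succ_apply, Nat.succ_eq_add_one, Nat.sub_add_cancel (len_pos m a),
    iterate_len]

end PathProd

namespace SocleLift

variable {A C : Type*} [Ring A] [Algebra K A] [Ring C] [Algebra K C]
  {S : SocleLift (K := K) m A C}

namespace Idempotents

variable {e : Q.Vertex → A} (he : S.Idempotents e) {x : Q.Arrow → A}
include he

theorem pathProd_len_eq_smul_σ [FiniteDimensional K A] (hx : Q.toFinQuiver.IsRep e x) {a : Q.Arrow}
    (ha : pathProd x a (len m a) ∈ rightSocle A) :
    pathProd x a (len m a) = S.t (pathProd x a (len m a)) • he.σ (Q.src a) :=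
  he.eq_t_smul_σ ha (pathProd_len_mul_e hx a)

/-- Lifted arrows which satisfy the defining relations up to scalars in the socle can be rescaled
to satisfy the relations of `B(Q, f, m, b)` for some border function `b`. -/
theorem exists_isRep [IsAlgClosed K] [FiniteDimensional K A] (hx : Q.toFinQuiver.IsRep e x)
    (h0 : ∀ a, Q.f a ≠ a → x a * x (Q.f a) = 0)
    (h1 : ∀ a, Q.f a = a → x a * x a ∈ rightSocle A)
    (h2 : ∀ a, pathProd x a (len m a) ∈ rightSocle A)
    (h3 : ∀ a, pathProd x a (len m a) ≠ 0) :
    ∃ (b : Q.border → K) (y : Q.Arrow → A), IsRep m b e y ∧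
      (∀ a, pathProd y a (len m a) ≠ 0) ∧ ((∀ a, x a * x (Q.f a) = 0) → b = 0) := by
  have hroot : ∀ (n : ℕ) (l : K), ∃ c : K, n ≠ 0 → c ^ n = l := fun n l => by
    by_cases hn : n = 0
    · exact ⟨0, fun h => absurd hn h⟩
    · obtain ⟨c, hc⟩ := IsAlgClosed.exists_pow_nat_eq l (Nat.pos_of_ne_zero hn)
      exact ⟨c, fun _ => hc⟩
  choose r hr using hroot
  let l : Q.Arrow → K := fun a => S.t (pathProd x a (len m a))
  have hl : ∀ a, l (Q.g a) = l a := t_pathProd_len_g S.t S.t_comm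
  have hP : ∀ a, pathProd x a (len m a) = l a • he.σ (Q.src a) := fun a =>
    he.pathProd_len_eq_smul_σ hx (h2 a)
  have hl0 : ∀ a, l a ≠ 0 := fun a h => h3 a (by rw [hP, h, zero_smul])
  -- B_a has `len m a` factors, so a root of that order of 1 / l_a turns B_a into σ. It is constant
  -- on g-orbits, as `pathProd_smul` requires.
  let c : Q.Arrow → K := fun a => r (len m a) (l a)⁻¹
  have hcg : ∀ a, c (Q.g a) = c a := fun a => by simp only [c, len_g, hl]
  have hP' : ∀ a, pathProd (fun a => c a • x a) a (len m a) = he.σ (Q.src a) := fun a => by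
    rw [pathProd_smul c hcg, hr _ _ (len_pos m a).ne', hP, smul_smul, inv_mul_cancel₀ (hl0 a),
      one_smul]
  let b : Q.border → K := fun v => S.t ((c v.2.choose • x v.2.choose) * (c v.2.choose • x v.2.choose))
  refine ⟨b, fun a => c a • x a, ⟨hx.smul c, fun a ha => ?_, fun a ha => ?_, fun a => ?_⟩,
    fun a => ?_, fun h => ?_⟩
  · rw [smul_mul_smul_comm, h0 a ha, smul_zero]
  · have hv : (⟨Q.src a, a, rfl, ha⟩ : Q.border).2.choose = a := by
      have hs := (⟨Q.src a, a, rfl, ha⟩ : Q.border).2.choose_spec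
      obtain h | h := eq_or_eq_bar hs.1
      · exact h
      · exact absurd (h ▸ hs.2) (S.noDoubleLoop.f_bar_ne ha)
    rw [hP']
    show _ = S.t _ • _
    rw [hv]
    refine he.eq_t_smul_σ ?_ ?_
    · rw [smul_mul_smul_comm]
      exact soc_smul (h1 a ha) _
    · rw [mul_assoc, smul_mul_assoc (c a) (x a) (e _), ← tgt_eq_src_of_f_eq ha, hx.mul_tgt]
  · rw [hP', hP', src_bar]
  · rw [hP']
    exact he.σ_ne_zero _
  · funext v
    obtain ⟨-, hv⟩ := v.2.choose_spec
    show S.t _ = 0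
    have := h v.2.choose
    rw [hv] at this
    rw [smul_mul_smul_comm, this, smul_zero, map_zero]

end Idempotents

/-- The lift from B(Q, f, m, b) is injective, as the socle elements survive, and the dimension of
the source is the same for b and for 0, hence that of A. -/
theorem nonempty_algEquiv_of_isRep (S : SocleLift (K := K) m A C) [FiniteDimensional K A]
    {e : Q.Vertex → A} {b : Q.border → K} {y : Q.Arrow → A} (hy : IsRep m b e y)
    (hy0 : ∀ a, pathProd y a (len m a) ≠ 0) : Nonempty (A ≃ₐ[K] Q.algebra m b) := by
  have hinj : Function.Injective hy.lift :=
    injective_of_socElt_ne_zero m b S.noDoubleLoop _ fun v => by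
      have := hy.lift_socElt (Q.out v)
      rw [src_out] at this
      rw [this]
      exact hy0 _
  have hfin : Module.finrank K (Q.algebra m b) = Module.finrank K A := by
    rw [S.finrank_eq, finrank_algebra_eq m S.noDoubleLoop]
  have hsurj : Function.Surjective hy.lift := by
    have h1 : Module.finrank K (LinearMap.range hy.lift.toLinearMap) = Module.finrank K A := by
      rw [← hfin]
      exact (LinearEquiv.ofInjective hy.lift.toLinearMap hinj).finrank_eq.symm
    exact LinearMap.range_eq_top.1 (Submodule.eq_top_of_finrank_eq h1)
  exact ⟨(AlgEquiv.ofBijective hy.lift ⟨hinj, hsurj⟩).symm⟩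

end SocleLift

end TwoRegularQuiver

end

/-! ### Lifting arrows to A, and perturbations that do not affect long products. -/

noncomputable section

namespace TwoRegularQuiver

open BasisIndex
open scoped Classical

variable {K : Type*} [Field K] {Q : TwoRegularQuiver} {m : Q.WeightFunction}

namespace SocleLift

variable {A C : Type*} [Ring A] [Algebra K A] [Ring C] [Algebra K C]
  {S : SocleLift (K := K) m A C}

/-- Lifts of the arrows to `A`, compatible with the idempotents `e`. -/
structure ArrowLift (S : SocleLift (K := K) m A C) (e : Q.Vertex → A) (x : Q.Arrow → A) :
    Prop extends Q.toFinQuiver.IsRep e x where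
  π_x : ∀ a, S.π (x a) = S.ρ (gen m 0 a)
  ne_zero : ∀ a, len m a = 1 → x a ≠ 0

theorem ρ_gen_eq_zero {a : Q.Arrow} (ha : len m a = 1) : S.ρ (gen m 0 a) = 0 := by
  have := pathProd_gen_len m (0 : Q.border → K) a
  rw [ha, pathProd_one] at this
  rw [this, S.ρ_socElt]

/-- An arrow with `len m a = 1` equals its own B_a and is invisible in C; its lift is taken to be
the socle generator. Other lifts are cut down by the idempotents at both ends. -/
theorem Idempotents.exists_arrowLift [FiniteDimensional K A] {e : Q.Vertex → A}
    (he : S.Idempotents e) : ∃ x, S.ArrowLift e x := by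
  choose y hy using fun a => S.π_surj (S.ρ (gen m 0 a))
  have hid := fun v => (he.complete.idem v).eq
  have htgt : ∀ {a}, len m a = 1 → Q.tgt a = Q.src a := fun {a} h => by
    rw [← src_g, g_eq_of_len_eq_one m h]
  refine ⟨fun a => if len m a = 1 then he.σ (Q.src a) else e (Q.src a) * y a * e (Q.tgt a),
    ⟨hid, fun v w h => he.complete.ortho h, he.complete.complete, fun a => ?_, fun a => ?_⟩,
    fun a => ?_, fun a ha => ?_⟩
  · split_ifs
    · exact he.e_mul_σ _
    · rw [← mul_assoc, ← mul_assoc, hid]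
  · split_ifs with h
    · rw [htgt h, he.σ_mul_e]
    · rw [mul_assoc, hid]
  · split_ifs with h
    · rw [S.π_ker.2 (he.σ_mem _), ρ_gen_eq_zero h]
    · rw [map_mul, map_mul, he.π_e, he.π_e, hy, ← map_mul, (isRep_gen m 0).src_mul, ← map_mul,
        (isRep_gen m 0).mul_tgt]
  · rw [if_pos ha]
    exact he.σ_ne_zero _

theorem not_mem_soc_of_coords {z : A} {y : Q.algebra m (0 : Q.border → K)} (hz : S.π z = S.ρ y)
    {h : Q.Arrow} {i : ℕ} (hy : coords m 0 y (mid h i) ≠ 0) : z ∉ rightSocle A := fun hm => by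
  rw [S.π_ker.2 hm] at hz
  exact hy ((S.coords_of_ρ_eq_zero hz.symm).2 h i)

namespace ArrowLift

variable {e : Q.Vertex → A} {x : Q.Arrow → A} (hx : S.ArrowLift e x)
include hx

theorem mem_rad (a : Q.Arrow) : x a ∈ S.rad := ⟨gen m 0 a, augmentation_gen m 0 a, hx.π_x a⟩

theorem π_pathProd (a : Q.Arrow) (i : ℕ) :
    S.π (pathProd x a i) = S.ρ (pathProd (gen m 0) a i) := by
  rw [map_pathProd, map_pathProd]
  simp only [hx.π_x]

theorem pathProd_mem_rad (a : Q.Arrow) {i : ℕ} (hi : i ≠ 0) : pathProd x a i ∈ S.rad :=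
  ⟨_, augmentation_pathProd m 0 a hi, hx.π_pathProd a i⟩

theorem exists_sub_sum_mul_mem {n : A} (hn : n ∈ S.rad) :
    ∃ c : Q.Arrow → A, n - ∑ a, x a * c a ∈ rightSocle A := by
  obtain ⟨j, hj, hn⟩ := hn
  obtain ⟨d, rfl⟩ := exists_eq_sum_gen_mul m 0 ((mem_pathIdeal_one_iff m 0 (.inr rfl)).2 hj)
  choose c hc using fun a => S.π_surj (S.ρ (d a))
  refine ⟨c, S.π_ker.1 ?_⟩
  rw [map_sub, hn, map_sum, map_sum, sub_eq_zero]
  simp only [map_mul, hc, hx.π_x]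

theorem exists_sub_sum_mul_mem' {n : A} (hn : n ∈ S.rad) :
    ∃ c : Q.Arrow → A, n - ∑ a, c a * x a ∈ rightSocle A := by
  obtain ⟨j, hj, hn⟩ := hn
  obtain ⟨d, rfl⟩ := exists_eq_sum_mul_gen m 0 ((mem_pathIdeal_one_iff m 0 (.inr rfl)).2 hj)
  choose c hc using fun a => S.π_surj (S.ρ (d a))
  refine ⟨c, S.π_ker.1 ?_⟩
  rw [map_sub, hn, map_sum, map_sum, sub_eq_zero]
  simp only [map_mul, hc, hx.π_x]

/-- Up to socle elements, which y kills, the radical is generated by the lifted arrows. So an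
element of the radical that kills all arrows kills the radical and lies in the socle. -/
theorem exists_mul_ne_zero (he : S.Idempotents e) {y : A} (hy : y ∈ S.rad)
    (hy' : y ∉ rightSocle A) : ∃ a, y * x a ≠ 0 := by
  by_contra! h
  refine hy' (he.mem_soc_of_mul_rad fun n hn => ?_)
  obtain ⟨c, hc⟩ := hx.exists_sub_sum_mul_mem hn
  have := rad_mul_soc hc hy
  rw [mul_sub, sub_eq_zero, Finset.mul_sum] at this
  rw [this]
  exact Finset.sum_eq_zero fun a _ => by rw [← mul_assoc, h, zero_mul]

theorem mul_f_mem (a : Q.Arrow) : x a * x (Q.f a) ∈ rightSocle A := by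
  rw [← S.π_ker, map_mul, hx.π_x, hx.π_x, ← map_mul, (isRep_gen m 0).mul_f]
  have : borderCoef (0 : Q.border → K) a = 0 := by unfold borderCoef; split_ifs <;> rfl
  rw [this, zero_smul, map_zero]

theorem pathProd_len_mem (a : Q.Arrow) : pathProd x a (len m a) ∈ rightSocle A := by
  rw [← S.π_ker, hx.π_pathProd, pathProd_gen_len, S.ρ_socElt]

/-- B_a without its last arrow is not in the socle, so some arrow c does not kill it. If c continued
by f, the last two factors would form a socle element, killed by the rest of the path; that rest is
nonempty precisely because the length is at least three. -/
theorem pathProd_len_ne_zero (he : S.Idempotents e) {a : Q.Arrow} (ha : 3 ≤ len m a) :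
    pathProd x a (len m a) ≠ 0 := by
  obtain ⟨l, hl⟩ := Nat.exists_eq_add_of_le' ha
  have hy : pathProd x a (l + 2) ∉ rightSocle A :=
    not_mem_soc_of_coords (hx.π_pathProd a (l + 2)) (h := a) (i := l + 1) (by
      rw [coords_pathProd m 0 a (by omega), word_apply_mid m _ _ _ (by omega) (by omega)]
      simp)
  obtain ⟨c, hc⟩ := hx.exists_mul_ne_zero he (hx.pathProd_mem_rad a (by omega)) hy
  rw [pathProd_succ', mul_assoc] at hc
  by_cases hs : Q.src c = Q.tgt (Q.g^[l + 1] a)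
  · obtain rfl | rfl := eq_g_or_eq_f hs
    · rw [← mul_assoc, ← pathProd_succ', ← Function.iterate_succ_apply' Q.g, ← pathProd_succ'] at hc
      rwa [hl]
    · exact absurd (rad_mul_soc (hx.mul_f_mem _) (hx.pathProd_mem_rad a (by omega))) hc
  · rw [hx.mul_eq_zero hs, mul_zero] at hc
    exact absurd rfl hc

end ArrowLift

/-- The elements of `rad A` whose products with `rad A` lie in the socle. -/
def rad₂ (S : SocleLift (K := K) m A C) : Submodule K A where
  carrier := {w | w ∈ S.rad ∧ ∀ n ∈ S.rad, w * n ∈ rightSocle A ∧ n * w ∈ rightSocle A}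
  add_mem' := by
    rintro a b ⟨ha, ha'⟩ ⟨hb, hb'⟩
    refine ⟨S.rad.add_mem ha hb, fun n hn => ⟨?_, ?_⟩⟩
    · rw [add_mul]; exact Submodule.add_mem _ (ha' n hn).1 (hb' n hn).1
    · rw [mul_add]; exact Submodule.add_mem _ (ha' n hn).2 (hb' n hn).2
  zero_mem' := ⟨S.rad.zero_mem, fun n _ => by simp⟩
  smul_mem' := by
    rintro c a ⟨ha, ha'⟩
    refine ⟨S.rad.smul_mem c ha, fun n hn => ⟨?_, ?_⟩⟩
    · rw [smul_mul_assoc]; exact soc_smul (ha' n hn).1 c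
    · rw [mul_smul_comm]; exact soc_smul (ha' n hn).2 c

theorem rad₂_le_rad {w : A} (hw : w ∈ S.rad₂) : w ∈ S.rad := hw.1

theorem rad₂_mul_mul {w n n' : A} (hw : w ∈ S.rad₂) (hn : n ∈ S.rad) (hn' : n' ∈ S.rad) :
    w * (n * n') = 0 := by
  rw [← mul_assoc, soc_mul_rad (hw.2 n hn).1 hn']

namespace ArrowLift

variable {e : Q.Vertex → A} {x : Q.Arrow → A} (hx : S.ArrowLift e x)
include hx

theorem pathProd_mem_rad₂ (a : Q.Arrow) {i : ℕ} (hi : i ≠ 0) (hi' : i + 1 = len m a) :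
    pathProd x a i ∈ S.rad₂ := by
  refine ⟨hx.pathProd_mem_rad a hi, fun n hn => ⟨?_, ?_⟩⟩
  · obtain ⟨c, hc⟩ := hx.exists_sub_sum_mul_mem hn
    have := rad_mul_soc hc (hx.pathProd_mem_rad a hi)
    rw [mul_sub, sub_eq_zero, Finset.mul_sum] at this
    rw [this]
    refine Submodule.sum_mem _ fun d _ => ?_
    rw [← mul_assoc]
    refine soc_mul ?_ _
    rw [← S.π_ker, map_mul, hx.π_pathProd, hx.π_x, ← map_mul, (isRep_gen m 0).pathProd_mul m _ _ hi]
    split_ifs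
    · rw [hi', pathProd_gen_len, S.ρ_socElt]
    · rw [map_zero]
  · obtain ⟨c, hc⟩ := hx.exists_sub_sum_mul_mem' hn
    have := soc_mul_rad hc (hx.pathProd_mem_rad a hi)
    rw [sub_mul, sub_eq_zero, Finset.sum_mul] at this
    rw [this]
    refine Submodule.sum_mem _ fun d _ => ?_
    rw [mul_assoc]
    refine mul_mem_rightSocle _ ?_
    rw [← S.π_ker, map_mul, hx.π_pathProd, hx.π_x, ← map_mul,
      (isRep_gen m 0).mul_pathProd (.inr rfl) _ _ hi]
    split_ifs with h1 h2
    · rw [← h1, len_g] at hi'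
      rw [hi', pathProd_gen_len, S.ρ_socElt]
    · rw [pathProd_gen_len, map_smul, S.ρ_socElt, smul_zero]
    · rw [map_zero]

end ArrowLift

namespace ArrowLift

variable {x x' : Q.Arrow → A}

theorem pathProd_two_sub_mem (hx : ∀ a, x a ∈ S.rad) (hw : ∀ a, x' a - x a ∈ S.rad₂) (a : Q.Arrow) :
    pathProd x' a 2 - pathProd x a 2 ∈ rightSocle A := by
  have h1 := (hw a).2 _ (hx (Q.g a))
  have h2 := (hw (Q.g a)).2 _ (hx a)
  have h3 := (hw a).2 _ (rad₂_le_rad (hw (Q.g a)))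
  have : pathProd x' a 2 - pathProd x a 2 = (x' a - x a) * x (Q.g a) +
      x a * (x' (Q.g a) - x (Q.g a)) + (x' a - x a) * (x' (Q.g a) - x (Q.g a)) := by
    simp only [pathProd_succ, pathProd_zero, mul_one]
    noncomm_ring
  rw [this]
  exact Submodule.add_mem _ (Submodule.add_mem _ h1.1 h2.2) h3.1

/-- A perturbation from `rad₂` followed by two radical factors is zero; and products of length two
change only by socle elements, which the preceding factor kills. -/
theorem pathProd_eq_of_three_le (hx : ∀ a, x a ∈ S.rad) (hw : ∀ a, x' a - x a ∈ S.rad₂)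
    (a : Q.Arrow) (i : ℕ) : pathProd x' a (i + 3) = pathProd x a (i + 3) := by
  have hx' : ∀ a, x' a ∈ S.rad := fun a => by
    have := S.rad.add_mem (rad₂_le_rad (hw a)) (hx a)
    rwa [sub_add_cancel] at this
  have key : ∀ a i, x' a * pathProd x (Q.g a) (i + 2) = pathProd x a (i + 3) := fun a i => by
    have h1 : pathProd x (Q.g (Q.g a)) (i + 1) ∈ S.rad := by
      rw [pathProd_succ]; exact rad_mul (hx _) _
    have := rad₂_mul_mul (hw a) (hx (Q.g a)) h1
    rw [← pathProd_succ, sub_mul, sub_eq_zero] at this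
    rw [this, ← pathProd_succ]
  induction i generalizing a with
  | zero =>
    have := rad_mul_soc (pathProd_two_sub_mem hx hw (Q.g a)) (hx' a)
    rw [mul_sub, sub_eq_zero] at this
    rw [zero_add, pathProd_succ, this]
    exact key a 0
  | succ i ih => rw [Nat.add_right_comm, pathProd_succ, ih, key]

end ArrowLift

end SocleLift

end TwoRegularQuiver

end

/-! ### Products of arrows modified by parallel paths. -/

noncomputable section

namespace TwoRegularQuiver

open BasisIndex
open scoped Classical

variable {K : Type*} [Field K] {Q : TwoRegularQuiver} {m : Q.WeightFunction}

theorem NoDoubleLoop.tgt_f_ne (hQ : Q.NoDoubleLoop) {a : Q.Arrow} (ha : Q.g a = a) :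
    Q.tgt (Q.f a) ≠ Q.src a := by
  rw [← bar_g, ha]
  exact hQ a (by rw [← src_g, ha])

theorem g_f_eq_of_f_f_ne {a : Q.Arrow} (h : Q.tgt (Q.f a) = Q.src a) (hne : Q.f (Q.f a) ≠ a) :
    Q.g (Q.f a) = a := by
  rw [← src_f] at h
  rw [g, bar_eq_of_ne h.symm hne.symm]

/-- The hypotheses say that the path a, f a closes up but f does not, so g(f a) = a. Length one
would then force f(f a) = a, and length two would give g a = f a. -/
theorem three_le_len_f (m : Q.WeightFunction) {a : Q.Arrow} (h : Q.tgt (Q.f a) = Q.src a)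
    (hne : Q.f (Q.f a) ≠ a) : 3 ≤ len m (Q.f a) := by
  have hg := g_f_eq_of_f_f_ne h hne
  have h0 := len_pos m (Q.f a)
  by_contra hlt
  obtain h1 | h2 : len m (Q.f a) = 1 ∨ len m (Q.f a) = 2 := by omega
  · have h1 := g_eq_of_len_eq_one m h1
    rw [hg] at h1
    exact hne (by rw [← h1, ← h1])
  · have h2 := g_g_eq_of_len_eq_two m h2
    rw [hg] at h2
    exact g_ne_f a h2

theorem NoDoubleLoop.two_le_len (hQ : Q.NoDoubleLoop) (m : Q.WeightFunction) {a : Q.Arrow}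
    (h : Q.f (Q.f a) = a) : 2 ≤ len m a := by
  have h0 := len_pos m a
  by_contra hlt
  exact hQ.tgt_f_ne (g_eq_of_len_eq_one m (show len m a = 1 by omega)) (by rw [← src_f, h])

theorem iterate_len_sub_one_g (m : Q.WeightFunction) (a : Q.Arrow) :
    Q.g^[len m a - 1] (Q.g a) = a := by
  rw [← Function.iterate_succ_apply, Function.iterate_succ_apply', g_iterate_len_sub_one]

namespace SocleLift

variable {A C : Type*} [Ring A] [Algebra K A] [Ring C] [Algebra K C]
  {S : SocleLift (K := K) m A C}

/-- The lift of the arrow `h` changed by a multiple of a path parallel to `h`. -/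
def modified (m : Q.WeightFunction) (x : Q.Arrow → A) (c : Q.Arrow → K) (h : Q.Arrow) : A :=
  -- B_{g(f h)} ends with the arrow f h. Omitting it leaves a path from the target of f h to the
  -- target of h, which is parallel to h when f h ends at the source of h. `Admissible` also makes
  -- its length at least two, so that the change lies in `rad₂`.
  x h - c h • pathProd x (Q.g (Q.f h)) (len m (Q.f h) - 1)

/-- The coefficients `c` are supported at the arrows `h` for which `modified` makes sense. -/
def Admissible (m : Q.WeightFunction) (c : Q.Arrow → K) : Prop :=
  ∀ h, c h ≠ 0 → 3 ≤ len m (Q.f h) ∧ Q.tgt (Q.f h) = Q.src h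

theorem modified_of_len_eq_one (hQ : Q.NoDoubleLoop) {x : Q.Arrow → A}
    {c : Q.Arrow → K} (hc : Admissible m c) {a : Q.Arrow} (ha : len m a = 1) :
    modified m x c a = x a := by
  have : c a = 0 := by
    by_contra h
    exact hQ.tgt_f_ne (g_eq_of_len_eq_one m ha) (hc a h).2
  rw [modified, this, zero_smul, sub_zero]

namespace ArrowLift

variable {e : Q.Vertex → A} {x : Q.Arrow → A} (hx : S.ArrowLift e x) {c : Q.Arrow → K}
  (hc : Admissible m c)
include hx hc

theorem modified_sub_mem (a : Q.Arrow) : modified m x c a - x a ∈ S.rad₂ := by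
  rw [modified, sub_sub_cancel_left]
  refine Submodule.neg_mem _ ?_
  by_cases h : c a = 0
  · rw [h, zero_smul]; exact Submodule.zero_mem _
  · have := (hc a h).1
    refine Submodule.smul_mem _ _ (hx.pathProd_mem_rad₂ _ (by omega) ?_)
    rw [len_g]; omega

theorem modified_mem_rad (a : Q.Arrow) : modified m x c a ∈ S.rad := by
  have := S.rad.add_mem (rad₂_le_rad (hx.modified_sub_mem hc a)) (hx.mem_rad a)
  rwa [sub_add_cancel] at this

theorem isRep_modified : Q.toFinQuiver.IsRep e (modified m x c) where
  idem := hx.idem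
  orth := hx.orth
  sum := hx.sum
  src_mul a := by
    rw [modified, mul_sub, hx.src_mul, mul_smul_comm]
    by_cases h : c a = 0
    · simp [h]
    · obtain ⟨h1, h2⟩ := hc a h
      have := e_mul_pathProd hx.toIsRep (Q.g (Q.f a)) (i := len m (Q.f a) - 1) (by omega)
      rw [src_g, h2] at this
      rw [this]
  mul_tgt a := by
    rw [modified, sub_mul, hx.mul_tgt, smul_mul_assoc]
    by_cases h : c a = 0
    · simp [h]
    · obtain ⟨h1, h2⟩ := hc a h
      have := pathProd_mul_e hx.toIsRep (Q.g (Q.f a)) (i := len m (Q.f a) - 1) (by omega)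
      rw [iterate_len_sub_one_g, src_f] at this
      rw [this]

/-- The path added to x_a followed by x_{f a} completes B_{g(f a)}. Dually x_a completes B_a with
the path added to x_{f a} when f(f a) = a; otherwise that path starts with f a, and the socle
element x_a x_{f a} kills its remainder. The two added paths together are too long to survive. -/
theorem modified_mul_modified (a : Q.Arrow) :
    modified m x c a * modified m x c (Q.f a) = x a * x (Q.f a)
      - c a • pathProd x (Q.g (Q.f a)) (len m (Q.g (Q.f a)))
      - (if Q.f (Q.f a) = a then c (Q.f a) else 0) • pathProd x a (len m a) := by
  have h1 : c a • (pathProd x (Q.g (Q.f a)) (len m (Q.f a) - 1) * x (Q.f a)) =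
      c a • pathProd x (Q.g (Q.f a)) (len m (Q.g (Q.f a))) := by
    rw [len_g, pathProd_ne_zero_succ' x (Q.g (Q.f a)) (len_pos m (Q.f a)).ne',
      iterate_len_sub_one_g]
  have h2 : c (Q.f a) • (x a * pathProd x (Q.g (Q.f (Q.f a))) (len m (Q.f (Q.f a)) - 1)) =
      (if Q.f (Q.f a) = a then c (Q.f a) else 0) • pathProd x a (len m a) := by
    by_cases h : c (Q.f a) = 0
    · simp [h]
    obtain ⟨h1, h2⟩ := hc _ h
    split_ifs with h3
    · rw [h3, ← pathProd_ne_zero_succ x a (len_pos m a).ne']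
    · have h4 : Q.g (Q.f (Q.f a)) = Q.f a := by
        obtain h5 | h5 := eq_g_or_eq_f (a := a) (b := Q.g (Q.f (Q.f a))) (by rw [src_g, h2, src_f])
        · exact absurd (g_injective h5) h3
        · exact h5
      rw [h4, pathProd_ne_zero_succ x (Q.f a) (by omega), ← mul_assoc,
        soc_mul_rad (hx.mul_f_mem a) (hx.pathProd_mem_rad _ (by omega)), zero_smul, smul_zero]
  have h3 : (c a • pathProd x (Q.g (Q.f a)) (len m (Q.f a) - 1)) *
      (c (Q.f a) • pathProd x (Q.g (Q.f (Q.f a))) (len m (Q.f (Q.f a)) - 1)) = 0 := by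
    by_cases h : c a = 0
    · simp [h]
    by_cases h' : c (Q.f a) = 0
    · simp [h']
    have h1 := (hc _ h).1
    have h2 := (hc _ h').1
    rw [smul_mul_smul_comm, pathProd_ne_zero_succ x (Q.g (Q.f (Q.f a))) (by omega),
      rad₂_mul_mul (hx.pathProd_mem_rad₂ _ (by omega) (by rw [len_g]; omega)) (hx.mem_rad _)
        (hx.pathProd_mem_rad _ (by omega)), smul_zero]
  rw [modified, modified, sub_mul, mul_sub, mul_sub, h3, smul_mul_assoc, mul_smul_comm, h1, h2]
  abel

theorem pathProd_modified_mem (a : Q.Arrow) (ha : len m a ≠ 1) :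
    pathProd (modified m x c) a (len m a) ∈ rightSocle A := by
  have h0 := len_pos m a
  by_cases h2 : len m a = 2
  · have h1 := hx.pathProd_len_mem a
    rw [h2] at h1 ⊢
    have := Submodule.add_mem _ (pathProd_two_sub_mem hx.mem_rad (hx.modified_sub_mem hc) a) h1
    rwa [sub_add_cancel] at this
  · obtain ⟨i, hi⟩ := Nat.exists_eq_add_of_le' (show 3 ≤ len m a by omega)
    have h1 := hx.pathProd_len_mem a
    rw [hi] at h1 ⊢
    rwa [pathProd_eq_of_three_le hx.mem_rad (hx.modified_sub_mem hc)]

/-- Covers B_a of length two. If the product with g a vanished as well, the modified arrow would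
kill all modified arrows, then all longer paths, then all original arrows, and so lie in the socle;
but its coordinate at the path a is nonzero. -/
theorem modified_mul_g_ne_zero (he : S.Idempotents e) {a : Q.Arrow} (ha : 2 ≤ len m a)
    (h0 : modified m x c a * modified m x c (Q.f a) = 0) :
    modified m x c a * modified m x c (Q.g a) ≠ 0 := by
  intro hg
  have hzero : ∀ d, modified m x c a * modified m x c d = 0 := fun d => by
    by_cases hs : Q.src d = Q.tgt a
    · obtain rfl | rfl := eq_g_or_eq_f hs
      · exact hg
      · exact h0
    · exact (hx.isRep_modified hc).mul_eq_zero hs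
  have hpath : ∀ d i, modified m x c a * pathProd x d (i + 2) = 0 := fun d i => by
    obtain rfl | ⟨i, rfl⟩ : i = 0 ∨ ∃ j, i = j + 1 := by cases i <;> simp
    · have := rad_mul_soc (pathProd_two_sub_mem hx.mem_rad (hx.modified_sub_mem hc) d)
        (hx.modified_mem_rad hc a)
      rw [mul_sub, sub_eq_zero] at this
      rw [zero_add, ← this, pathProd_succ, ← mul_assoc, hzero, zero_mul]
    · rw [← pathProd_eq_of_three_le hx.mem_rad (hx.modified_sub_mem hc), pathProd_succ, ← mul_assoc,
        hzero, zero_mul]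
  have hx0 : ∀ d, modified m x c a * x d = 0 := fun d => by
    have h1 := hzero d
    rw [modified.eq_def m x c d, mul_sub, sub_eq_zero] at h1
    rw [h1]
    by_cases h : c d = 0
    · simp [h]
    · obtain ⟨i, hi⟩ := Nat.exists_eq_add_of_le' (hc d h).1
      rw [hi, show i + 3 - 1 = i + 2 by omega, mul_smul_comm, hpath, smul_zero]
  refine absurd hx0 ?_
  push Not
  refine hx.exists_mul_ne_zero he (hx.modified_mem_rad hc a) ?_
  refine not_mem_soc_of_coords (S := S) (h := a) (i := 0) (y := gen m 0 a + (-1 : K) • c a •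
    pathProd (gen m (0 : Q.border → K)) (Q.g (Q.f a)) (len m (Q.f a) - 1)) ?_ ?_
  · rw [modified, map_sub, map_smul, hx.π_x, hx.π_pathProd, map_add, map_smul, map_smul,
      neg_one_smul, sub_eq_add_neg]
  · have h1 := coords_pathProd m (0 : Q.border → K) a (i := 1) (by omega)
    rw [pathProd_one] at h1
    rw [map_add, map_smul, map_smul, Finsupp.add_apply, Finsupp.smul_apply, Finsupp.smul_apply, h1,
      word_apply_mid m _ _ _ (by omega) (by omega)]
    by_cases h : c a = 0
    · simp [h]
    · have := (hc a h).1
      rw [coords_pathProd m (0 : Q.border → K) _ (by omega), word_apply_mid_of_ne m (Or.inr (by omega))]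
      simp

end ArrowLift

end SocleLift

end TwoRegularQuiver

end

/-! ### Solving for the correction coefficients. -/

noncomputable section

namespace TwoRegularQuiver

open BasisIndex
open scoped Classical

variable {K : Type*} [Field K] {Q : TwoRegularQuiver} {m : Q.WeightFunction}

/-- Arrows can be compared in a connected quiver: a set of arrows closed under `bar` and `g` is
everything. -/
def Connected (Q : TwoRegularQuiver) : Prop :=
  ∀ s : Set Q.Arrow, s.Nonempty → (∀ a ∈ s, Q.bar a ∈ s ∧ Q.g a ∈ s) → ∀ a, a ∈ s

namespace SocleLift

variable {A C : Type*} [Ring A] [Algebra K A] [Ring C] [Algebra K C]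
  {S : SocleLift (K := K) m A C}

/-- Elements `x` of `A` satisfying the relations of `B(Q, f, m, b)` up to scalars. -/
structure WeakRep (S : SocleLift (K := K) m A C) (e : Q.Vertex → A) (x : Q.Arrow → A) :
    Prop extends Q.toFinQuiver.IsRep e x where
  mul_f_eq_zero : ∀ a, Q.f a ≠ a → x a * x (Q.f a) = 0
  border_mem : ∀ a, Q.f a = a → x a * x a ∈ rightSocle A
  len_mem : ∀ a, pathProd x a (len m a) ∈ rightSocle A
  len_ne_zero : ∀ a, pathProd x a (len m a) ≠ 0
  mul_f_eq_zero_of_two : (2 : K) ≠ 0 → ∀ a, x a * x (Q.f a) = 0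

theorem Idempotents.eq_zero_of_mul_mul {e : Q.Vertex → A} (he : S.Idempotents e) {v w : Q.Vertex}
    {u : A} (hu : u ∈ rightSocle A) (hv : e v * u = u) (hw : u * e w = u)
    (ht : v = w → S.t u = 0) : u = 0 := by
  by_cases h : v = w
  · exact he.eq_zero_of_t_eq_zero hu hw (ht h)
  · rw [← hw, ← hv, he.mul_soc_mul_eq_zero h hu]

namespace ArrowLift

variable {e : Q.Vertex → A} {x : Q.Arrow → A}

/-- The coefficients for which the modified arrows satisfy the zero relations. -/
def coef (S : SocleLift (K := K) m A C) (x : Q.Arrow → A) (a : Q.Arrow) : K :=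
  if Q.tgt (Q.f a) = Q.src a ∧ 3 ≤ len m (Q.f a) then
    if Q.f (Q.f a) = a then
      -- For an f-fixed loop the same coefficient enters twice, whence the 2. In characteristic two
      -- the quotient is 0 by convention and the loop stays unmodified.
      if Q.f a = a then S.t (x a * x (Q.f a)) / (2 * S.t (pathProd x a (len m a)))
      -- In a 2-cycle of f the arrows a and f a pose the same equation by symmetry of t. One of the
      -- two coefficients suffices: the only admissible one, or the one chosen by the enumeration if
      -- both are admissible.
      else if len m a < 3 ∨ Fintype.equivFin _ a < Fintype.equivFin _ (Q.f a) then
        S.t (x a * x (Q.f a)) / S.t (pathProd x (Q.f a) (len m (Q.f a)))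
      else 0
    else S.t (x a * x (Q.f a)) / S.t (pathProd x (Q.f a) (len m (Q.f a)))
  else 0

theorem admissible_coef : Admissible m (coef S x) := fun a ha => by
  unfold coef at ha
  split_ifs at ha with h <;> first | exact ⟨h.2, h.1⟩ | exact absurd rfl ha

/-- Applying t to `modified_mul_modified` shows that this equation is the vanishing of x'_a x'_{f
a}. The hypothesis `hs` removes the 2-cycles of f for which neither coefficient is admissible. -/
theorem coef_eq (hx : S.ArrowLift e x) (he : S.Idempotents e)
    (hs : ∀ a, Q.f a ≠ a → Q.f (Q.f a) = a → 3 ≤ len m a ∨ 3 ≤ len m (Q.f a)) (a : Q.Arrow)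
    (ha : Q.f a ≠ a ∨ (2 : K) ≠ 0) (hv : Q.src a = Q.tgt (Q.f a)) :
    S.t (x a * x (Q.f a)) = coef S x a * S.t (pathProd x (Q.f a) (len m (Q.f a))) +
      (if Q.f (Q.f a) = a then coef S x (Q.f a) else 0) * S.t (pathProd x a (len m a)) := by
  have hl : ∀ a, 3 ≤ len m a → S.t (pathProd x a (len m a)) ≠ 0 := fun a ha h0 =>
    hx.pathProd_len_ne_zero he ha
      (he.eq_zero_of_t_eq_zero (hx.pathProd_len_mem a) (pathProd_len_mul_e hx.toIsRep a) h0)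
  by_cases h2 : Q.f (Q.f a) = a
  · by_cases h1 : Q.f a = a
    · have h3 := S.noDoubleLoop.three_le_len m h1
      have h4 := hl a h3
      have h5 := ha.resolve_left (not_not.2 h1)
      have h6 : coef S x a = S.t (x a * x a) / (2 * S.t (pathProd x a (len m a))) := by
        rw [coef, if_pos ⟨hv.symm, by rwa [h1]⟩, if_pos h2, if_pos h1, h1]
      simp only [h1, if_true, h6]
      field_simp
      ring
    · have hne : Fintype.equivFin _ a ≠ Fintype.equivFin _ (Q.f a) := fun h =>
        h1 ((Fintype.equivFin _).injective h).symm
      have hcomm : S.t (x (Q.f a) * x a) = S.t (x a * x (Q.f a)) := S.t_comm _ _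
      have hla := hl a
      have hlf := hl (Q.f a)
      have h12 : a ≠ Q.f a := fun h => h1 h.symm
      have c1 : coef S x a = if 3 ≤ len m (Q.f a) ∧ (len m a < 3 ∨
          Fintype.equivFin _ a < Fintype.equivFin _ (Q.f a)) then
          S.t (x a * x (Q.f a)) / S.t (pathProd x (Q.f a) (len m (Q.f a))) else 0 := by
        unfold coef
        simp only [hv.symm, h2, h1, true_and, if_true, if_false]
        split_ifs <;> first | rfl | tauto
      have c2 : coef S x (Q.f a) = if 3 ≤ len m a ∧ (len m (Q.f a) < 3 ∨
          Fintype.equivFin _ (Q.f a) < Fintype.equivFin _ a) then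
          S.t (x a * x (Q.f a)) / S.t (pathProd x a (len m a)) else 0 := by
        unfold coef
        simp only [Q.src_f, h2, h12, true_and, if_true, if_false, hcomm]
        split_ifs <;> first | rfl | tauto
      rw [if_pos h2, c1, c2]
      by_cases l1 : 3 ≤ len m a
      · by_cases l2 : 3 ≤ len m (Q.f a)
        · have := hla l1
          have := hlf l2
          rcases lt_or_gt_of_ne hne with h | h
          · rw [if_pos ⟨l2, Or.inr h⟩, if_neg (by rintro ⟨-, h' | h'⟩; omega; exact lt_asymm h h')]
            field_simp
            ring
          · rw [if_neg (by rintro ⟨-, h' | h'⟩; omega; exact lt_asymm h h'), if_pos ⟨l1, Or.inr h⟩]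
            field_simp
            ring
        · have := hla l1
          rw [if_neg (fun h => l2 h.1), if_pos ⟨l1, Or.inl (by omega)⟩]
          field_simp
          ring
      · have l2 := (hs a h1 h2).resolve_left l1
        have := hlf l2
        rw [if_pos ⟨l2, Or.inl (by omega)⟩, if_neg (fun h => l1 h.1)]
        field_simp
        ring
  · have h3 := three_le_len_f m hv.symm h2
    have h4 := hl _ h3
    have h5 : coef S x a = S.t (x a * x (Q.f a)) / S.t (pathProd x (Q.f a) (len m (Q.f a))) := by
      unfold coef
      rw [if_pos ⟨hv.symm, h3⟩, if_neg h2]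
    rw [if_neg h2, h5]
    field_simp
    ring

/-- The zero relations are scalar equations solved by `coef`. That B_a stays nonzero has three
reasons: length one is never modified, length two is `modified_mul_g_ne_zero`, and products of three
or more arrows are insensitive to the modification. -/
theorem weakRep_modified (hx : S.ArrowLift e x) (he : S.Idempotents e)
    (hs : ∀ a, Q.f a ≠ a → Q.f (Q.f a) = a → 3 ≤ len m a ∨ 3 ≤ len m (Q.f a)) :
    S.WeakRep e (modified m x (coef S x)) := by
  have hc : Admissible m (coef S x) := admissible_coef
  have hrep := hx.isRep_modified hc
  have hmem : ∀ a, modified m x (coef S x) a * modified m x (coef S x) (Q.f a) ∈ rightSocle A :=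
    fun a => by
      rw [hx.modified_mul_modified hc]
      exact Submodule.sub_mem _ (Submodule.sub_mem _ (hx.mul_f_mem a)
        (soc_smul (hx.pathProd_len_mem _) _)) (soc_smul (hx.pathProd_len_mem _) _)
  have hzero : ∀ a, (Q.f a ≠ a ∨ (2 : K) ≠ 0) →
      modified m x (coef S x) a * modified m x (coef S x) (Q.f a) = 0 := fun a ha => by
    refine he.eq_zero_of_mul_mul (v := Q.src a) (w := Q.tgt (Q.f a)) (hmem a) ?_ ?_ fun hv => ?_
    · rw [← mul_assoc, hrep.src_mul]
    · rw [mul_assoc, hrep.mul_tgt]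
    · rw [hx.modified_mul_modified hc, map_sub, map_sub, map_smul, map_smul,
        t_pathProd_len_g S.t S.t_comm, hx.coef_eq he hs a ha hv, smul_eq_mul, smul_eq_mul]
      ring
  refine ⟨hrep, fun a ha => hzero a (Or.inl ha), fun a ha => ?_, fun a => ?_, fun a => ?_,
    fun h a => hzero a (Or.inr h)⟩
  · have := hmem a
    rwa [ha] at this
  · by_cases h1 : len m a = 1
    · have := hx.pathProd_len_mem a
      rw [h1, pathProd_one] at this ⊢
      rwa [modified_of_len_eq_one S.noDoubleLoop hc h1]
    · exact hx.pathProd_modified_mem hc a h1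
  · have h0 := len_pos m a
    by_cases h1 : len m a = 1
    · rw [h1, pathProd_one, modified_of_len_eq_one S.noDoubleLoop hc h1]
      exact hx.ne_zero a h1
    by_cases h2 : len m a = 2
    · rw [h2, pathProd_succ, pathProd_one]
      refine hx.modified_mul_g_ne_zero hc he h2.ge (hzero a (Or.inl fun h => ?_))
      have := S.noDoubleLoop.three_le_len m h
      omega
    · obtain ⟨i, hi⟩ := Nat.exists_eq_add_of_le' (show 3 ≤ len m a by omega)
      have := hx.pathProd_len_ne_zero he (a := a) (by omega)
      rw [hi] at this ⊢
      rwa [pathProd_eq_of_three_le hx.mem_rad (hx.modified_sub_mem hc)]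

end ArrowLift

end SocleLift

end TwoRegularQuiver

end

/-! ### The exceptional quiver, and the algebraic half of the theorem. -/

noncomputable section

namespace TwoRegularQuiver

open BasisIndex
open scoped Classical

variable {K : Type*} [Field K] {Q : TwoRegularQuiver} {m : Q.WeightFunction}

namespace SocleLift

variable {A C : Type*} [Ring A] [Algebra K A] [Ring C] [Algebra K C]
  {S : SocleLift (K := K) m A C}

namespace ArrowLift

variable {e : Q.Vertex → A} {x : Q.Arrow → A}

theorem add_smul_not_mem_soc (hx : S.ArrowLift e x) {h k : Q.Arrow} (hk : 2 ≤ len m h)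
    (hk' : 2 ≤ len m k) (hne : h ≠ k) {α β : K} (hab : α ≠ 0 ∨ β ≠ 0) :
    α • x h + β • x k ∉ rightSocle A := by
  have hco : ∀ a, coords m (0 : Q.border → K) (gen m 0 a) = word m K a 1 := fun a => by
    have := coords_pathProd m (0 : Q.border → K) a (i := 1) (by omega)
    rwa [pathProd_one] at this
  have hπ : S.π (α • x h + β • x k) = S.ρ (α • gen m 0 h + β • gen m 0 k) := by
    rw [map_add, map_add, map_smul, map_smul, map_smul, map_smul, hx.π_x, hx.π_x]
  have hco' : coords m 0 (α • gen m (0 : Q.border → K) h + β • gen m 0 k) =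
      α • word m K h 1 + β • word m K k 1 := by
    rw [map_add, map_smul, map_smul, hco, hco]
  rcases hab with h0 | h0
  · refine not_mem_soc_of_coords hπ (h := h) (i := 0) ?_
    rw [hco', Finsupp.add_apply, Finsupp.smul_apply, Finsupp.smul_apply,
      word_apply_mid m _ _ _ (by omega) (by omega), word_apply_mid m _ _ _ (by omega) (by omega)]
    simpa [hne.symm] using h0
  · refine not_mem_soc_of_coords hπ (h := k) (i := 0) ?_
    rw [hco', Finsupp.add_apply, Finsupp.smul_apply, Finsupp.smul_apply,
      word_apply_mid m _ _ _ (by omega) (by omega), word_apply_mid m _ _ _ (by omega) (by omega)]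
    simpa [hne] using h0

/-- The case of a quiver with two vertices and four arrows, with relations in degree two only. -/
theorem exists_weakRep_of_len_eq_two (hx : S.ArrowLift e x) (he : S.Idempotents e)
    (hQ : Q.Connected) {h : Q.Arrow} (h1 : Q.f h ≠ h) (h2 : Q.f (Q.f h) = h) (hl : len m h = 2)
    (hlk : len m (Q.f h) = 2) : ∃ x', S.WeakRep e x' := by
  obtain ⟨k, hk⟩ : ∃ k, k = Q.f h := ⟨_, rfl⟩
  rw [← hk] at h1 h2 hlk
  have gh : Q.g h = Q.bar k := by rw [g, hk]
  have gk : Q.g k = Q.bar h := by rw [g, h2]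
  have gbk : Q.g (Q.bar k) = h := by rw [← gh, g_g_eq_of_len_eq_two m hl]
  have gbh : Q.g (Q.bar h) = k := by rw [← gk, g_g_eq_of_len_eq_two m hlk]
  have fbk : Q.f (Q.bar k) = Q.bar h := by rw [← bar_g, gbk]
  have fbh : Q.f (Q.bar h) = Q.bar k := by rw [← bar_g, gbh]
  have lbk : len m (Q.bar k) = 2 := by rw [← gh, len_g, hl]
  have lbh : len m (Q.bar h) = 2 := by rw [← gk, len_g, hlk]
  have th : Q.tgt h = Q.src k := by rw [hk, src_f]
  have tk : Q.tgt k = Q.src h := by rw [← h2, src_f]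
  have tbh : Q.tgt (Q.bar h) = Q.src k := by rw [← src_g, gbh]
  have tbk : Q.tgt (Q.bar k) = Q.src h := by rw [← src_g, gbk]
  have hvw : Q.src h ≠ Q.src k := fun h' => S.noDoubleLoop h (th.trans h'.symm) (tbh.trans h'.symm)
  have hsb : Q.src (Q.bar h) = Q.src h := Q.src_bar h
  have ksb : Q.src (Q.bar k) = Q.src k := Q.src_bar k
  have hbh := Q.bar_ne h
  have kbk := Q.bar_ne k
  have hk1 : h ≠ k := fun h' => hvw (by rw [h'])
  have hk2 : h ≠ Q.bar k := fun h' => hvw (by rw [← ksb, ← h'])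
  have hk3 : Q.bar h ≠ k := fun h' => hvw (by rw [← hsb, h'])
  have hk4 : Q.bar h ≠ Q.bar k := fun h' => hvw (by rw [← hsb, h', ksb])
  -- These four arrows are closed under bar and g, so connectedness leaves no others.
  have hall : ∀ a, a = h ∨ a = Q.bar h ∨ a = k ∨ a = Q.bar k := by
    refine hQ {a | a = h ∨ a = Q.bar h ∨ a = k ∨ a = Q.bar k} ⟨h, Or.inl rfl⟩ ?_
    rintro a (rfl | rfl | rfl | rfl)
    · exact ⟨Or.inr (Or.inl rfl), Or.inr (Or.inr (Or.inr gh))⟩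
    · exact ⟨Or.inl (bar_bar _), Or.inr (Or.inr (Or.inl gbh))⟩
    · exact ⟨Or.inr (Or.inr (Or.inr rfl)), Or.inr (Or.inl gk)⟩
    · exact ⟨Or.inr (Or.inr (Or.inl (bar_bar _))), Or.inl gbk⟩
  have m1 : x h * x k ∈ rightSocle A := by have := hx.mul_f_mem h; rwa [← hk] at this
  have m2 : x (Q.bar h) * x (Q.bar k) ∈ rightSocle A := by
    have := hx.mul_f_mem (Q.bar h); rwa [fbh] at this
  have m3 : x h * x (Q.bar k) ∈ rightSocle A := by
    have := hx.pathProd_len_mem h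
    rwa [hl, pathProd_succ, pathProd_one, gh] at this
  have m4 : x (Q.bar h) * x k ∈ rightSocle A := by
    have := hx.pathProd_len_mem (Q.bar h)
    rwa [lbh, pathProd_succ, pathProd_one, gbh] at this
  have n1 : x k * x h ∈ rightSocle A := by have := hx.mul_f_mem k; rwa [h2] at this
  have n2 : x (Q.bar k) * x (Q.bar h) ∈ rightSocle A := by
    have := hx.mul_f_mem (Q.bar k); rwa [fbk] at this
  have n3 : x k * x (Q.bar h) ∈ rightSocle A := by
    have := hx.pathProd_len_mem k
    rwa [hlk, pathProd_succ, pathProd_one, gk] at this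
  have n4 : x (Q.bar k) * x h ∈ rightSocle A := by
    have := hx.pathProd_len_mem (Q.bar k)
    rwa [lbk, pathProd_succ, pathProd_one, gbk] at this
  obtain ⟨a, ha⟩ : ∃ a, a = S.t (x h * x k) := ⟨_, rfl⟩
  obtain ⟨b, hb⟩ : ∃ b, b = S.t (x h * x (Q.bar k)) := ⟨_, rfl⟩
  obtain ⟨c, hc⟩ : ∃ c, c = S.t (x (Q.bar h) * x k) := ⟨_, rfl⟩
  obtain ⟨d, hd⟩ : ∃ d, d = S.t (x (Q.bar h) * x (Q.bar k)) := ⟨_, rfl⟩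
  -- The rows of the matrix of traces of x_h, x_{bar h} against x_k, x_{bar k} are independent: a
  -- relation gives α x_h + β x_{bar h}, which kills every arrow without lying in the socle.
  have lin : ∀ α β : K, (α ≠ 0 ∨ β ≠ 0) → α * a + β * c = 0 → α * b + β * d = 0 → False := by
    intro α β h0 hac hbd
    have hrad : α • x h + β • x (Q.bar h) ∈ S.rad :=
      S.rad.add_mem (S.rad.smul_mem _ (hx.mem_rad _)) (S.rad.smul_mem _ (hx.mem_rad _))
    obtain ⟨z, hz⟩ := hx.exists_mul_ne_zero he hrad
      (hx.add_smul_not_mem_soc hl.ge lbh.ge hbh.symm h0)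
    refine hz ?_
    rw [add_mul, smul_mul_assoc, smul_mul_assoc]
    obtain rfl | rfl | rfl | rfl := hall z
    · rw [hx.mul_eq_zero (by rwa [th]), hx.mul_eq_zero (by rwa [tbh])]; simp
    · rw [hx.mul_eq_zero (by rwa [th, hsb]), hx.mul_eq_zero (by rwa [tbh, hsb])]; simp
    · refine he.eq_zero_of_t_eq_zero (v := Q.src h)
        (Submodule.add_mem _ (soc_smul m1 _) (soc_smul m4 _)) ?_ ?_
      · rw [add_mul, smul_mul_assoc, smul_mul_assoc, mul_assoc, mul_assoc, ← tk, hx.mul_tgt]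
      · rw [map_add, map_smul, map_smul, ← ha, ← hc]; exact hac
    · refine he.eq_zero_of_t_eq_zero (v := Q.src h)
        (Submodule.add_mem _ (soc_smul m3 _) (soc_smul m2 _)) ?_ ?_
      · rw [add_mul, smul_mul_assoc, smul_mul_assoc, mul_assoc, mul_assoc, ← tbk, hx.mul_tgt]
      · rw [map_add, map_smul, map_smul, ← hb, ← hd]; exact hbd
  have hdet : a * d - b * c ≠ 0 := fun h0 => by
    by_cases hcd : c = 0 ∧ d = 0
    · obtain ⟨rfl, rfl⟩ := hcd
      exact lin 0 1 (Or.inr one_ne_zero) (by ring) (by ring)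
    · by_cases hab : a = 0 ∧ b = 0
      · obtain ⟨rfl, rfl⟩ := hab
        exact lin 1 0 (Or.inl one_ne_zero) (by ring) (by ring)
      · by_cases hc0 : c = 0
        · have hd0 : d ≠ 0 := fun h => hcd ⟨hc0, h⟩
          exact lin d (-b) (Or.inl hd0) (by linear_combination h0) (by ring)
        · exact lin c (-a) (Or.inl hc0) (by ring) (by linear_combination -h0)
  -- Keep the arrows at the source of h and take the adapted basis of the arrows back. Then t(x_h
  -- y_k) = ba − ab = 0 and t(x_{bar h} y_{bar k}) = dc − cd = 0, while the other two traces are ±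
  -- the determinant.
  let y : Q.Arrow → A := fun z => if z = k then b • x k - a • x (Q.bar k) else
    if z = Q.bar k then d • x k - c • x (Q.bar k) else x z
  have yk : y k = b • x k - a • x (Q.bar k) := if_pos rfl
  have ybk : y (Q.bar k) = d • x k - c • x (Q.bar k) := by
    show (if _ then _ else _) = _
    rw [if_neg kbk, if_pos rfl]
  have yh : y h = x h := by
    show (if _ then _ else _) = _
    rw [if_neg hk1, if_neg hk2]
  have ybh : y (Q.bar h) = x (Q.bar h) := by
    show (if _ then _ else _) = _
    rw [if_neg hk3, if_neg hk4]
  have sk := hx.src_mul k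
  have sbk := hx.src_mul (Q.bar k)
  rw [ksb] at sbk
  have ek := hx.mul_tgt k
  have ebk := hx.mul_tgt (Q.bar k)
  rw [tk] at ek
  rw [tbk] at ebk
  have hrep : Q.toFinQuiver.IsRep e y :=
    { idem := hx.idem
      orth := hx.orth
      sum := hx.sum
      src_mul := fun z => by
        obtain rfl | rfl | rfl | rfl := hall z
        · rw [yh, hx.src_mul]
        · rw [ybh, hx.src_mul]
        · rw [yk, mul_sub, mul_smul_comm, mul_smul_comm, sk, sbk]
        · rw [ybk, ksb, mul_sub, mul_smul_comm, mul_smul_comm, sk, sbk]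
      mul_tgt := fun z => by
        obtain rfl | rfl | rfl | rfl := hall z
        · rw [yh, hx.mul_tgt]
        · rw [ybh, hx.mul_tgt]
        · rw [yk, tk, sub_mul, smul_mul_assoc, smul_mul_assoc, ek, ebk]
        · rw [ybk, tbk, sub_mul, smul_mul_assoc, smul_mul_assoc, ek, ebk] }
  have p1 : ∀ α β : K, x h * (α • x k - β • x (Q.bar k)) ∈ rightSocle A := fun α β => by
    rw [mul_sub, mul_smul_comm, mul_smul_comm]
    exact Submodule.sub_mem _ (soc_smul m1 _) (soc_smul m3 _)
  have p2 : ∀ α β : K, x (Q.bar h) * (α • x k - β • x (Q.bar k)) ∈ rightSocle A := fun α β => by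
    rw [mul_sub, mul_smul_comm, mul_smul_comm]
    exact Submodule.sub_mem _ (soc_smul m4 _) (soc_smul m2 _)
  have q1 : ∀ α β : K, (α • x k - β • x (Q.bar k)) * x h ∈ rightSocle A := fun α β => by
    rw [sub_mul, smul_mul_assoc, smul_mul_assoc]
    exact Submodule.sub_mem _ (soc_smul n1 _) (soc_smul n4 _)
  have q2 : ∀ α β : K, (α • x k - β • x (Q.bar k)) * x (Q.bar h) ∈ rightSocle A := fun α β => by
    rw [sub_mul, smul_mul_assoc, smul_mul_assoc]
    exact Submodule.sub_mem _ (soc_smul n3 _) (soc_smul n2 _)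
  have t1 : ∀ α β : K, S.t (x h * (α • x k - β • x (Q.bar k))) = α * a - β * b := fun α β => by
    rw [mul_sub, mul_smul_comm, mul_smul_comm, map_sub, map_smul, map_smul, ← ha, ← hb]; rfl
  have t2 : ∀ α β : K, S.t (x (Q.bar h) * (α • x k - β • x (Q.bar k))) = α * c - β * d :=
    fun α β => by
      rw [mul_sub, mul_smul_comm, mul_smul_comm, map_sub, map_smul, map_smul, ← hc, ← hd]; rfl
  have hne : ∀ {u : A}, S.t u ≠ 0 → u ≠ 0 := fun hu h0 => hu (by rw [h0, map_zero])
  have hzero : ∀ z, y z * y (Q.f z) = 0 := fun z => by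
    have hvan : ∀ {z z' : Q.Arrow}, y z * y z' ∈ rightSocle A → S.t (y z * y z') = 0 →
        y z * y z' = 0 := fun {z z'} hm ht =>
      he.eq_zero_of_t_eq_zero hm (v := Q.tgt z') (by rw [mul_assoc, hrep.mul_tgt]) ht
    obtain rfl | rfl | rfl | rfl := hall z
    · rw [← hk]
      exact hvan (by rw [yh, yk]; exact p1 _ _) (by rw [yh, yk, t1]; ring)
    · rw [fbh]
      exact hvan (by rw [ybh, ybk]; exact p2 _ _) (by rw [ybh, ybk, t2]; ring)
    · rw [h2]
      exact hvan (by rw [yh, yk]; exact q1 _ _) (by rw [S.t_comm, yh, yk, t1]; ring)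
    · rw [fbk]
      exact hvan (by rw [ybh, ybk]; exact q2 _ _) (by rw [S.t_comm, ybh, ybk, t2]; ring)
  have hlen : ∀ z, pathProd y z (len m z) = y z * y (Q.g z) := fun z => by
    have : len m z = 2 := by obtain rfl | rfl | rfl | rfl := hall z <;> assumption
    rw [this, pathProd_succ, pathProd_one]
  refine ⟨y, hrep, fun z _ => hzero z, fun z hz => ?_, fun z => ?_, fun z => ?_, fun _ => hzero⟩
  · have := hzero z
    rw [hz] at this
    rw [this]
    exact Submodule.zero_mem _
  · rw [hlen]
    obtain rfl | rfl | rfl | rfl := hall z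
    · rw [gh, yh, ybk]; exact p1 _ _
    · rw [gbh, ybh, yk]; exact p2 _ _
    · rw [gk, ybh, yk]; exact q2 _ _
    · rw [gbk, yh, ybk]; exact q1 _ _
  · rw [hlen]
    obtain rfl | rfl | rfl | rfl := hall z
    · rw [gh, yh, ybk]
      exact hne (by rw [t1]; convert hdet using 1; ring)
    · rw [gbh, ybh, yk]
      exact hne (by rw [t2]; convert neg_ne_zero.2 hdet using 1; ring)
    · rw [gk, ybh, yk]
      exact hne (by rw [S.t_comm, t2]; convert neg_ne_zero.2 hdet using 1; ring)
    · rw [gbk, yh, ybk]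
      exact hne (by rw [S.t_comm, t1]; convert hdet using 1; ring)

theorem exists_weakRep (hx : S.ArrowLift e x) (he : S.Idempotents e) (hQ : Q.Connected) :
    ∃ x', S.WeakRep e x' := by
  by_cases hs : ∀ a, Q.f a ≠ a → Q.f (Q.f a) = a → 3 ≤ len m a ∨ 3 ≤ len m (Q.f a)
  · exact ⟨_, hx.weakRep_modified he hs⟩
  · push Not at hs
    obtain ⟨h, h1, h2, h3, h4⟩ := hs
    have := S.noDoubleLoop.two_le_len m h2
    have := S.noDoubleLoop.two_le_len m (show Q.f (Q.f (Q.f h)) = Q.f h by rw [h2])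
    exact hx.exists_weakRep_of_len_eq_two he hQ h1 h2 (by omega) (by omega)

end ArrowLift

/-- A symmetric algebra `A` with `soc(A)² = 0` which is socle equivalent to `B(Q, f, m, 0)` is
isomorphic to `B(Q, f, m, b)` for some border function `b`, and `b = 0` is possible in
characteristic different from two. -/
theorem exists_algEquiv [IsAlgClosed K] [FiniteDimensional K A] (S : SocleLift (K := K) m A C)
    (hQ : Q.Connected) : ∃ b : Q.border → K, Nonempty (A ≃ₐ[K] Q.algebra m b) ∧
      ((2 : K) ≠ 0 → b = 0) := by
  obtain ⟨e, he⟩ := S.exists_idempotents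
  obtain ⟨x, hx⟩ := he.exists_arrowLift
  obtain ⟨y, hy⟩ := hx.exists_weakRep he hQ
  obtain ⟨b, z, h1, h2, h3⟩ := he.exists_isRep hy.toIsRep hy.mul_f_eq_zero hy.border_mem hy.len_mem
    hy.len_ne_zero
  exact ⟨b, S.nonempty_algEquiv_of_isRep h1 h2, fun h => h3 (hy.mul_f_eq_zero_of_two h)⟩

end SocleLift

end TwoRegularQuiver

end

/-! ### Geometric realization of a surface complex as a manifold with boundary. -/

noncomputable section

/-! ### Triangulated surfaces from simplicial complexes -/

/-- A connected two-dimensional simplicial complex in which the link of each vertex `v` is a path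
`link v 0, …, link v (size v)`. -/
structure SurfaceComplex (V Tr : Type) where
  corner : Tr → Fin 3 → V
  corner_injective : ∀ t, Function.Injective (corner t)
  eq_of_range_subset : ∀ t t', Set.range (corner t) ⊆ Set.range (corner t') → t = t'
  size : V → ℕ
  size_pos : ∀ v, 0 < size v
  link : V → ℕ → V
  link_inj : ∀ v i j, i ≤ size v → j ≤ size v → link v i = link v j → i = j
  link_ne : ∀ v j, j ≤ size v → link v j ≠ v
  exists_link : ∀ t v, v ∈ Set.range (corner t) →
    ∃ j < size v, Set.range (corner t) = {v, link v j, link v (j + 1)}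
  exists_triangle : ∀ v, ∀ j < size v, ∃ t, Set.range (corner t) = {v, link v j, link v (j + 1)}
  connected : ∀ t t', Relation.ReflTransGen (fun a b => ∃ i j, corner a i = corner b j) t t'
  nonempty : Nonempty Tr

/-! #### Coordinates on the cone over a path of length `k` -/

/-- The `j`-th coordinate of the point of the cone over a path of length `k` which has the moments
`Y` and `Z` with respect to the two ends. -/
def pathCoord (k : ℕ) (Y Z : ℝ) (j : ℕ) : ℝ := max 0 ((Y + Z) / k - |Z - j * ((Y + Z) / k)|)

theorem exists_nat_mul_le (k : ℕ) {Z r : ℝ} (hZ : 0 ≤ Z) (h : Z ≤ (k + 1 : ℕ) * r) :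
    ∃ i < k + 1, (i : ℝ) * r ≤ Z ∧ Z ≤ (i + 1 : ℕ) * r := by
  induction k with
  | zero => exact ⟨0, by simp, by simpa using hZ, h⟩
  | succ k ih =>
    rcases le_total Z ((k + 1 : ℕ) * r) with h1 | h1
    · obtain ⟨i, hi, h2⟩ := ih h1
      exact ⟨i, by omega, h2⟩
    · exact ⟨k + 1, by omega, h1, h⟩

/-- With r = (Y + Z)/k, the index i is chosen so that i r ≤ Z ≤ (i + 1) r, and the weights are (i +
1) r − Z and Z − i r. Thus the quadrant of moments is divided into k sectors, one for each triangle
of the cone. -/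
theorem exists_pathCoord {k : ℕ} (hk : 0 < k) {Y Z : ℝ} (hY : 0 ≤ Y) (hZ : 0 ≤ Z) :
    ∃ i < k, ∃ a b : ℝ, 0 ≤ a ∧ 0 ≤ b ∧ Y = (k - i) * a + (k - (i + 1)) * b ∧
      Z = i * a + (i + 1) * b := by
  obtain ⟨k, rfl⟩ := Nat.exists_eq_succ_of_ne_zero hk.ne'
  have hk' : (0 : ℝ) < (k + 1 : ℕ) := by positivity
  obtain ⟨i, hi, h1, h2⟩ := exists_nat_mul_le k (r := (Y + Z) / (k + 1 : ℕ)) hZ (by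
    rw [mul_div_cancel₀ _ hk'.ne']; linarith)
  rw [Nat.cast_add_one i] at h2
  refine ⟨i, hi, (i + 1) * ((Y + Z) / (k + 1 : ℕ)) - Z, Z - i * ((Y + Z) / (k + 1 : ℕ)),
    by linarith, by linarith, ?_, by ring⟩
  have : ((k + 1 : ℕ) : ℝ) * ((Y + Z) / (k + 1 : ℕ)) = Y + Z := mul_div_cancel₀ _ hk'.ne'
  rw [Nat.succ_eq_add_one]
  linear_combination -this

section pathCoord

variable {k i : ℕ} (hi : i < k) {a b : ℝ} (ha : 0 ≤ a) (hb : 0 ≤ b)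
include hi

theorem moments_add_div :
    (((k : ℝ) - i) * a + (k - (i + 1)) * b + (i * a + (i + 1) * b)) / k = a + b := by
  have : (k : ℝ) ≠ 0 := by
    have : (0 : ℝ) < k := by exact_mod_cast (Nat.zero_le i).trans_lt hi
    exact this.ne'
  field_simp
  ring

include ha hb

theorem pathCoord_left :
    pathCoord k ((k - i) * a + (k - (i + 1)) * b) (i * a + (i + 1) * b) i = a := by
  rw [pathCoord, moments_add_div hi, show (i : ℝ) * a + (i + 1) * b - i * (a + b) = b by ring,
    abs_of_nonneg hb, add_sub_cancel_right, max_eq_right ha]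

theorem pathCoord_right :
    pathCoord k ((k - i) * a + (k - (i + 1)) * b) (i * a + (i + 1) * b) (i + 1) = b := by
  rw [pathCoord, moments_add_div hi]
  push_cast
  rw [show (i : ℝ) * a + (i + 1) * b - (i + 1) * (a + b) = -a by ring, abs_neg,
    abs_of_nonneg ha, add_sub_cancel_left, max_eq_right hb]

theorem pathCoord_of_ne {j : ℕ} (h1 : j ≠ i) (h2 : j ≠ i + 1) :
    pathCoord k ((k - i) * a + (k - (i + 1)) * b) (i * a + (i + 1) * b) j = 0 := by
  rw [pathCoord, moments_add_div hi, max_eq_left]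
  rcases lt_or_gt_of_ne h1 with h | h
  · have : (j : ℝ) + 1 ≤ i := by exact_mod_cast h
    have h3 := le_abs_self ((i : ℝ) * a + (i + 1) * b - j * (a + b))
    nlinarith
  · have : (i : ℝ) + 2 ≤ j := by exact_mod_cast (show i + 2 ≤ j by omega)
    have h3 := neg_abs_le ((i : ℝ) * a + (i + 1) * b - j * (a + b))
    nlinarith

end pathCoord

theorem continuous_pathCoord (k j : ℕ) :
    Continuous fun p : ℝ × ℝ => pathCoord k p.1 p.2 j := by
  unfold pathCoord
  fun_prop

theorem sum_eq_add_of_consecutive {M : Type*} [AddCommMonoid M] {k i : ℕ} (hi : i < k) (F : ℕ → M)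
    (h : ∀ j ≤ k, j ≠ i → j ≠ i + 1 → F j = 0) :
    ∑ j ∈ Finset.range (k + 1), F j = F i + F (i + 1) := by
  refine Finset.sum_eq_add i (i + 1) (by omega) (fun j hj h' => h j ?_ h'.1 h'.2) ?_ ?_
  · simpa [Nat.lt_succ_iff] using hj
  · intro h; simp at h; omega
  · intro h; simp at h; omega

namespace SurfaceComplex

open scoped Classical

variable {V Tr : Type} [Fintype V] (X : SurfaceComplex V Tr)

/-- The geometric realization of the complex, in barycentric coordinates. -/
def Space : Type :=
  {x : V → ℝ // x ∈ stdSimplex ℝ V ∧ ∃ t, ∀ w, x w ≠ 0 → w ∈ Set.range (X.corner t)}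

instance : TopologicalSpace X.Space := inferInstanceAs (TopologicalSpace (Subtype _))

instance : T2Space X.Space := inferInstanceAs (T2Space (Subtype _))

theorem continuous_val : Continuous (Subtype.val : X.Space → V → ℝ) := continuous_subtype_val

theorem continuous_apply_val (w : V) : Continuous fun x : X.Space => x.1 w :=
  (continuous_apply w).comp X.continuous_val

variable {X}

theorem Space.ext {x y : X.Space} (h : ∀ w, x.1 w = y.1 w) : x = y := Subtype.ext (funext h)

theorem Space.nonneg (x : X.Space) (w : V) : 0 ≤ x.1 w := x.2.1.1 w

theorem Space.sum_eq (x : X.Space) : ∑ w, x.1 w = 1 := x.2.1.2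

theorem Space.exists_pos (x : X.Space) : ∃ v, 0 < x.1 v := by
  by_contra! h
  have : ∑ w, x.1 w ≤ 0 := Finset.sum_nonpos fun w _ => h w
  rw [x.sum_eq] at this
  linarith

theorem Space.exists_link (x : X.Space) {v : V} (hv : 0 < x.1 v) :
    ∃ j < X.size v, ∀ w, x.1 w ≠ 0 → w = v ∨ w = X.link v j ∨ w = X.link v (j + 1) := by
  obtain ⟨t, ht⟩ := x.2.2
  obtain ⟨j, hj, h⟩ := X.exists_link t v (ht v hv.ne')
  refine ⟨j, hj, fun w hw => ?_⟩
  have := ht w hw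
  rw [h] at this
  exact this

theorem sum_eq_of_link {v : V} {i : ℕ} (hi : i < X.size v) (F : V → ℝ)
    (h : ∀ w, F w ≠ 0 → w = v ∨ w = X.link v i ∨ w = X.link v (i + 1)) :
    ∑ w, F w = F v + (F (X.link v i) + F (X.link v (i + 1))) := by
  have h1 := X.link_ne v i hi.le
  have h2 := X.link_ne v (i + 1) hi
  have h3 : X.link v i ≠ X.link v (i + 1) := fun h => by
    have := X.link_inj v _ _ hi.le hi h; omega
  have hs : ∑ w, F w = ∑ w ∈ {v, X.link v i, X.link v (i + 1)}, F w := by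
    refine (Finset.sum_subset (Finset.subset_univ _) fun w _ hw => ?_).symm
    by_contra hne
    have := h w hne
    simp at hw
    tauto
  rw [hs, Finset.sum_insert (by simp [h1.symm, h2.symm]), Finset.sum_pair h3]

variable (X)

/-- The moment of the projection of `x` to the link of `v` with respect to the last point. -/
def momentY (v : V) (x : X.Space) : ℝ :=
  (∑ j ∈ Finset.range (X.size v + 1), ((X.size v : ℝ) - j) * x.1 (X.link v j)) / x.1 v

/-- The moment of the projection of `x` to the link of `v` with respect to the first point. -/
def momentZ (v : V) (x : X.Space) : ℝ :=
  (∑ j ∈ Finset.range (X.size v + 1), (j : ℝ) * x.1 (X.link v j)) / x.1 v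

variable {X}

section

variable {v : V} {x : X.Space} {i : ℕ} (hi : i < X.size v)
  (h : ∀ w, x.1 w ≠ 0 → w = v ∨ w = X.link v i ∨ w = X.link v (i + 1))
include hi h

theorem apply_link_eq_zero {j : ℕ} (hj : j ≤ X.size v) (h1 : j ≠ i) (h2 : j ≠ i + 1) :
    x.1 (X.link v j) = 0 := by
  by_contra hne
  rcases h _ hne with h3 | h3 | h3
  · exact X.link_ne v j hj h3
  · exact h1 (X.link_inj v _ _ hj hi.le h3)
  · exact h2 (X.link_inj v _ _ hj hi h3)

theorem momentY_eq : X.momentY v x = ((X.size v : ℝ) - i) * (x.1 (X.link v i) / x.1 v) +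
    (X.size v - (i + 1)) * (x.1 (X.link v (i + 1)) / x.1 v) := by
  rw [momentY, sum_eq_add_of_consecutive hi]
  · push_cast; ring
  · intro j hj h1 h2
    rw [apply_link_eq_zero hi h hj h1 h2, mul_zero]

theorem momentZ_eq : X.momentZ v x = (i : ℝ) * (x.1 (X.link v i) / x.1 v) +
    (i + 1) * (x.1 (X.link v (i + 1)) / x.1 v) := by
  rw [momentZ, sum_eq_add_of_consecutive hi]
  · push_cast; ring
  · intro j hj h1 h2
    rw [apply_link_eq_zero hi h hj h1 h2, mul_zero]

end

theorem momentY_nonneg (v : V) (x : X.Space) : 0 ≤ X.momentY v x := by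
  refine div_nonneg (Finset.sum_nonneg fun j hj => mul_nonneg ?_ (x.nonneg _)) (x.nonneg _)
  rw [Finset.mem_range, Nat.lt_succ_iff] at hj
  rw [sub_nonneg]
  exact_mod_cast hj

theorem momentZ_nonneg (v : V) (x : X.Space) : 0 ≤ X.momentZ v x :=
  div_nonneg (Finset.sum_nonneg fun _ _ => mul_nonneg (Nat.cast_nonneg _) (x.nonneg _)) (x.nonneg _)

variable (X)

/-- The barycentric coordinates of the point in the star of `v` with given moments. -/
def conePoint (v : V) (Y Z : ℝ) (w : V) : ℝ :=
  -- The apex has weight 1 and the link has total weight (Y + Z) / k; the division makes the sum 1.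
  -- This matches the moments, which are taken relative to the coordinate of v.
  (if w = v then 1 else ∑ j ∈ Finset.range (X.size v + 1),
    if X.link v j = w then pathCoord (X.size v) Y Z j else 0) / (1 + (Y + Z) / X.size v)

theorem continuousOn_conePoint (v w : V) :
    ContinuousOn (fun p : ℝ × ℝ => X.conePoint v p.1 p.2 w) {p | 0 ≤ p.1 ∧ 0 ≤ p.2} := by
  have hk : (0 : ℝ) < X.size v := by exact_mod_cast X.size_pos v
  unfold conePoint
  refine ContinuousOn.div ?_ (by fun_prop) fun p hp => ?_
  · split_ifs
    · exact continuousOn_const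
    · refine Continuous.continuousOn (continuous_finsetSum _ fun j _ => ?_)
      split_ifs
      · exact continuous_pathCoord _ _
      · exact continuous_const
  · have : 0 ≤ (p.1 + p.2) / X.size v := div_nonneg (add_nonneg hp.1 hp.2) hk.le
    linarith

variable {X}

section

variable {v : V} {i : ℕ} (hi : i < X.size v) {a b : ℝ} (ha : 0 ≤ a) (hb : 0 ≤ b) {Y Z : ℝ}
  (hY : Y = ((X.size v : ℝ) - i) * a + (X.size v - (i + 1)) * b) (hZ : Z = i * a + (i + 1) * b)
include hi hY hZ

theorem conePoint_self : X.conePoint v Y Z v = 1 / (1 + (a + b)) := by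
  rw [conePoint, if_pos rfl, hY, hZ, moments_add_div hi]

theorem conePoint_link {j : ℕ} (hj : j ≤ X.size v) :
    X.conePoint v Y Z (X.link v j) = pathCoord (X.size v) Y Z j / (1 + (a + b)) := by
  rw [conePoint, if_neg (X.link_ne v j hj), Finset.sum_eq_single j, if_pos rfl, hY, hZ,
    moments_add_div hi]
  · intro l hl hlj
    rw [if_neg fun h => hlj (X.link_inj v _ _ (by simpa [Nat.lt_succ_iff] using hl) hj h)]
  · intro h; simp at h; omega

include ha hb

theorem conePoint_left : X.conePoint v Y Z (X.link v i) = a / (1 + (a + b)) := by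
  rw [conePoint_link hi hY hZ hi.le, hY, hZ, pathCoord_left hi ha hb]

theorem conePoint_right : X.conePoint v Y Z (X.link v (i + 1)) = b / (1 + (a + b)) := by
  rw [conePoint_link hi hY hZ hi, hY, hZ, pathCoord_right hi ha hb]

theorem conePoint_of_ne {w : V} (h1 : w ≠ v) (h2 : w ≠ X.link v i) (h3 : w ≠ X.link v (i + 1)) :
    X.conePoint v Y Z w = 0 := by
  rw [conePoint, if_neg h1, Finset.sum_eq_zero, zero_div]
  intro j _
  split_ifs with h
  · subst h
    rw [hY, hZ, pathCoord_of_ne hi ha hb]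
    · rintro rfl; exact h2 rfl
    · rintro rfl; exact h3 rfl
  · rfl

end

theorem conePoint_mem (v : V) {Y Z : ℝ} (hY : 0 ≤ Y) (hZ : 0 ≤ Z) :
    X.conePoint v Y Z ∈ stdSimplex ℝ V ∧
      ∃ t, ∀ w, X.conePoint v Y Z w ≠ 0 → w ∈ Set.range (X.corner t) := by
  obtain ⟨i, hi, a, b, ha, hb, hY, hZ⟩ := exists_pathCoord (X.size_pos v) hY hZ
  have h0 : (0 : ℝ) < 1 + (a + b) := by positivity
  have hsupp : ∀ w, X.conePoint v Y Z w ≠ 0 → w = v ∨ w = X.link v i ∨ w = X.link v (i + 1) := by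
    intro w hw
    by_contra! h
    exact hw (conePoint_of_ne hi ha hb hY hZ h.1 h.2.1 h.2.2)
  refine ⟨⟨fun w => ?_, ?_⟩, ?_⟩
  · by_cases h : X.conePoint v Y Z w = 0
    · rw [h]
    · rcases hsupp w h with rfl | rfl | rfl
      · rw [conePoint_self hi hY hZ]; positivity
      · rw [conePoint_left hi ha hb hY hZ]; positivity
      · rw [conePoint_right hi ha hb hY hZ]; positivity
  · rw [sum_eq_of_link hi _ hsupp, conePoint_self hi hY hZ, conePoint_left hi ha hb hY hZ,
      conePoint_right hi ha hb hY hZ]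
    field_simp
  · obtain ⟨t, ht⟩ := X.exists_triangle v i hi
    exact ⟨t, fun w hw => by rw [ht]; exact hsupp w hw⟩

variable (X)

/-- The chart of the realization on the open star of a vertex. -/
def chart (v : V) : OpenPartialHomeomorph X.Space (EuclideanHalfSpace 2) where
  -- The moments identify the open star with the quadrant Y, Z ≥ 0, and (min(Y, Z), Y − Z)
  -- straightens the quadrant to a half-plane.
  toFun x := ⟨!₂[min (X.momentY v x) (X.momentZ v x), X.momentY v x - X.momentZ v x],
    le_min (momentY_nonneg v x) (momentZ_nonneg v x)⟩
  invFun p := ⟨X.conePoint v (p.1 0 + max (p.1 1) 0) (p.1 0 + max (-p.1 1) 0),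
    conePoint_mem v (add_nonneg p.2 (le_max_right _ _)) (add_nonneg p.2 (le_max_right _ _))⟩
  source := {x | 0 < x.1 v}
  target := Set.univ
  map_source' _ _ := Set.mem_univ _
  map_target' p _ := by
    have hk : (0 : ℝ) < X.size v := by exact_mod_cast X.size_pos v
    have h1 : 0 ≤ p.1 0 + max (p.1 1) 0 := add_nonneg p.2 (le_max_right _ _)
    have h2 : 0 ≤ p.1 0 + max (-p.1 1) 0 := add_nonneg p.2 (le_max_right _ _)
    show 0 < X.conePoint v _ _ v
    rw [conePoint, if_pos rfl]
    positivity
  left_inv' x hx := by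
    obtain ⟨i, hi, h⟩ := x.exists_link hx
    have hx0 : 0 < x.1 v := hx
    have ha : 0 ≤ x.1 (X.link v i) / x.1 v := div_nonneg (x.nonneg _) (x.nonneg _)
    have hb : 0 ≤ x.1 (X.link v (i + 1)) / x.1 v := div_nonneg (x.nonneg _) (x.nonneg _)
    have hY := momentY_eq hi h
    have hZ := momentZ_eq hi h
    have hs := sum_eq_of_link hi _ h
    rw [x.sum_eq] at hs
    have hD : 1 + (x.1 (X.link v i) / x.1 v + x.1 (X.link v (i + 1)) / x.1 v) = 1 / x.1 v := by
      field_simp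
      linarith
    refine Space.ext fun w => ?_
    show X.conePoint v (min (X.momentY v x) (X.momentZ v x) + max (X.momentY v x - X.momentZ v x) 0)
      (min (X.momentY v x) (X.momentZ v x) + max (-(X.momentY v x - X.momentZ v x)) 0) w = x.1 w
    have e1 : min (X.momentY v x) (X.momentZ v x) + max (X.momentY v x - X.momentZ v x) 0 =
        X.momentY v x := by
      rcases le_total (X.momentY v x) (X.momentZ v x) with h | h
      · rw [min_eq_left h, max_eq_right (by linarith)]; ring
      · rw [min_eq_right h, max_eq_left (by linarith)]; ring
    have e2 : min (X.momentY v x) (X.momentZ v x) + max (-(X.momentY v x - X.momentZ v x)) 0 =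
        X.momentZ v x := by
      rcases le_total (X.momentY v x) (X.momentZ v x) with h | h
      · rw [min_eq_left h, max_eq_left (by linarith)]; ring
      · rw [min_eq_right h, max_eq_right (by linarith)]; ring
    rw [e1, e2]
    by_cases h1 : w = v
    · rw [h1, conePoint_self hi hY hZ, hD, one_div_one_div]
    by_cases h2 : w = X.link v i
    · rw [h2, conePoint_left hi ha hb hY hZ, hD]
      field_simp
    by_cases h3 : w = X.link v (i + 1)
    · rw [h3, conePoint_right hi ha hb hY hZ, hD]
      field_simp
    rw [conePoint_of_ne hi ha hb hY hZ h1 h2 h3]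
    by_contra hne
    have := h w (Ne.symm hne)
    tauto
  right_inv' p _ := by
    have hp : 0 ≤ p.1 0 := p.2
    obtain ⟨Y, hYd⟩ : ∃ Y, Y = p.1 0 + max (p.1 1) 0 := ⟨_, rfl⟩
    obtain ⟨Z, hZd⟩ : ∃ Z, Z = p.1 0 + max (-p.1 1) 0 := ⟨_, rfl⟩
    have hY0 : 0 ≤ Y := hYd ▸ add_nonneg p.2 (le_max_right _ _)
    have hZ0 : 0 ≤ Z := hZd ▸ add_nonneg p.2 (le_max_right _ _)
    obtain ⟨i, hi, a, b, ha, hb, hY, hZ⟩ := exists_pathCoord (X.size_pos v) hY0 hZ0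
    obtain ⟨x, hx⟩ : ∃ x : X.Space, x.1 = X.conePoint v Y Z := ⟨⟨_, conePoint_mem v hY0 hZ0⟩, rfl⟩
    have h0 : (0 : ℝ) < 1 + (a + b) := by positivity
    have hsupp : ∀ w, x.1 w ≠ 0 → w = v ∨ w = X.link v i ∨ w = X.link v (i + 1) := by
      intro w hw
      by_contra! h
      rw [hx] at hw
      exact hw (conePoint_of_ne hi ha hb hY hZ h.1 h.2.1 h.2.2)
    have mY : X.momentY v x = Y := by
      rw [momentY_eq hi hsupp, hx, conePoint_self hi hY hZ, conePoint_left hi ha hb hY hZ,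
        conePoint_right hi ha hb hY hZ, hY]
      field_simp
    have mZ : X.momentZ v x = Z := by
      rw [momentZ_eq hi hsupp, hx, conePoint_self hi hY hZ, conePoint_left hi ha hb hY hZ,
        conePoint_right hi ha hb hY hZ, hZ]
      field_simp
    have hmin : min Y Z = p.1 0 ∧ Y - Z = p.1 1 := by
      rw [hYd, hZd]
      rcases le_total 0 (p.1 1) with h | h
      · rw [max_eq_left h, max_eq_right (by linarith), min_eq_right (by linarith)]
        constructor <;> ring
      · rw [max_eq_right h, max_eq_left (by linarith), min_eq_left (by linarith)]
        constructor <;> ring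
    have hxe : x = ⟨X.conePoint v (p.1 0 + max (p.1 1) 0) (p.1 0 + max (-p.1 1) 0),
        conePoint_mem v (add_nonneg p.2 (le_max_right _ _)) (add_nonneg p.2 (le_max_right _ _))⟩ :=
      Subtype.ext (by rw [hx, hYd, hZd])
    refine Subtype.ext ?_
    rw [← hxe]
    ext l
    fin_cases l
    · show min (X.momentY v x) (X.momentZ v x) = p.1 0
      rw [mY, mZ, hmin.1]
    · show X.momentY v x - X.momentZ v x = p.1 1
      rw [mY, mZ, hmin.2]
  open_source := isOpen_lt continuous_const (X.continuous_apply_val v)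
  open_target := isOpen_univ
  continuousOn_toFun := by
    have hY : ContinuousOn (X.momentY v) {x | 0 < x.1 v} := by
      refine ContinuousOn.div ?_ (X.continuous_apply_val v).continuousOn fun x hx => hx.ne'
      exact (continuous_finsetSum _ fun j _ =>
        continuous_const.mul (X.continuous_apply_val _)).continuousOn
    have hZ : ContinuousOn (X.momentZ v) {x | 0 < x.1 v} := by
      refine ContinuousOn.div ?_ (X.continuous_apply_val v).continuousOn fun x hx => hx.ne'
      exact (continuous_finsetSum _ fun j _ =>
        continuous_const.mul (X.continuous_apply_val _)).continuousOn
    refine Topology.IsInducing.subtypeVal.continuousOn_iff.2 ?_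
    refine (PiLp.continuous_toLp 2 _).comp_continuousOn (continuousOn_pi.2 fun l => ?_)
    fin_cases l
    · exact hY.inf hZ
    · exact hY.sub hZ
  continuousOn_invFun := by
    refine Topology.IsInducing.subtypeVal.continuousOn_iff.2 ?_
    refine continuousOn_pi.2 fun w => ?_
    have hc : ∀ l, Continuous fun p : EuclideanHalfSpace 2 => p.1 l := fun l =>
      (PiLp.continuous_apply 2 _ l).comp continuous_subtype_val
    exact (X.continuousOn_conePoint v w).comp (f := fun p : EuclideanHalfSpace 2 =>
      (p.1 0 + max (p.1 1) 0, p.1 0 + max (-p.1 1) 0))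
      (((hc 0).add ((hc 1).max continuous_const)).prodMk
        ((hc 0).add ((hc 1).neg.max continuous_const))).continuousOn
      fun p _ => ⟨add_nonneg p.2 (le_max_right _ _), add_nonneg p.2 (le_max_right _ _)⟩

instance : ChartedSpace (EuclideanHalfSpace 2) X.Space where
  atlas := Set.range X.chart
  chartAt x := X.chart x.exists_pos.choose
  mem_chart_source x := x.exists_pos.choose_spec
  chart_mem_atlas _ := Set.mem_range_self _

/-- The boundary is defined by the preferred chart at x, so v is the vertex whose star is that
chart. The first chart coordinate is the minimum of two nonnegative moments. -/
theorem mem_boundary_iff (x : X.Space) : ∃ v, 0 < x.1 v ∧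
    (x ∈ (𝓡∂ 2).boundary X.Space ↔ X.momentY v x = 0 ∨ X.momentZ v x = 0) := by
  refine ⟨x.exists_pos.choose, x.exists_pos.choose_spec, ?_⟩
  show extChartAt (𝓡∂ 2) x x ∈ frontier (Set.range (𝓡∂ 2)) ↔ _
  rw [frontier_range_modelWithCornersEuclideanHalfSpace]
  show 0 = min (X.momentY _ x) (X.momentZ _ x) ↔ _
  have h1 := momentY_nonneg x.exists_pos.choose x
  have h2 := momentZ_nonneg x.exists_pos.choose x
  constructor
  · intro h
    rcases min_choice (X.momentY x.exists_pos.choose x) (X.momentZ x.exists_pos.choose x) with h' | h'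
    · exact Or.inl (h' ▸ h.symm)
    · exact Or.inr (h' ▸ h.symm)
  · rintro (h | h)
    · rw [h, min_eq_left h2]
    · rw [h, min_eq_right h1]

end SurfaceComplex

end

/-! ### Cells of the realization and the triangulated surface. -/

noncomputable section

namespace SurfaceComplex

open scoped Classical

variable {V Tr : Type} [Fintype V] {X : SurfaceComplex V Tr}

/-- The vertex set of the open simplex containing a point. -/
def Space.supp (x : X.Space) : Set V := {w | x.1 w ≠ 0}

/-! #### Simplices -/

variable (X)

/-- A family of vertices spanning a simplex. -/
structure Spans {n : ℕ} (κ : Fin (n + 1) → V) : Prop where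
  injective : Function.Injective κ
  exists_subset : ∃ t, Set.range κ ⊆ Set.range (X.corner t)

variable {X}

namespace Spans

variable {n : ℕ} {κ : Fin (n + 1) → V} (hκ : X.Spans κ)

/-- The parametrization of a simplex of the realization. -/
def map (x : stdSimplex ℝ (Fin (n + 1))) : X.Space :=
  ⟨fun w => ∑ i, if κ i = w then x.1 i else 0, by
    refine ⟨⟨fun w => Finset.sum_nonneg fun i _ => ?_, ?_⟩, ?_⟩
    · split_ifs
      · exact x.2.1 i
      · exact le_rfl
    · rw [Finset.sum_comm, ← x.2.2]
      simp
    · obtain ⟨t, ht⟩ := hκ.exists_subset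
      refine ⟨t, fun w hw => ?_⟩
      obtain ⟨i, -, hi⟩ := Finset.exists_ne_zero_of_sum_ne_zero hw
      exact ht ⟨i, by by_contra h; rw [if_neg h] at hi; exact hi rfl⟩⟩

theorem map_apply (x : stdSimplex ℝ (Fin (n + 1))) (i : Fin (n + 1)) :
    (hκ.map x).1 (κ i) = x.1 i := by
  show ∑ j, (if κ j = κ i then x.1 j else 0) = x.1 i
  rw [Finset.sum_eq_single i, if_pos rfl]
  · intro j _ hj
    rw [if_neg fun h => hj (hκ.injective h)]
  · simp

theorem map_apply_of_notMem (x : stdSimplex ℝ (Fin (n + 1))) {w : V} (hw : w ∉ Set.range κ) :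
    (hκ.map x).1 w = 0 := by
  show ∑ i, (if κ i = w then x.1 i else 0) = 0
  exact Finset.sum_eq_zero fun i _ => if_neg fun h => hw ⟨i, h⟩

theorem map_injective : Function.Injective hκ.map := fun x y h => by
  refine Subtype.ext (funext fun i => ?_)
  rw [← hκ.map_apply x, ← hκ.map_apply y, h]

theorem continuous_map : Continuous hκ.map := by
  refine Continuous.subtype_mk ?_ _
  refine continuous_pi fun w => continuous_finsetSum _ fun i _ => ?_
  split_ifs
  · exact (continuous_apply i).comp continuous_subtype_val
  · exact continuous_const

theorem isEmbedding_map : Topology.IsEmbedding hκ.map :=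
  (hκ.continuous_map.isClosedEmbedding hκ.map_injective).isEmbedding

/-- An open face is the set of points with a prescribed support. One statement serves for vertices,
open sides and open triangles. -/
theorem bijOn_map (I : Set (Fin (n + 1))) :
    Set.BijOn hκ.map {x | ∀ i, x.1 i ≠ 0 ↔ i ∈ I} {p | p.supp = κ '' I} := by
  refine ⟨fun x hx => ?_, hκ.map_injective.injOn, fun p hp => ?_⟩
  · ext w
    constructor
    · intro hw
      by_cases h : w ∈ Set.range κ
      · obtain ⟨i, rfl⟩ := h
        refine ⟨i, (hx i).1 ?_, rfl⟩
        rwa [← hκ.map_apply]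
      · exact absurd (hκ.map_apply_of_notMem x h) hw
    · rintro ⟨i, hi, rfl⟩
      show (hκ.map x).1 (κ i) ≠ 0
      rw [hκ.map_apply]
      exact (hx i).2 hi
  · have hz : ∀ w, w ∉ Set.range κ → p.1 w = 0 := fun w hw => by
      by_contra h
      have : w ∈ p.supp := h
      rw [show p.supp = κ '' I from hp] at this
      exact hw (Set.image_subset_range _ _ this)
    have hs : ∑ i, p.1 (κ i) = 1 := by
      rw [← p.sum_eq]
      exact Fintype.sum_of_injective κ hκ.injective _ _ hz fun _ => rfl
    refine ⟨⟨fun i => p.1 (κ i), fun i => p.nonneg _, hs⟩, fun i => ?_, Space.ext fun w => ?_⟩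
    · show κ i ∈ p.supp ↔ _
      rw [show p.supp = κ '' I from hp, hκ.injective.mem_set_image]
    · by_cases h : w ∈ Set.range κ
      · obtain ⟨i, rfl⟩ := h
        rw [hκ.map_apply]
      · rw [hκ.map_apply_of_notMem _ h, hz w h]

theorem image_simplexInterior :
    hκ.map '' simplexInterior n = {p | p.supp = Set.range κ} := by
  rw [← Set.image_univ, ← (hκ.bijOn_map Set.univ).image_eq]
  congr 1
  ext x
  refine forall_congr' fun i => ?_
  simp only [Set.mem_univ, iff_true]
  exact (x.2.1 i).lt_iff_ne'

end Spans

variable (X)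

theorem exists_mem_range (v : V) : ∃ t, v ∈ Set.range (X.corner t) := by
  obtain ⟨t, ht⟩ := X.exists_triangle v 0 (X.size_pos v)
  exact ⟨t, by rw [ht]; simp⟩

/-- A vertex as a point of the realization. -/
def vertexPoint (v : V) : X.Space :=
  ⟨Pi.single v 1, single_mem_stdSimplex ℝ v, by
    obtain ⟨t, ht⟩ := X.exists_mem_range v
    refine ⟨t, fun w hw => ?_⟩
    by_cases h : w = v
    · rwa [h]
    · rw [Pi.single_eq_of_ne h] at hw
      exact absurd rfl hw⟩

theorem eq_vertexPoint_iff {v : V} {p : X.Space} : p = X.vertexPoint v ↔ p.supp = {v} := by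
  constructor
  · rintro rfl
    ext w
    show Pi.single (M := fun _ => ℝ) v 1 w ≠ 0 ↔ w = v
    rw [Pi.single_apply]
    simp
  · intro h
    have hz : ∀ w, w ≠ v → p.1 w = 0 := fun w hw => by
      by_contra h'
      have : w ∈ p.supp := h'
      rw [h] at this
      exact hw this
    have hv : p.1 v = 1 := by
      rw [← p.sum_eq]
      exact (Finset.sum_eq_single v (fun w _ hw => hz w hw) (by simp)).symm
    refine Space.ext fun w => ?_
    show _ = Pi.single (M := fun _ => ℝ) v 1 w
    by_cases hw : w = v
    · rw [hw, hv, Pi.single_eq_same]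
    · rw [hz w hw, Pi.single_eq_of_ne hw]

theorem Spans.map_mem_range_vertexPoint {n : ℕ} {κ : Fin (n + 1) → V} (hκ : X.Spans κ)
    (x : stdSimplex ℝ (Fin (n + 1))) (hx : ∃ i, x.1 i = 1) :
    hκ.map x ∈ Set.range X.vertexPoint := by
  obtain ⟨i, hi⟩ := hx
  refine ⟨κ i, ((X.eq_vertexPoint_iff).2 ?_).symm⟩
  rw [show ({κ i} : Set V) = κ '' {i} by simp]
  refine (hκ.bijOn_map {i}).mapsTo fun j => ?_
  show x.1 j ≠ 0 ↔ j = i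
  constructor
  · intro hj
    by_contra hne
    have h1 := Finset.sum_le_sum_of_subset_of_nonneg (Finset.subset_univ ({j, i} : Finset (Fin (n + 1))))
      (f := x.1) fun l _ _ => x.2.1 l
    rw [Finset.sum_pair hne, x.2.2, hi] at h1
    have h2 := lt_of_le_of_ne (x.2.1 j) (Ne.symm hj)
    linarith
  · rintro rfl
    rw [hi]
    exact one_ne_zero

/-- The edges of the complex, as sets of vertices. -/
def Edge : Type := {s : Set V // ∃ t i, s = {X.corner t (i + 1), X.corner t (i + 2)}}

instance : Fintype X.Edge := Fintype.ofFinite (Subtype _)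

/-- The edge of a triangle opposite to a corner. -/
def side (t : Tr) (i : Fin 3) : X.Edge := ⟨{X.corner t (i + 1), X.corner t (i + 2)}, t, i, rfl⟩

theorem spans_corner (t : Tr) : X.Spans (X.corner t) := ⟨X.corner_injective t, t, subset_rfl⟩

theorem coe_side (t : Tr) (i : Fin 3) : (X.side t i).1 = X.corner t '' {i}ᶜ := by
  have : ({i}ᶜ : Set (Fin 3)) = {i + 1, i + 2} := by
    ext j
    simp only [Set.mem_compl_iff, Set.mem_singleton_iff, Set.mem_insert_iff]
    revert i j
    decide
  rw [this, Set.image_pair]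
  rfl

theorem side_injective (t : Tr) : Function.Injective (X.side t) := fun i j h => by
  have h1 := congrArg Subtype.val h
  rw [coe_side, coe_side] at h1
  have := (X.corner_injective t).image_injective h1
  simpa using this

theorem corner_ne (t : Tr) (i : Fin 3) : X.corner t (i + 1) ≠ X.corner t (i + 2) := fun h => by
  have h1 : ∀ i : Fin 3, i + 1 ≠ i + 2 := by decide
  exact h1 i (X.corner_injective t h)

variable {X}

theorem Edge.exists_spans (e : X.Edge) : ∃ κ : Fin 2 → V, X.Spans κ ∧ Set.range κ = e.1 := by
  obtain ⟨t, i, h⟩ := e.2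
  refine ⟨![X.corner t (i + 1), X.corner t (i + 2)], ⟨?_, t, ?_⟩, ?_⟩
  · have hne := X.corner_ne t i
    intro a b hab
    fin_cases a <;> fin_cases b <;> simp_all
  · rintro _ ⟨a, rfl⟩
    fin_cases a <;> simp
  · rw [h]
    ext w
    simp
    exact or_comm

/-- The two ends of an edge. -/
def Edge.ends (e : X.Edge) : Fin 2 → V := e.exists_spans.choose

theorem Edge.spans (e : X.Edge) : X.Spans e.ends := e.exists_spans.choose_spec.1

theorem Edge.range_ends (e : X.Edge) : Set.range e.ends = e.1 := e.exists_spans.choose_spec.2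

variable (X)

/-- The vertex sets of the cells. -/
def cellSet : V ⊕ X.Edge ⊕ Tr → Set V :=
  Sum.elim (fun v => {v}) (Sum.elim (fun e => e.1) fun t => Set.range (X.corner t))

theorem ncard_edge (e : X.Edge) : e.1.ncard = 2 := by
  rw [← e.range_ends, ← Set.image_univ, Set.ncard_image_of_injective _ e.spans.injective]
  simp

theorem ncard_range_corner (t : Tr) : (Set.range (X.corner t)).ncard = 3 := by
  rw [← Set.image_univ, Set.ncard_image_of_injective _ (X.corner_injective t)]
  simp

theorem cellSet_injective : Function.Injective X.cellSet := by
  have h1 : ∀ c, (X.cellSet c).ncard = Sum.elim (fun _ => 1) (Sum.elim (fun _ => 2) fun _ => 3) c := by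
    rintro (v | e | t)
    · exact Set.ncard_singleton v
    · exact X.ncard_edge e
    · exact X.ncard_range_corner t
  intro c d h
  have h2 := h1 c
  rw [h, h1 d] at h2
  rcases c with v | e | t <;> rcases d with w | e' | t' <;> simp at h2
  · exact congrArg _ (Set.singleton_injective h)
  · exact congrArg _ (congrArg _ (Subtype.ext h))
  · exact congrArg _ (congrArg _ (X.eq_of_range_subset t t' h.subset))

theorem exists_cellSet_eq_supp (p : X.Space) : ∃ c, X.cellSet c = p.supp := by
  obtain ⟨t, ht⟩ := p.2.2
  obtain ⟨I, hI⟩ : ∃ I : Finset (Fin 3), X.corner t '' I = p.supp := by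
    refine ⟨Finset.univ.filter fun i => X.corner t i ∈ p.supp, ?_⟩
    ext w
    constructor
    · rintro ⟨i, hi, rfl⟩
      simpa using hi
    · intro hw
      obtain ⟨i, rfl⟩ := ht w hw
      exact ⟨i, by simpa using hw, rfl⟩
  have hne : I.Nonempty := by
    obtain ⟨v, hv⟩ := p.exists_pos
    have : v ∈ p.supp := hv.ne'
    rw [← hI] at this
    obtain ⟨i, hi, -⟩ := this
    exact ⟨i, hi⟩
  have hcases : ∀ I : Finset (Fin 3), I.Nonempty →
      (∃ i, I = {i}) ∨ (∃ i, I = {i + 1, i + 2}) ∨ I = Finset.univ := by decide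
  rcases hcases I hne with ⟨i, rfl⟩ | ⟨i, rfl⟩ | rfl
  · exact ⟨Sum.inl (X.corner t i), by rw [← hI]; simp [cellSet]⟩
  · refine ⟨Sum.inr (Sum.inl (X.side t i)), ?_⟩
    rw [← hI, Finset.coe_pair, Set.image_pair]
    rfl
  · exact ⟨Sum.inr (Sum.inr t), by rw [← hI]; simp [cellSet]⟩

/-! #### Incidence of edges and triangles -/

theorem exists_edge_eq {e : X.Edge} {v : V} (hv : v ∈ e.1) :
    ∃ j ≤ X.size v, e.1 = {v, X.link v j} := by
  obtain ⟨t, i, h⟩ := e.2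
  have key : ∀ w, v ∈ Set.range (X.corner t) → w ∈ Set.range (X.corner t) → w ≠ v →
      ∃ j ≤ X.size v, w = X.link v j := fun w hv hw hne => by
    obtain ⟨j, hj, hr⟩ := X.exists_link t v hv
    rw [hr] at hw
    rcases hw with rfl | rfl | rfl
    · exact absurd rfl hne
    · exact ⟨j, hj.le, rfl⟩
    · exact ⟨j + 1, hj, rfl⟩
  have hne := X.corner_ne t i
  rw [h] at hv
  rcases hv with hv | hv
  · obtain ⟨j, hj, hw⟩ := key (X.corner t (i + 2)) ⟨_, hv.symm⟩ ⟨_, rfl⟩ (by rw [hv]; exact hne.symm)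
    exact ⟨j, hj, by rw [h, ← hw, hv]⟩
  · have hv : v = X.corner t (i + 2) := hv
    obtain ⟨j, hj, hw⟩ := key (X.corner t (i + 1)) ⟨_, hv.symm⟩ ⟨_, rfl⟩ (by rw [hv]; exact hne)
    exact ⟨j, hj, by rw [h, ← hw, hv, Set.pair_comm]⟩

theorem exists_side_eq {e : X.Edge} {t : Tr} (h : e.1 ⊆ Set.range (X.corner t)) :
    ∃ i, X.side t i = e := by
  have h2 := X.ncard_edge e
  obtain ⟨I, hI⟩ : ∃ I : Finset (Fin 3), X.corner t '' I = e.1 := by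
    refine ⟨Finset.univ.filter fun i => X.corner t i ∈ e.1, ?_⟩
    ext w
    constructor
    · rintro ⟨i, hi, rfl⟩
      simpa using hi
    · intro hw
      obtain ⟨i, rfl⟩ := h hw
      exact ⟨i, by simpa using hw, rfl⟩
  rw [← hI, Set.ncard_image_of_injective _ (X.corner_injective t), Set.ncard_coe_finset] at h2
  have hcases : ∀ I : Finset (Fin 3), I.card = 2 → ∃ i, I = {i + 1, i + 2} := by decide
  obtain ⟨i, rfl⟩ := hcases I h2
  refine ⟨i, Subtype.ext ?_⟩
  rw [← hI, Finset.coe_pair, Set.image_pair]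
  rfl

theorem side_subset (t : Tr) (i : Fin 3) : (X.side t i).1 ⊆ Set.range (X.corner t) := by
  rw [coe_side]
  exact Set.image_subset_range _ _

theorem ncard_sides (e : X.Edge) : {p : Tr × Fin 3 | X.side p.1 p.2 = e}.ncard =
    {t | e.1 ⊆ Set.range (X.corner t)}.ncard := by
  refine Set.ncard_congr (fun p _ => p.1) (fun p hp => ?_) (fun p q hp hq h => ?_) fun t ht => ?_
  · have := X.side_subset p.1 p.2
    rwa [show X.side p.1 p.2 = e from hp] at this
  · obtain ⟨t, i⟩ := p
    obtain ⟨t', i'⟩ := q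
    obtain rfl : t = t' := h
    have : X.side t i = X.side t i' := (show X.side t i = e from hp).trans
      (show X.side t i' = e from hq).symm
    rw [X.side_injective t this]
  · obtain ⟨i, hi⟩ := X.exists_side_eq ht
    exact ⟨(t, i), hi, rfl⟩

/-- The triangles at v correspond to the steps of the path `link v`. An inner point of the path
belongs to the steps before and after it, an end point to one. -/
theorem ncard_triangles {v : V} {j : ℕ} (hj : j ≤ X.size v) :
    {t | ({v, X.link v j} : Set V) ⊆ Set.range (X.corner t)}.ncard =
      if j = 0 ∨ j = X.size v then 1 else 2 := by
  choose T hT using X.exists_triangle v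
  have hpos := X.size_pos v
  have hmem : ∀ l (hl : l < X.size v), (X.link v j ∈ Set.range (X.corner (T l hl)) ↔ j = l ∨ j = l + 1) :=
    fun l hl => by
      rw [hT]
      simp only [Set.mem_insert_iff, Set.mem_singleton_iff, X.link_ne v j hj, false_or]
      exact or_congr ⟨fun h => X.link_inj v _ _ hj hl.le h, fun h => by rw [h]⟩
        ⟨fun h => X.link_inj v _ _ hj hl h, fun h => by rw [h]⟩
  have hset : ∀ t, ({v, X.link v j} : Set V) ⊆ Set.range (X.corner t) ↔
      ∃ l, ∃ hl : l < X.size v, t = T l hl ∧ (j = l ∨ j = l + 1) := fun t => by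
    rw [Set.pair_subset_iff]
    constructor
    · rintro ⟨h1, h2⟩
      obtain ⟨l, hl, hr⟩ := X.exists_link t v h1
      have : t = T l hl := X.eq_of_range_subset _ _ (by rw [hr, hT])
      exact ⟨l, hl, this, (hmem l hl).1 (this ▸ h2)⟩
    · rintro ⟨l, hl, rfl, h⟩
      exact ⟨by rw [hT]; simp, (hmem l hl).2 h⟩
  split_ifs with h
  · rw [Set.ncard_eq_one]
    rcases h with rfl | rfl
    · refine ⟨T 0 hpos, Set.ext fun t => (hset t).trans ?_⟩
      constructor
      · rintro ⟨l, hl, rfl, h | h⟩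
        · subst h; rfl
        · omega
      · rintro rfl
        exact ⟨0, hpos, rfl, Or.inl rfl⟩
    · refine ⟨T (X.size v - 1) (by omega), Set.ext fun t => (hset t).trans ?_⟩
      constructor
      · rintro ⟨l, hl, rfl, h | h⟩
        · omega
        · obtain rfl : l = X.size v - 1 := by omega
          rfl
      · rintro rfl
        exact ⟨X.size v - 1, by omega, rfl, Or.inr (by omega)⟩
  · push Not at h
    have hj' : j < X.size v := lt_of_le_of_ne hj h.2
    rw [Set.ncard_eq_two]
    refine ⟨T (j - 1) (by omega), T j hj', fun he => ?_, Set.ext fun t => (hset t).trans ?_⟩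
    · have h1 : X.link v (j + 1) ∈ Set.range (X.corner (T j hj')) := by rw [hT]; simp
      rw [← he, hT] at h1
      rcases h1 with h1 | h1 | h1
      · exact X.link_ne v _ hj' h1
      · have := X.link_inj v _ _ hj' (by omega) h1; omega
      · have := X.link_inj v _ _ hj' (by omega) h1; omega
    · constructor
      · rintro ⟨l, hl, rfl, h' | h'⟩
        · subst h'; exact Or.inr rfl
        · obtain rfl : l = j - 1 := by omega
          exact Or.inl rfl
      · rintro (rfl | rfl)
        · exact ⟨j - 1, by omega, rfl, Or.inr (by omega)⟩
        · exact ⟨j, hj', rfl, Or.inl rfl⟩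

/-- On the open edge from v to `link v j` only one link coordinate is nonzero, so the moments are
positive multiples of `size v - j` and of `j`. Together with `ncard_triangles` this matches the
topological boundary with incidence one. -/
theorem moment_eq_zero_iff {p : X.Space} {v : V} {j : ℕ} (hj : j ≤ X.size v)
    (hp : p.supp = {v, X.link v j}) :
    (X.momentY v p = 0 ∨ X.momentZ v p = 0) ↔ j = 0 ∨ j = X.size v := by
  have hv : 0 < p.1 v := lt_of_le_of_ne (p.nonneg v) (Ne.symm (show v ∈ p.supp by rw [hp]; simp))
  have hl : 0 < p.1 (X.link v j) := lt_of_le_of_ne (p.nonneg _)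
    (Ne.symm (show X.link v j ∈ p.supp by rw [hp]; simp))
  have hpos := X.size_pos v
  have hk : (0 : ℝ) < X.size v := by exact_mod_cast hpos
  have hc := div_pos hl hv
  by_cases hjk : j = X.size v
  · have h : ∀ w, p.1 w ≠ 0 → w = v ∨ w = X.link v (j - 1) ∨ w = X.link v (j - 1 + 1) :=
      fun w hw => by
        have : w ∈ p.supp := hw
        rw [hp] at this
        rw [Nat.sub_add_cancel (by omega)]
        exact this.imp_right Or.inr
    have h0 : p.1 (X.link v (j - 1)) = 0 := by
      by_contra h0
      have : X.link v (j - 1) ∈ p.supp := h0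
      rw [hp] at this
      rcases this with h | h
      · exact X.link_ne v _ (by omega) h
      · have := X.link_inj v _ _ (by omega) hj h; omega
    refine iff_of_true (Or.inl ?_) (Or.inr hjk)
    rw [momentY_eq (by omega) h, h0]
    have : ((j - 1 : ℕ) : ℝ) + 1 = X.size v := by
      rw [← hjk]; exact_mod_cast Nat.sub_add_cancel (by omega)
    rw [this]
    ring
  · have hj' : j < X.size v := lt_of_le_of_ne hj hjk
    have h : ∀ w, p.1 w ≠ 0 → w = v ∨ w = X.link v j ∨ w = X.link v (j + 1) :=
      fun w hw => by
        have : w ∈ p.supp := hw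
        rw [hp] at this
        exact this.imp_right Or.inl
    have h0 : p.1 (X.link v (j + 1)) = 0 := by
      by_contra h0
      have : X.link v (j + 1) ∈ p.supp := h0
      rw [hp] at this
      rcases this with h | h
      · exact X.link_ne v _ hj' h
      · have := X.link_inj v _ _ hj' hj h; omega
    have hlt : (j : ℝ) < X.size v := by exact_mod_cast hj'
    rw [momentY_eq hj' h, momentZ_eq hj' h, h0]
    constructor
    · rintro (h | h)
      · have := mul_pos (sub_pos.2 hlt) hc
        simp only [zero_div, mul_zero, add_zero] at h
        exact absurd h this.ne'
      · simp only [zero_div, mul_zero, add_zero, mul_eq_zero, hc.ne', or_false] at h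
        exact Or.inl (by exact_mod_cast h)
    · rintro (h | h)
      · right; simp [h]
      · exact absurd h hjk

theorem ncard_sides_eq {e : X.Edge} {v : V} {j : ℕ} (hj : j ≤ X.size v)
    (he : e.1 = {v, X.link v j}) : {p : Tr × Fin 3 | X.side p.1 p.2 = e}.ncard =
      if j = 0 ∨ j = X.size v then 1 else 2 := by
  rw [ncard_sides, ← X.ncard_triangles hj]
  simp only [he]

theorem mem_boundary_iff_ncard {e : X.Edge} {p : X.Space} (hp : p.supp = e.1) :
    p ∈ (𝓡∂ 2).boundary X.Space ↔ {p : Tr × Fin 3 | X.side p.1 p.2 = e}.ncard = 1 := by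
  obtain ⟨v, hv, h⟩ := X.mem_boundary_iff p
  obtain ⟨j, hj, he⟩ := X.exists_edge_eq (show v ∈ e.1 by rw [← hp]; exact hv.ne')
  rw [h, X.moment_eq_zero_iff hj (hp.trans he), X.ncard_sides_eq hj he]
  split_ifs with h' <;> simp [h']

theorem ncard_sides_eq_one_or_two (e : X.Edge) :
    {p : Tr × Fin 3 | X.side p.1 p.2 = e}.ncard = 1 ∨
      {p : Tr × Fin 3 | X.side p.1 p.2 = e}.ncard = 2 := by
  have hv : e.ends 0 ∈ e.1 := by rw [← e.range_ends]; exact ⟨0, rfl⟩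
  obtain ⟨j, hj, he⟩ := X.exists_edge_eq hv
  rw [X.ncard_sides_eq hj he]
  split_ifs <;> simp

/-! #### The surface -/

variable [Fintype Tr]

theorem iUnion_range_map : ⋃ t, Set.range (X.spans_corner t).map = Set.univ := by
  refine Set.eq_univ_of_forall fun p => ?_
  obtain ⟨t, ht⟩ := p.2.2
  have hp : p.supp = X.corner t '' (X.corner t ⁻¹' p.supp) := by
    rw [Set.image_preimage_eq_inter_range,
      Set.inter_eq_left.2 (show p.supp ⊆ _ from fun w hw => ht w hw)]
  obtain ⟨x, -, hx⟩ := ((X.spans_corner t).bijOn_map (X.corner t ⁻¹' p.supp)).surjOn hp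
  exact Set.mem_iUnion.2 ⟨t, x, hx⟩

instance : CompactSpace X.Space := by
  refine isCompact_univ_iff.1 ?_
  rw [← X.iUnion_range_map]
  exact isCompact_iUnion fun t => isCompact_range (X.spans_corner t).continuous_map

instance : ConnectedSpace X.Space := by
  have := X.nonempty
  have hconn : ConnectedSpace (stdSimplex ℝ (Fin 3)) :=
    isConnected_iff_connectedSpace.1 (isPathConnected_stdSimplex (Fin 3)).isConnected
  refine connectedSpace_iff_univ.2 ?_
  rw [← X.iUnion_range_map]
  refine IsConnected.iUnion_of_reflTransGen
    (fun t => isConnected_range (X.spans_corner t).continuous_map) fun t t' => ?_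
  refine Relation.ReflTransGen.mono (fun a b => ?_) _ _ (X.connected t t')
  rintro ⟨i, j, hij⟩
  have key : ∀ t i, X.vertexPoint (X.corner t i) ∈ Set.range (X.spans_corner t).map := fun t i => by
    obtain ⟨x, -, hx⟩ := ((X.spans_corner t).bijOn_map {i}).surjOn
      (show X.vertexPoint (X.corner t i) ∈ _ by
        rw [Set.image_singleton]
        exact X.eq_vertexPoint_iff.1 rfl)
    exact ⟨x, hx⟩
  exact ⟨_, key a i, hij ▸ key b j⟩

theorem openSide_eq (i : Fin 3) : openSide i = {x | ∀ j, x.1 j ≠ 0 ↔ j ∈ ({i}ᶜ : Set (Fin 3))} := by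
  ext x
  constructor
  · rintro ⟨h1, h2⟩ j
    by_cases h : j = i
    · simp [h, h1]
    · simp [h, (h2 j h).ne']
  · intro h
    refine ⟨?_, fun j hj => lt_of_le_of_ne (x.2.1 j) (Ne.symm ((h j).2 hj))⟩
    by_contra h0
    exact (h i).1 h0 rfl

/-- The realization as a triangulated surface, with the orientation of the triangles given by the
order of their corners. -/
def surface : DirectedTriangulatedSurface where
  S := X.Space
  Vertex := V
  Edge := X.Edge
  Triangle := Tr
  vertexMap := X.vertexPoint
  edgeMap e := e.spans.map
  triangleMap t := (X.spans_corner t).map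
  edgeMap_continuous e := e.spans.continuous_map
  triangleMap_continuous t := (X.spans_corner t).continuous_map
  edgeMap_isEmbedding e := e.spans.isEmbedding_map.comp Topology.IsEmbedding.subtypeVal
  triangleMap_isEmbedding t := (X.spans_corner t).isEmbedding_map.comp Topology.IsEmbedding.subtypeVal
  existsUnique_cell p := by
    have key : ∀ c : V ⊕ X.Edge ⊕ Tr, p ∈ Sum.elim (fun v => {X.vertexPoint v})
        (Sum.elim (fun e : X.Edge => e.spans.map '' simplexInterior 1)
          (fun t => (X.spans_corner t).map '' simplexInterior 2)) c ↔ X.cellSet c = p.supp := by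
      rintro (v | e | t)
      · exact X.eq_vertexPoint_iff.trans eq_comm
      · show p ∈ e.spans.map '' simplexInterior 1 ↔ _
        rw [e.spans.image_simplexInterior, e.range_ends]
        exact eq_comm
      · show p ∈ (X.spans_corner t).map '' simplexInterior 2 ↔ _
        rw [(X.spans_corner t).image_simplexInterior]
        exact eq_comm
    obtain ⟨c, hc⟩ := X.exists_cellSet_eq_supp p
    exact ⟨c, (key c).2 hc, fun d hd => X.cellSet_injective (((key d).1 hd).trans hc.symm)⟩
  edgeMap_end e x hx := e.spans.map_mem_range_vertexPoint X x hx
  triangleMap_corner t x hx := (X.spans_corner t).map_mem_range_vertexPoint X x hx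
  side := X.side
  triangleMap_side t i := by
    rw [openSide_eq, (X.side t i).spans.image_simplexInterior, Edge.range_ends, coe_side]
    exact (X.spans_corner t).bijOn_map {i}ᶜ
  side_ne t := ⟨0, 1, fun h => absurd (X.side_injective t h) (by decide)⟩
  edge_incidence e := by
    have key : ∀ p ∈ e.spans.map '' simplexInterior 1, p.supp = e.1 := fun p hp => by
      rw [e.spans.image_simplexInterior, e.range_ends] at hp
      exact hp
    have hne : (e.spans.map '' simplexInterior 1).Nonempty := by
      refine Set.Nonempty.image _ ⟨⟨fun _ => 1 / 2, fun _ => by norm_num, by norm_num⟩, fun i => ?_⟩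
      show (0 : ℝ) < 1 / 2
      norm_num
    rcases X.ncard_sides_eq_one_or_two e with h | h
    · exact Or.inr ⟨h, fun p hp => (X.mem_boundary_iff_ncard (key p hp)).2 h⟩
    · refine Or.inl ⟨h, fun hsub => ?_⟩
      obtain ⟨p, hp⟩ := hne
      have := (X.mem_boundary_iff_ncard (key p hp)).1 (hsub hp)
      omega
  nontrivialEdge := by
    obtain ⟨t⟩ := X.nonempty
    exact ⟨X.side t 0, X.side t 1, fun h => absurd (X.side_injective t h) (by decide)⟩
  orientation _ := true

theorem surface_noSelfFolded : X.surface.NoSelfFolded := X.side_injective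

/-- At a vertex of the complex all link coordinates vanish, so both moments are zero: as links are
paths, every vertex lies on the boundary. -/
theorem surface_hasBoundary : X.surface.HasBoundary := by
  obtain ⟨t⟩ := X.nonempty
  refine ⟨X.vertexPoint (X.corner t 0), ?_⟩
  obtain ⟨v, hv, h⟩ := X.mem_boundary_iff (X.vertexPoint (X.corner t 0))
  refine h.2 (Or.inl ?_)
  have hs := X.eq_vertexPoint_iff.1 (rfl : X.vertexPoint (X.corner t 0) = _)
  have hv' : v ∈ (X.vertexPoint (X.corner t 0)).supp := hv.ne'
  rw [hs] at hv'
  rw [momentY, Finset.sum_eq_zero, zero_div]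
  intro j hj
  rw [Finset.mem_range, Nat.lt_succ_iff] at hj
  have : X.link v j ∉ (X.vertexPoint (X.corner t 0)).supp := by
    rw [hs, ← show v = _ from hv']
    exact X.link_ne v j hj
  rw [not_not.1 this, mul_zero]

theorem mem_boundaryEdges_surface (e : X.Edge) : e ∈ X.surface.boundaryEdges ↔
    {p : Tr × Fin 3 | X.side p.1 p.2 = e}.ncard = 1 := by
  rcases X.surface.edge_incidence e with ⟨h1, h2⟩ | ⟨h1, h2⟩
  · refine iff_of_false h2 ?_
    have h1 : {p : Tr × Fin 3 | X.side p.1 p.2 = e}.ncard = 2 := h1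
    omega
  · exact iff_of_true h2 h1

end SurfaceComplex

end

/-! ### First return maps between quivers and corner algebras. -/

noncomputable section

namespace TwoRegularQuiver

open scoped Classical

/-- An embedding of the arrows of `Q` into those of `Q'` such that the permutation `g` of `Q` is the
first return map of the permutation `g` of `Q'`. -/
structure FirstReturn (Q Q' : TwoRegularQuiver) where
  ι : Q.Vertex → Q'.Vertex
  ι_injective : Function.Injective ι
  τ : Q.Arrow → Q'.Arrow
  τ_injective : Function.Injective τ
  time : Q.Arrow → ℕ
  time_pos : ∀ h, 0 < time h
  src_τ : ∀ h, Q'.src (τ h) = ι (Q.src h)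
  iterate_time : ∀ h, Q'.g^[time h] (τ h) = τ (Q.g h)
  notMem_range : ∀ h j, 0 < j → j < time h → Q'.src (Q'.g^[j] (τ h)) ∉ Set.range ι
  time_of_fixed : ∀ h, Q.f h = h → time h = 1

namespace FirstReturn

variable {Q Q' : TwoRegularQuiver} (F : FirstReturn Q Q')

theorem bar_τ (h : Q.Arrow) : Q'.bar (F.τ h) = F.τ (Q.bar h) :=
  bar_eq_of_ne (by rw [F.src_τ, F.src_τ, src_bar]) fun h' => Q.bar_ne h (F.τ_injective h')

theorem g_iterate_time_sub_one (h : Q.Arrow) :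
    Q'.g (Q'.g^[F.time h - 1] (F.τ h)) = F.τ (Q.g h) := by
  rw [← Function.iterate_succ_apply' Q'.g, Nat.succ_eq_add_one, Nat.sub_add_cancel (F.time_pos h),
    F.iterate_time]

/-- On return, the two arrows that can follow are the images of g h and f h. So the zero relation
for h and f h occurs at the junction of the two return paths. -/
theorem f_iterate_time_sub_one (h : Q.Arrow) :
    Q'.f (Q'.g^[F.time h - 1] (F.τ h)) = F.τ (Q.f h) := by
  rw [← bar_g, F.g_iterate_time_sub_one, F.bar_τ, bar_g]

theorem f_τ {h : Q.Arrow} (hf : Q.f h = h) : Q'.f (F.τ h) = F.τ h := by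
  have := F.f_iterate_time_sub_one h
  rwa [F.time_of_fixed h hf, hf] at this

/-- The last arrow before the return is no border loop: for return time one by injectivity of τ,
otherwise because it starts outside the image of ι. -/
theorem f_iterate_ne {h : Q.Arrow} (hf : Q.f h ≠ h) :
    Q'.f (Q'.g^[F.time h - 1] (F.τ h)) ≠ Q'.g^[F.time h - 1] (F.τ h) := fun h' => by
  rw [F.f_iterate_time_sub_one] at h'
  by_cases h1 : F.time h = 1
  · rw [h1] at h'
    exact hf (F.τ_injective h')
  · have := F.time_pos h
    refine F.notMem_range h (F.time h - 1) (by omega) (by omega) ?_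
    rw [← h', F.src_τ]
    exact ⟨_, rfl⟩

/-- The time of the `i`-th return. -/
def returnTime (h : Q.Arrow) : ℕ → ℕ
  | 0 => 0
  | i + 1 => F.time h + returnTime (Q.g h) i

theorem iterate_returnTime (h : Q.Arrow) (i : ℕ) :
    Q'.g^[F.returnTime h i] (F.τ h) = F.τ (Q.g^[i] h) := by
  induction i generalizing h with
  | zero => rfl
  | succ i ih =>
    rw [returnTime, Nat.add_comm, Function.iterate_add_apply, F.iterate_time, ih,
      Function.iterate_succ_apply]

theorem le_returnTime (h : Q.Arrow) (i : ℕ) : i ≤ F.returnTime h i := by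
  induction i generalizing h with
  | zero => exact le_rfl
  | succ i ih =>
    have := ih (Q.g h)
    have := F.time_pos h
    rw [returnTime]
    omega

theorem exists_eq_returnTime (n : ℕ) (h : Q.Arrow)
    (hn : Q'.src (Q'.g^[n] (F.τ h)) ∈ Set.range F.ι) : ∃ i, n = F.returnTime h i := by
  induction n using Nat.strong_induction_on generalizing h with
  | _ n ih =>
    by_cases h0 : n = 0
    · exact ⟨0, h0⟩
    by_cases hlt : n < F.time h
    · exact absurd hn (F.notMem_range h n (Nat.pos_of_ne_zero h0) hlt)
    obtain ⟨k, rfl⟩ := Nat.exists_eq_add_of_le (not_lt.1 hlt)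
    rw [Nat.add_comm, Function.iterate_add_apply, F.iterate_time] at hn
    obtain ⟨i, rfl⟩ := ih k (by have := F.time_pos h; omega) (Q.g h) hn
    exact ⟨i + 1, rfl⟩

theorem returnTime_mono (h : Q.Arrow) : Monotone (F.returnTime h) := by
  refine monotone_nat_of_le_succ fun i => ?_
  induction i generalizing h with
  | zero => exact Nat.zero_le _
  | succ i ih => exact Nat.add_le_add_left (ih (Q.g h)) _

/-- The orbit upstairs meets the image of ι exactly at the return times, so it first closes up when
the orbit downstairs does. -/
theorem minimalPeriod_τ (h : Q.Arrow) :
    Function.minimalPeriod Q'.g (F.τ h) = F.returnTime h (Function.minimalPeriod Q.g h) := by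
  refine le_antisymm (Function.IsPeriodicPt.minimalPeriod_le ?_ ?_) ?_
  · exact (minimalPeriod_pos h).trans_le (F.le_returnTime h _)
  · rw [Function.IsPeriodicPt, Function.IsFixedPt, F.iterate_returnTime,
      Function.iterate_minimalPeriod]
  · have hp : Q'.g^[Function.minimalPeriod Q'.g (F.τ h)] (F.τ h) = F.τ h :=
      Function.iterate_minimalPeriod
    obtain ⟨i, hi⟩ := F.exists_eq_returnTime _ h (by rw [hp, F.src_τ]; exact ⟨_, rfl⟩)
    rw [hi, F.iterate_returnTime] at hp
    have h0 : 0 < i := by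
      by_contra hi0
      have := minimalPeriod_pos (F.τ h)
      rw [hi, show i = 0 by omega] at this
      exact absurd this (lt_irrefl 0)
    rw [hi]
    exact F.returnTime_mono h
      (Function.IsPeriodicPt.minimalPeriod_le h0 (F.τ_injective hp))

section Rep

variable {R : Type*} [Ring R] {e : Q'.Vertex → R} {x : Q'.Arrow → R}

/-- The product of the arrows of `Q'` up to the first return. -/
def returnProd (x : Q'.Arrow → R) (h : Q.Arrow) : R := pathProd x (F.τ h) (F.time h)

theorem pathProd_returnTime (x : Q'.Arrow → R) (h : Q.Arrow) (i : ℕ) :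
    pathProd x (F.τ h) (F.returnTime h i) = pathProd (F.returnProd x) h i := by
  induction i generalizing h with
  | zero => rfl
  | succ i ih => rw [returnTime, pathProd_add, F.iterate_time, ih, pathProd_succ]; rfl

theorem pathProd_len_τ {m : Q.WeightFunction} {m' : Q'.WeightFunction}
    (hm : ∀ h, m'.toFun (F.τ h) = m.toFun h) (x : Q'.Arrow → R) (h : Q.Arrow) :
    pathProd x (F.τ h) (len m' (F.τ h)) = pathProd (F.returnProd x) h (len m h) := by
  rw [pathProd_len, pathProd_len, F.minimalPeriod_τ, F.pathProd_returnTime, hm]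

/-- The idempotent corresponding to the vertices of `Q`. -/
def cornerIdem (e : Q'.Vertex → R) : R := ∑ v, e (F.ι v)

variable (hx : Q'.toFinQuiver.IsRep e x)
include hx

theorem cornerIdem_mul (v : Q.Vertex) : F.cornerIdem e * e (F.ι v) = e (F.ι v) := by
  rw [cornerIdem, Finset.sum_mul, Finset.sum_eq_single v, hx.idem]
  · intro w _ hw
    exact hx.orth _ _ fun h => hw (F.ι_injective h)
  · simp

theorem mul_cornerIdem (v : Q.Vertex) : e (F.ι v) * F.cornerIdem e = e (F.ι v) := by
  rw [cornerIdem, Finset.mul_sum, Finset.sum_eq_single v, hx.idem]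
  · intro w _ hw
    exact hx.orth _ _ fun h => hw (F.ι_injective h).symm
  · simp

theorem cornerIdem_mul_of_notMem {v : Q'.Vertex} (hv : v ∉ Set.range F.ι) :
    F.cornerIdem e * e v = 0 := by
  rw [cornerIdem, Finset.sum_mul]
  exact Finset.sum_eq_zero fun w _ => hx.orth _ _ fun h => hv ⟨w, h⟩

theorem mul_cornerIdem_of_notMem {v : Q'.Vertex} (hv : v ∉ Set.range F.ι) :
    e v * F.cornerIdem e = 0 := by
  rw [cornerIdem, Finset.mul_sum]
  exact Finset.sum_eq_zero fun w _ => hx.orth _ _ fun h => hv ⟨w, h.symm⟩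

theorem isIdempotentElem_cornerIdem : IsIdempotentElem (F.cornerIdem e) := by
  show F.cornerIdem e * F.cornerIdem e = F.cornerIdem e
  conv_lhs => rw [cornerIdem.eq_def F e]
  rw [Finset.sum_mul]
  exact Finset.sum_congr rfl fun v _ => F.mul_cornerIdem hx v

theorem e_mul_returnProd (h : Q.Arrow) :
    e (F.ι (Q.src h)) * F.returnProd x h = F.returnProd x h := by
  rw [← F.src_τ, returnProd, e_mul_pathProd hx _ (F.time_pos h).ne']

theorem returnProd_mul_e (h : Q.Arrow) :
    F.returnProd x h * e (F.ι (Q.tgt h)) = F.returnProd x h := by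
  have := pathProd_mul_e hx (F.τ h) (F.time_pos h).ne'
  rwa [F.iterate_time, F.src_τ, src_g] at this

end Rep

section Corner

variable {K R : Type*} [Field K] [Ring R] [Algebra K R] {e : Q'.Vertex → R} {x : Q'.Arrow → R}
  {m : Q.WeightFunction} {m' : Q'.WeightFunction} {b : Q.border → K} {b' : Q'.border → K}

/-- The border functions `b` and `b'` agree on the fixed arrows of `Q`. -/
def BorderCompatible (b : Q.border → K) (b' : Q'.border → K) : Prop :=
  ∀ h (hf : Q.f h = h), b' ⟨Q'.src (F.τ h), F.τ h, rfl, F.f_τ hf⟩ = b ⟨Q.src h, h, rfl, hf⟩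

/-- The vertices of `Q` in the idempotent algebra. -/
def cornerVertex (hx : Q'.toFinQuiver.IsRep e x) (v : Q.Vertex) :
    (F.isIdempotentElem_cornerIdem hx).Corner :=
  ⟨e (F.ι v), (Subsemigroup.mem_corner_iff (F.isIdempotentElem_cornerIdem hx)).2
    ⟨F.cornerIdem_mul hx v, F.mul_cornerIdem hx v⟩⟩

/-- The arrows of `Q` in the idempotent algebra. -/
def cornerArrow (hx : Q'.toFinQuiver.IsRep e x) (h : Q.Arrow) :
    (F.isIdempotentElem_cornerIdem hx).Corner :=
  ⟨F.returnProd x h, (Subsemigroup.mem_corner_iff (F.isIdempotentElem_cornerIdem hx)).2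
    ⟨by rw [← F.e_mul_returnProd hx h, ← mul_assoc, F.cornerIdem_mul hx],
      by rw [← F.returnProd_mul_e hx h, mul_assoc, F.mul_cornerIdem hx]⟩⟩

/-- The inclusion of the idempotent algebra. -/
def cornerVal {E : R} (hE : IsIdempotentElem E) : hE.Corner →ₗ[K] R where
  toFun := Subtype.val
  map_add' _ _ := rfl
  map_smul' _ _ := rfl

theorem val_pathProd_cornerArrow (hx : Q'.toFinQuiver.IsRep e x) (h : Q.Arrow) {i : ℕ}
    (hi : i ≠ 0) : (pathProd (F.cornerArrow hx) h i).1 = pathProd (F.returnProd x) h i := by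
  obtain ⟨i, rfl⟩ := Nat.exists_eq_succ_of_ne_zero hi
  clear hi
  induction i generalizing h with
  | zero => rw [pathProd_one, pathProd_one]; rfl
  | succ i ih =>
    rw [pathProd_succ, pathProd_succ (F.returnProd x), ← ih]
    rfl

theorem isRep_corner (hx : IsRep m' b' e x) (hm : ∀ h, m'.toFun (F.τ h) = m.toFun h)
    (hb : F.BorderCompatible b b') :
    IsRep m b (F.cornerVertex hx.toIsRep) (F.cornerArrow hx.toIsRep) where
  idem v := Subtype.ext (hx.idem _)
  orth v w h := Subtype.ext (hx.orth _ _ fun h' => h (F.ι_injective h'))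
  sum := Subtype.ext (map_sum (cornerVal (K := K) (F.isIdempotentElem_cornerIdem hx.toIsRep)) _ _)
  src_mul h := Subtype.ext (F.e_mul_returnProd hx.toIsRep h)
  mul_tgt h := Subtype.ext (F.returnProd_mul_e hx.toIsRep h)
  zero h hf := Subtype.ext <| by
    show F.returnProd x h * F.returnProd x (Q.f h) = 0
    rw [returnProd, returnProd, pathProd_ne_zero_succ' x (F.τ h) (F.time_pos h).ne',
      pathProd_ne_zero_succ x (F.τ (Q.f h)) (F.time_pos _).ne', mul_assoc,
      ← mul_assoc (x _) (x _), ← F.f_iterate_time_sub_one, hx.zero _ (F.f_iterate_ne hf), zero_mul,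
      mul_zero]
  border h hf := Subtype.ext <| by
    show F.returnProd x h * F.returnProd x h = b _ • (pathProd (F.cornerArrow hx.toIsRep) h _).1
    rw [F.val_pathProd_cornerArrow hx.toIsRep h (len_pos m h).ne', ← F.pathProd_len_τ hm,
      ← hb h hf, ← hx.border (F.τ h) (F.f_τ hf), returnProd, F.time_of_fixed h hf, pathProd_one]
  comm h := Subtype.ext <| by
    rw [F.val_pathProd_cornerArrow hx.toIsRep h (len_pos m h).ne',
      F.val_pathProd_cornerArrow hx.toIsRep _ (len_pos m _).ne', ← F.pathProd_len_τ hm,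
      ← F.pathProd_len_τ hm, hx.comm, F.bar_τ]

theorem exists_eq_τ {a : Q'.Arrow} (ha : Q'.src a ∈ Set.range F.ι) : ∃ h, a = F.τ h := by
  obtain ⟨v, hv⟩ := ha
  rw [← src_out Q v, ← F.src_τ] at hv
  obtain h | h := eq_or_eq_bar hv.symm
  · exact ⟨_, h⟩
  · exact ⟨_, h.trans (F.bar_τ _)⟩

/-- Compressing a path of Q' to the corner gives zero unless both its ends lie in the image of ι;
then its length is a return time and it is a product of return paths. Injectivity holds since socle
elements go to nonzero cycles B. -/
theorem nonempty_algEquiv_corner (hQ : Q.NoDoubleLoop) (hx : IsRep m' b' e x)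
    (hm : ∀ h, m'.toFun (F.τ h) = m.toFun h) (hb : F.BorderCompatible b b')
    (hne : ∀ a, pathProd x a (len m' a) ≠ 0)
    (hspan : Submodule.span K (Set.range e ∪ {y | ∃ h i, i ≠ 0 ∧ y = pathProd x h i}) = ⊤) :
    Nonempty (Q.algebra m b ≃ₐ[K] (F.isIdempotentElem_cornerIdem hx.toIsRep).Corner) := by
  have hE := F.isIdempotentElem_cornerIdem hx.toIsRep
  have hrep := F.isRep_corner hx hm hb
  have hinj : Function.Injective hrep.lift :=
    injective_of_socElt_ne_zero m b hQ _ fun v hv => by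
      have := hrep.lift_socElt (Q.out v)
      rw [src_out, hv] at this
      have h2 := congrArg Subtype.val this
      rw [F.val_pathProd_cornerArrow hx.toIsRep _ (len_pos m _).ne', ← F.pathProd_len_τ hm] at h2
      exact hne _ h2.symm
  have hmem : ∀ y, F.cornerIdem e * y * F.cornerIdem e ∈
      LinearMap.range ((cornerVal (K := K) hE).comp hrep.lift.toLinearMap) := fun y => by
    have hy : y ∈ Submodule.span K _ := hspan.symm ▸ Submodule.mem_top
    induction hy using Submodule.span_induction with
    | mem y hy =>
      obtain ⟨u, rfl⟩ | ⟨a, i, hi, rfl⟩ := hy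
      · by_cases hu : u ∈ Set.range F.ι
        · obtain ⟨v, rfl⟩ := hu
          rw [F.cornerIdem_mul hx.toIsRep, F.mul_cornerIdem hx.toIsRep]
          exact ⟨idem m b v, congrArg Subtype.val (hrep.lift_idem v)⟩
        · rw [F.cornerIdem_mul_of_notMem hx.toIsRep hu, zero_mul]
          exact Submodule.zero_mem _
      · by_cases ha : Q'.src a ∈ Set.range F.ι
        · obtain ⟨h, rfl⟩ := F.exists_eq_τ ha
          have h1 := e_mul_pathProd hx.toIsRep (F.τ h) hi
          have h2 := pathProd_mul_e hx.toIsRep (F.τ h) hi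
          by_cases ht : Q'.src (Q'.g^[i] (F.τ h)) ∈ Set.range F.ι
          · obtain ⟨j, rfl⟩ := F.exists_eq_returnTime i h ht
            rw [F.iterate_returnTime, F.src_τ] at h2
            have hj : j ≠ 0 := by
              rintro rfl
              exact hi rfl
            refine ⟨pathProd (gen m b) h j, ?_⟩
            rw [F.src_τ] at h1
            have h3 : F.cornerIdem e * pathProd x (F.τ h) (F.returnTime h j) =
                pathProd x (F.τ h) (F.returnTime h j) := by
              rw [← h1, ← mul_assoc, F.cornerIdem_mul hx.toIsRep]
            rw [h3, ← h2, mul_assoc, F.mul_cornerIdem hx.toIsRep, h2, F.pathProd_returnTime,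
              ← F.val_pathProd_cornerArrow hx.toIsRep h hj]
            exact congrArg Subtype.val (hrep.lift_pathProd h j)
          · rw [← h2, mul_assoc, mul_assoc, F.mul_cornerIdem_of_notMem hx.toIsRep ht, mul_zero,
              mul_zero]
            exact Submodule.zero_mem _
        · rw [← e_mul_pathProd hx.toIsRep a hi, ← mul_assoc,
            F.cornerIdem_mul_of_notMem hx.toIsRep ha, zero_mul, zero_mul]
          exact Submodule.zero_mem _
    | zero => rw [mul_zero, zero_mul]; exact Submodule.zero_mem _
    | add y z _ _ hy hz => rw [mul_add, add_mul]; exact Submodule.add_mem _ hy hz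
    | smul c y _ hy => rw [mul_smul_comm, smul_mul_assoc]; exact Submodule.smul_mem _ c hy
  have hsurj : Function.Surjective hrep.lift := fun z => by
    obtain ⟨y, hy⟩ := hmem z.1
    refine ⟨y, Subtype.ext ?_⟩
    have h1 := (Subsemigroup.mem_corner_iff hE).1 z.2
    rw [h1.1, h1.2] at hy
    exact hy
  exact ⟨AlgEquiv.ofBijective hrep.lift ⟨hinj, hsurj⟩⟩

theorem isIsoIdempotentAlgebra (hQ : Q.NoDoubleLoop) (hQ' : Q'.NoDoubleLoop)
    (hm : ∀ h, m'.toFun (F.τ h) = m.toFun h) (hb : F.BorderCompatible b b') {A : Type*} [Ring A]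
    [Algebra K A] (φ : A ≃ₐ[K] Q.algebra m b) : IsIsoIdempotentAlgebra K A (Q'.algebra m' b') := by
  have hne : ∀ a, pathProd (gen m' b') a (len m' a) ≠ 0 := fun a h => by
    rw [pathProd_gen_len] at h
    have := coords_socElt m' b' (Q'.src a)
    rw [h, map_zero] at this
    simpa using DFunLike.congr_fun this (BasisIndex.soc (Q'.src a))
  obtain ⟨ψ⟩ := F.nonempty_algEquiv_corner hQ (isRep_gen m' b') hm hb hne
    (span_paths_eq_top m' b' (.inl hQ'))
  exact ⟨_, _, ⟨φ.trans ψ⟩⟩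

end Corner

/-- If p + 1 is the period of a, then p·i further steps after the first i lead back to a, and from
there to the second arrow. This makes `weight` independent of choices. -/
theorem exists_iterate_eq_of_iterate_eq {a : Q'.Arrow} {h h' : Q.Arrow} {i j : ℕ}
    (hi : Q'.g^[i] a = F.τ h) (hj : Q'.g^[j] a = F.τ h') : ∃ k, h' = Q.g^[k] h := by
  obtain ⟨p, hp⟩ := Nat.exists_eq_succ_of_ne_zero (minimalPeriod_pos a).ne'
  have ha : Q'.g^[p * i] (F.τ h) = a := by
    rw [← hi, ← Function.iterate_add_apply, show p * i + i = (p + 1) * i by ring,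
      ← Nat.succ_eq_add_one, ← hp]
    exact (Function.isPeriodicPt_minimalPeriod Q'.g a).mul_const i
  rw [← ha, ← Function.iterate_add_apply] at hj
  obtain ⟨k, hk⟩ := F.exists_eq_returnTime _ h (by rw [hj, F.src_τ]; exact ⟨_, rfl⟩)
  rw [hk, F.iterate_returnTime] at hj
  exact ⟨k, (F.τ_injective hj).symm⟩

theorem weightFunction_iterate (m : Q.WeightFunction) (h : Q.Arrow) (k : ℕ) :
    m.toFun (Q.g^[k] h) = m.toFun h := by
  induction k with
  | zero => rfl
  | succ k ih => rw [Function.iterate_succ_apply', m.map_g, ih]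

theorem weightFunction_eq_of_iterate_eq (m : Q.WeightFunction) {a : Q'.Arrow} {h h' : Q.Arrow}
    {i j : ℕ} (hi : Q'.g^[i] a = F.τ h) (hj : Q'.g^[j] a = F.τ h') : m.toFun h' = m.toFun h := by
  obtain ⟨k, rfl⟩ := F.exists_iterate_eq_of_iterate_eq hi hj
  exact weightFunction_iterate m h k

/-- The weight function on `Q'` which extends that of `Q` and is `1` on the other orbits. -/
def weight (m : Q.WeightFunction) : Q'.WeightFunction where
  toFun a := if h : ∃ h i, Q'.g^[i] a = F.τ h then m.toFun h.choose else 1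
  pos a := by
    split_ifs
    · exact m.pos _
    · exact one_pos
  map_g a := by
    have hiff : (∃ h i, Q'.g^[i] (Q'.g a) = F.τ h) ↔ ∃ h i, Q'.g^[i] a = F.τ h := by
      constructor
      · rintro ⟨h, i, hi⟩
        exact ⟨h, i + 1, hi⟩
      · rintro ⟨h, i, hi⟩
        obtain ⟨p, hp⟩ := Nat.exists_eq_succ_of_ne_zero (minimalPeriod_pos a).ne'
        refine ⟨h, i + p, ?_⟩
        rw [← Function.iterate_succ_apply, Nat.succ_eq_add_one, Nat.add_assoc,
          ← Nat.succ_eq_add_one, ← hp, Function.iterate_add_apply, Function.iterate_minimalPeriod,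
          hi]
    by_cases h : ∃ h i, Q'.g^[i] a = F.τ h
    · have h' := hiff.2 h
      rw [dif_pos h, dif_pos h']
      obtain ⟨i, hi⟩ := h.choose_spec
      obtain ⟨j, hj⟩ := h'.choose_spec
      exact F.weightFunction_eq_of_iterate_eq m hi (j := j + 1) hj
    · rw [dif_neg h, dif_neg (hiff.not.2 h)]

theorem weight_τ (m : Q.WeightFunction) (h : Q.Arrow) : (F.weight m).toFun (F.τ h) = m.toFun h := by
  have hex : ∃ h' i, Q'.g^[i] (F.τ h) = F.τ h' := ⟨h, 0, rfl⟩
  show (if h' : ∃ h' i, Q'.g^[i] (F.τ h) = F.τ h' then m.toFun h'.choose else 1) = _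
  rw [dif_pos hex]
  obtain ⟨i, hi⟩ := hex.choose_spec
  exact F.weightFunction_eq_of_iterate_eq m (i := 0) rfl hi

end FirstReturn

end TwoRegularQuiver

end

/-! ### The complex of triangle strips attached to Q. -/

noncomputable section

namespace TwoRegularQuiver

open scoped Classical

/-- The arrows which are not fixed by `f`. -/
abbrev MovedArrow (Q : TwoRegularQuiver) : Type := {h : Q.Arrow // Q.f h ≠ h}

/-- The permutation `f` on the arrows which it does not fix. -/
def movedPerm (Q : TwoRegularQuiver) : Equiv.Perm Q.MovedArrow :=
  Q.f.subtypePerm fun _ => Q.f.injective.ne_iff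

theorem movedPerm_ne {Q : TwoRegularQuiver} (h : Q.MovedArrow) : Q.movedPerm h ≠ h := fun h' =>
  h.2 (congrArg Subtype.val h')

theorem coe_movedPerm {Q : TwoRegularQuiver} (h : Q.MovedArrow) :
    (Q.movedPerm h).1 = Q.f h.1 := rfl

/-- The vertices of the complex realizing `Q`: a segment `L i, R i` for each vertex `i` of `Q` and
three points for each moved arrow. -/
inductive GadgetVertex (Q : TwoRegularQuiver) : Type
  | L (i : Q.Vertex)
  | R (i : Q.Vertex)
  | c (h : Q.MovedArrow)
  | y (h : Q.MovedArrow)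
  | z (h : Q.MovedArrow)

namespace GadgetVertex

variable {Q : TwoRegularQuiver}

instance : Fintype Q.GadgetVertex :=
  Fintype.ofSurjective (α := (Q.Vertex ⊕ Q.Vertex) ⊕ Q.MovedArrow ⊕ Q.MovedArrow ⊕ Q.MovedArrow)
    (Sum.elim (Sum.elim L R) (Sum.elim c (Sum.elim y z))) <| by
      rintro (i | i | h | h | h)
      · exact ⟨Sum.inl (Sum.inl i), rfl⟩
      · exact ⟨Sum.inl (Sum.inr i), rfl⟩
      · exact ⟨Sum.inr (Sum.inl h), rfl⟩
      · exact ⟨Sum.inr (Sum.inr (Sum.inl h)), rfl⟩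
      · exact ⟨Sum.inr (Sum.inr (Sum.inr h)), rfl⟩

/-- The strip of triangles for a moved arrow: any three consecutive points form a triangle. -/
def strip (h : Q.MovedArrow) : ℕ → Q.GadgetVertex
  | 0 => L (Q.src h.1)
  | 1 => R (Q.src h.1)
  | 2 => c h
  -- The points y h and z h belong to this strip alone; they keep apart the simplices of different
  -- strips even when f has short cycles.
  | 3 => y h
  | 4 => z h
  | 5 => c (Q.movedPerm h)
  | _ => L (Q.src (Q.movedPerm h).1)

end GadgetVertex

open GadgetVertex

variable {Q : TwoRegularQuiver}

/-- The corners of the triangle consisting of the points `m, m + 1, m + 2` of a strip. -/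
def gadgetCorner (t : Q.MovedArrow × Fin 5) : Fin 3 → Q.GadgetVertex :=
  -- In this order side 0 is {m, m + 1} and side 1 is {m + 1, m + 2}. The rotation takes side 0 to
  -- side 1, so g passes from side 0 of one triangle to side 0 of the next.
  ![strip t.1 (t.2 + 2), strip t.1 t.2, strip t.1 (t.2 + 1)]

theorem range_gadgetCorner (t : Q.MovedArrow × Fin 5) : Set.range (gadgetCorner t) =
    {strip t.1 t.2, strip t.1 (t.2 + 1), strip t.1 (t.2 + 2)} := by
  ext w
  simp only [gadgetCorner, Set.mem_range, Fin.exists_fin_succ, Set.mem_insert_iff,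
    Set.mem_singleton_iff, eq_comm (a := w)]
  simp
  tauto

theorem NoDoubleLoop.exists_moved (hQ : Q.NoDoubleLoop) (i : Q.Vertex) :
    ∃ h : Q.MovedArrow, Q.src h.1 = i := by
  by_cases h : Q.f (Q.out i) = Q.out i
  · exact ⟨⟨Q.bar (Q.out i), hQ.f_bar_ne h⟩, by rw [src_bar, src_out]⟩
  · exact ⟨⟨Q.out i, h⟩, src_out Q i⟩

variable (hQ : Q.NoDoubleLoop)

/-- A moved arrow starting at a vertex. -/
def NoDoubleLoop.fst (hQ : Q.NoDoubleLoop) (i : Q.Vertex) : Q.MovedArrow := (hQ.exists_moved i).choose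

theorem NoDoubleLoop.src_fst (i : Q.Vertex) : Q.src (hQ.fst i).1 = i := (hQ.exists_moved i).choose_spec

/-- Both arrows starting at the vertex are moved. -/
def NoDoubleLoop.IsInner (hQ : Q.NoDoubleLoop) (i : Q.Vertex) : Prop :=
  Q.f (Q.bar (hQ.fst i).1) ≠ Q.bar (hQ.fst i).1

/-- The second moved arrow starting at a vertex, if it exists. -/
def NoDoubleLoop.snd (hQ : Q.NoDoubleLoop) (i : Q.Vertex) : Q.MovedArrow :=
  if h : hQ.IsInner i then ⟨Q.bar (hQ.fst i).1, h⟩ else hQ.fst i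

theorem NoDoubleLoop.src_snd (i : Q.Vertex) : Q.src (hQ.snd i).1 = i := by
  unfold snd
  split_ifs
  · rw [src_bar, hQ.src_fst]
  · exact hQ.src_fst i

theorem NoDoubleLoop.snd_ne (i : Q.Vertex) (h : hQ.IsInner i) : hQ.fst i ≠ hQ.snd i := by
  rw [snd, dif_pos h]
  exact fun h' => Q.bar_ne (hQ.fst i).1 (congrArg Subtype.val h').symm

theorem NoDoubleLoop.eq_fst_or (k : Q.MovedArrow) :
    k = hQ.fst (Q.src k.1) ∨ hQ.IsInner (Q.src k.1) ∧ k = hQ.snd (Q.src k.1) := by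
  obtain h | h := eq_or_eq_bar (hQ.src_fst (Q.src k.1)).symm
  · exact Or.inl (Subtype.ext h)
  · have hi : hQ.IsInner (Q.src k.1) := by
      rw [IsInner, ← h]
      exact k.2
    refine Or.inr ⟨hi, Subtype.ext ?_⟩
    rw [snd, dif_pos hi]
    exact h

/-- The length of the link of a vertex. -/
def NoDoubleLoop.linkSize (hQ : Q.NoDoubleLoop) : Q.GadgetVertex → ℕ
  | L i => if hQ.IsInner i then 4 else 2
  | R i => if hQ.IsInner i then 4 else 2
  | c _ => 5
  | y _ => 3
  | z _ => 3

/-- The points of the link of a vertex. -/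
def NoDoubleLoop.linkPoint (hQ : Q.NoDoubleLoop) : Q.GadgetVertex → ℕ → Q.GadgetVertex
  | L i, 0 => z (Q.movedPerm.symm (hQ.fst i))
  | L i, 1 => c (hQ.fst i)
  | L i, 2 => R i
  | L i, 3 => c (hQ.snd i)
  | L i, _ => z (Q.movedPerm.symm (hQ.snd i))
  | R i, 0 => y (hQ.fst i)
  | R i, 1 => c (hQ.fst i)
  | R i, 2 => L i
  | R i, 3 => c (hQ.snd i)
  | R i, _ => y (hQ.snd i)
  | c h, 0 => z h
  | c h, 1 => y h
  | c h, 2 => R (Q.src h.1)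
  | c h, 3 => L (Q.src h.1)
  | c h, 4 => z (Q.movedPerm.symm h)
  | c h, _ => y (Q.movedPerm.symm h)
  | y h, 0 => R (Q.src h.1)
  | y h, 1 => c h
  | y h, 2 => z h
  | y h, _ => c (Q.movedPerm h)
  | z h, 0 => c h
  | z h, 1 => y h
  | z h, 2 => c (Q.movedPerm h)
  | z h, _ => L (Q.src (Q.movedPerm h).1)

theorem NoDoubleLoop.linkSize_pos (v : Q.GadgetVertex) : 0 < hQ.linkSize v := by
  cases v <;> simp only [linkSize] <;> (try split_ifs) <;> norm_num

theorem NoDoubleLoop.linkPoint_ne (v : Q.GadgetVertex) (j : ℕ) : hQ.linkPoint v j ≠ v := by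
  rcases v with i | i | h | h | h <;> rcases j with _ | _ | _ | _ | _ | j <;> simp [linkPoint]

theorem ne_movedPerm_symm (h : Q.MovedArrow) : h ≠ Q.movedPerm.symm h := fun h' =>
  movedPerm_ne h <| (congrArg _ h').trans (Q.movedPerm.apply_symm_apply h)

theorem NoDoubleLoop.linkPoint_L_inj (v : Q.Vertex) (i j : ℕ) (hi : i ≤ hQ.linkSize (L v))
    (hj : j ≤ hQ.linkSize (L v)) (h : hQ.linkPoint (L v) i = hQ.linkPoint (L v) j) : i = j := by
  by_cases hv : hQ.IsInner v
  · have h3 := hQ.snd_ne v hv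
    simp only [linkSize, if_pos hv] at hi hj
    interval_cases i <;> interval_cases j <;>
      first | rfl | exact absurd h (by simp [linkPoint, h3, h3.symm])
  · simp only [linkSize, if_neg hv] at hi hj
    interval_cases i <;> interval_cases j <;> first | rfl | exact absurd h (by simp [linkPoint])

theorem NoDoubleLoop.linkPoint_R_inj (v : Q.Vertex) (i j : ℕ) (hi : i ≤ hQ.linkSize (R v))
    (hj : j ≤ hQ.linkSize (R v)) (h : hQ.linkPoint (R v) i = hQ.linkPoint (R v) j) : i = j := by
  by_cases hv : hQ.IsInner v
  · have h3 := hQ.snd_ne v hv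
    simp only [linkSize, if_pos hv] at hi hj
    interval_cases i <;> interval_cases j <;>
      first | rfl | exact absurd h (by simp [linkPoint, h3, h3.symm])
  · simp only [linkSize, if_neg hv] at hi hj
    interval_cases i <;> interval_cases j <;> first | rfl | exact absurd h (by simp [linkPoint])

theorem NoDoubleLoop.linkPoint_c_inj (v : Q.MovedArrow) (i j : ℕ) (hi : i ≤ hQ.linkSize (c v))
    (hj : j ≤ hQ.linkSize (c v)) (h : hQ.linkPoint (c v) i = hQ.linkPoint (c v) j) : i = j := by
  have h3 := ne_movedPerm_symm v
  simp only [linkSize] at hi hj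
  interval_cases i <;> interval_cases j <;>
    first | rfl | exact absurd h (by simp [linkPoint, h3, h3.symm])

theorem NoDoubleLoop.linkPoint_inj (v : Q.GadgetVertex) (i j : ℕ) (hi : i ≤ hQ.linkSize v)
    (hj : j ≤ hQ.linkSize v) (h : hQ.linkPoint v i = hQ.linkPoint v j) : i = j := by
  rcases v with v | v | v | v | v
  · exact hQ.linkPoint_L_inj v i j hi hj h
  · exact hQ.linkPoint_R_inj v i j hi hj h
  · exact hQ.linkPoint_c_inj v i j hi hj h
  all_goals
    have h3 := movedPerm_ne v
    simp only [linkSize] at hi hj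
    interval_cases i <;> interval_cases j <;>
      first | rfl | exact absurd h (by simp [linkPoint, h3, h3.symm])

/-- Strip and position can be read off from the three points; the only input is that f moves h. -/
theorem gadget_eq_of_range_subset (t t' : Q.MovedArrow × Fin 5)
    (h : Set.range (gadgetCorner t) ⊆ Set.range (gadgetCorner t')) : t = t' := by
  obtain ⟨a, m⟩ := t
  obtain ⟨b, n⟩ := t'
  rw [range_gadgetCorner, range_gadgetCorner] at h
  simp only [Set.insert_subset_iff, Set.singleton_subset_iff, Set.mem_insert_iff,
    Set.mem_singleton_iff] at h
  have hb := movedPerm_ne b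
  fin_cases m <;> fin_cases n <;> simp [strip] at h ⊢
  all_goals first
    | exact h
    | exact h.1
    | exact h.2
    | exact h.2.1
    | exact hb (h.1.symm.trans h.2)
    | exact hb (h.1 ▸ h.2)

theorem insert_rotate {α : Type*} (a b c : α) : ({a, b, c} : Set α) = {b, c, a} := by
  rw [Set.insert_comm, Set.pair_comm a c]

theorem insert_reverse {α : Type*} (a b c : α) : ({a, b, c} : Set α) = {c, b, a} := by
  rw [insert_rotate, insert_rotate, Set.pair_comm]

theorem NoDoubleLoop.exists_link (t : Q.MovedArrow × Fin 5) (v : Q.GadgetVertex)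
    (hv : v ∈ Set.range (gadgetCorner t)) : ∃ j < hQ.linkSize v,
      Set.range (gadgetCorner t) = {v, hQ.linkPoint v j, hQ.linkPoint v (j + 1)} := by
  obtain ⟨h, m⟩ := t
  rw [range_gadgetCorner] at hv ⊢
  -- These four triangles lie in the stars of `L` and `R`, whose links run through one or two
  -- strips. Their positions depend on whether k is the first or the second moved arrow at its
  -- source.
  have hL : ∀ k : Q.MovedArrow, (∃ j < hQ.linkSize (L (Q.src k.1)),
      ({L (Q.src k.1), R (Q.src k.1), c k} : Set Q.GadgetVertex) =
        {L (Q.src k.1), hQ.linkPoint (L (Q.src k.1)) j, hQ.linkPoint (L (Q.src k.1)) (j + 1)}) ∧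
      (∃ j < hQ.linkSize (L (Q.src k.1)),
      ({L (Q.src k.1), z (Q.movedPerm.symm k), c k} : Set Q.GadgetVertex) =
        {L (Q.src k.1), hQ.linkPoint (L (Q.src k.1)) j, hQ.linkPoint (L (Q.src k.1)) (j + 1)}) ∧
      (∃ j < hQ.linkSize (R (Q.src k.1)),
      ({R (Q.src k.1), L (Q.src k.1), c k} : Set Q.GadgetVertex) =
        {R (Q.src k.1), hQ.linkPoint (R (Q.src k.1)) j, hQ.linkPoint (R (Q.src k.1)) (j + 1)}) ∧
      (∃ j < hQ.linkSize (R (Q.src k.1)),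
      ({R (Q.src k.1), y k, c k} : Set Q.GadgetVertex) =
        {R (Q.src k.1), hQ.linkPoint (R (Q.src k.1)) j, hQ.linkPoint (R (Q.src k.1)) (j + 1)}) := by
    intro k
    obtain ⟨i, hi⟩ : ∃ i, i = Q.src k.1 := ⟨_, rfl⟩
    have hk := hQ.eq_fst_or k
    rw [← hi] at hk ⊢
    have hs : 2 ≤ hQ.linkSize (L i) ∧ 2 ≤ hQ.linkSize (R i) := by
      simp only [linkSize]; split_ifs <;> simp
    rcases hk with hk | ⟨hi, hk⟩
    · rw [hk]
      exact ⟨⟨1, by omega, by rw [Set.pair_comm (R i)]; rfl⟩, ⟨0, by omega, rfl⟩,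
        ⟨1, by omega, by rw [Set.pair_comm (L i)]; rfl⟩, ⟨0, by omega, rfl⟩⟩
    · have hs : hQ.linkSize (L i) = 4 ∧ hQ.linkSize (R i) = 4 := by
        simp only [linkSize, if_pos hi, and_self]
      rw [hk]
      exact ⟨⟨2, by omega, rfl⟩, ⟨3, by omega, by rw [Set.pair_comm (z _)]; rfl⟩,
        ⟨2, by omega, rfl⟩, ⟨3, by omega, by rw [Set.pair_comm (y _)]; rfl⟩⟩
  obtain ⟨l1, -, l3, l4⟩ := hL h
  have l2 := (hL (Q.movedPerm h)).2.1
  rw [Equiv.symm_apply_apply] at l2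
  have hs := Q.movedPerm.symm_apply_apply h
  fin_cases m
  · rcases hv with rfl | rfl | rfl
    · exact l1
    · obtain ⟨j, hj, h'⟩ := l3
      exact ⟨j, hj, (Set.insert_comm _ _ _).trans h'⟩
    · exact ⟨2, show 2 < 5 by simp, insert_reverse _ _ _⟩
  · rcases hv with rfl | rfl | rfl
    · obtain ⟨j, hj, h'⟩ := l4
      exact ⟨j, hj, (congrArg _ (Set.pair_comm _ _)).trans h'⟩
    · exact ⟨1, show 1 < 5 by simp, insert_rotate _ _ _⟩
    · exact ⟨0, show 0 < 3 by simp, (insert_rotate _ _ _).trans (insert_rotate _ _ _)⟩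
  · rcases hv with rfl | rfl | rfl
    · exact ⟨0, show 0 < 5 by simp, congrArg _ (Set.pair_comm _ _)⟩
    · exact ⟨1, show 1 < 3 by simp, Set.insert_comm _ _ _⟩
    · exact ⟨0, show 0 < 3 by simp, (insert_rotate _ _ _).trans (insert_rotate _ _ _)⟩
  · rcases hv with rfl | rfl | rfl
    · exact ⟨2, show 2 < 3 by simp, rfl⟩
    · exact ⟨1, show 1 < 3 by simp, Set.insert_comm _ _ _⟩
    · refine ⟨4, show 4 < 5 by simp, ?_⟩
      show ({y h, z h, c (Q.movedPerm h)} : Set Q.GadgetVertex) = {c (Q.movedPerm h),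
        z (Q.movedPerm.symm (Q.movedPerm h)), y (Q.movedPerm.symm (Q.movedPerm h))}
      rw [hs, insert_reverse]
  · rcases hv with rfl | rfl | rfl
    · exact ⟨2, show 2 < 3 by simp, rfl⟩
    · refine ⟨3, show 3 < 5 by simp, ?_⟩
      show ({z h, c (Q.movedPerm h), L (Q.src (Q.movedPerm h).1)} : Set Q.GadgetVertex) =
        {c (Q.movedPerm h), L (Q.src (Q.movedPerm h).1), z (Q.movedPerm.symm (Q.movedPerm h))}
      rw [hs, insert_rotate]
    · obtain ⟨j, hj, h'⟩ := l2
      exact ⟨j, hj, ((insert_rotate _ _ _).trans (insert_rotate _ _ _)).trans h'⟩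

theorem NoDoubleLoop.exists_triangle (v : Q.GadgetVertex) (j : ℕ) (hj : j < hQ.linkSize v) :
    ∃ t, Set.range (gadgetCorner t) = {v, hQ.linkPoint v j, hQ.linkPoint v (j + 1)} := by
  simp only [range_gadgetCorner]
  have hs := fun k : Q.MovedArrow => Q.movedPerm.apply_symm_apply k
  have h0 : ∀ i k, Q.src k.1 = i → ∃ t : Q.MovedArrow × Fin 5,
      ({strip t.1 t.2, strip t.1 (t.2 + 1), strip t.1 (t.2 + 2)} : Set Q.GadgetVertex) =
        {L i, R i, c k} := by
    rintro i k rfl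
    exact ⟨(k, 0), rfl⟩
  have h1 : ∀ i k, Q.src k.1 = i → ∃ t : Q.MovedArrow × Fin 5,
      ({strip t.1 t.2, strip t.1 (t.2 + 1), strip t.1 (t.2 + 2)} : Set Q.GadgetVertex) =
        {R i, c k, y k} := by
    rintro i k rfl
    exact ⟨(k, 1), rfl⟩
  have h3 : ∀ k, ∃ t : Q.MovedArrow × Fin 5,
      ({strip t.1 t.2, strip t.1 (t.2 + 1), strip t.1 (t.2 + 2)} : Set Q.GadgetVertex) =
        {y (Q.movedPerm.symm k), z (Q.movedPerm.symm k), c k} := by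
    intro k
    refine ⟨(Q.movedPerm.symm k, 3), ?_⟩
    show ({y (Q.movedPerm.symm k), z (Q.movedPerm.symm k),
      c (Q.movedPerm (Q.movedPerm.symm k))} : Set Q.GadgetVertex) = _
    rw [hs]
  have h4 : ∀ i k, Q.src k.1 = i → ∃ t : Q.MovedArrow × Fin 5,
      ({strip t.1 t.2, strip t.1 (t.2 + 1), strip t.1 (t.2 + 2)} : Set Q.GadgetVertex) =
        {z (Q.movedPerm.symm k), c k, L i} := by
    rintro i k rfl
    refine ⟨(Q.movedPerm.symm k, 4), ?_⟩
    show ({z (Q.movedPerm.symm k), c (Q.movedPerm (Q.movedPerm.symm k)),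
      L (Q.src (Q.movedPerm (Q.movedPerm.symm k)).1)} : Set Q.GadgetVertex) = _
    rw [hs]
  have hf := hQ.src_fst
  have hg := hQ.src_snd
  rcases v with i | i | h | h | h
  · have : j < 4 := hj.trans_le (by simp only [linkSize]; split_ifs <;> simp)
    interval_cases j
    · obtain ⟨t, ht⟩ := h4 i _ (hf i)
      exact ⟨t, ht.trans ((insert_rotate _ _ _).trans (insert_rotate _ _ _))⟩
    · obtain ⟨t, ht⟩ := h0 i _ (hf i)
      exact ⟨t, ht.trans (congrArg _ (Set.pair_comm _ _))⟩
    · exact h0 i _ (hg i)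
    · obtain ⟨t, ht⟩ := h4 i _ (hg i)
      exact ⟨t, ht.trans (insert_reverse _ _ _)⟩
  · have : j < 4 := hj.trans_le (by simp only [linkSize]; split_ifs <;> simp)
    interval_cases j
    · obtain ⟨t, ht⟩ := h1 i _ (hf i)
      exact ⟨t, ht.trans (congrArg _ (Set.pair_comm _ _))⟩
    · obtain ⟨t, ht⟩ := h0 i _ (hf i)
      exact ⟨t, ht.trans (insert_rotate _ _ _)⟩
    · obtain ⟨t, ht⟩ := h0 i _ (hg i)
      exact ⟨t, ht.trans (Set.insert_comm _ _ _)⟩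
    · exact h1 i _ (hg i)
  · simp only [linkSize] at hj
    interval_cases j
    · exact ⟨(h, 2), congrArg _ (Set.pair_comm _ _)⟩
    · exact ⟨(h, 1), insert_rotate _ _ _⟩
    · exact ⟨(h, 0), insert_reverse _ _ _⟩
    · obtain ⟨t, ht⟩ := h4 _ h rfl
      exact ⟨t, ht.trans (insert_rotate _ _ _)⟩
    · obtain ⟨t, ht⟩ := h3 h
      exact ⟨t, ht.trans (insert_reverse _ _ _)⟩
  · simp only [linkSize] at hj
    interval_cases j
    · exact ⟨(h, 1), (insert_rotate _ _ _).trans (insert_rotate _ _ _)⟩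
    · exact ⟨(h, 2), Set.insert_comm _ _ _⟩
    · exact ⟨(h, 3), rfl⟩
  · simp only [linkSize] at hj
    interval_cases j
    · exact ⟨(h, 2), (insert_rotate _ _ _).trans (insert_rotate _ _ _)⟩
    · exact ⟨(h, 3), Set.insert_comm _ _ _⟩
    · exact ⟨(h, 4), rfl⟩

end TwoRegularQuiver

end

/-! ### Q inside the quiver of the strip surface. -/

noncomputable section

/-- An arrow from a triangle joins two different sides, so the only loops are the border loops, at
most one for each edge. -/
theorem DirectedTriangulatedSurface.NoSelfFolded.noDoubleLoop {T : DirectedTriangulatedSurface}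
    (hT : T.NoSelfFolded) : T.quiver.NoDoubleLoop := by
  have key : ∀ p : T.Triangle × Fin 3, T.quiver.tgt (Sum.inl p) ≠ T.quiver.src (Sum.inl p) := by
    intro p h
    have h1 := hT p.1 h
    have h2 : p.2 + T.step p.1 = p.2 := h1
    rw [add_eq_left, step] at h2
    split_ifs at h2 <;> exact absurd h2 (by decide)
  intro a ha hb
  have hs := T.quiver.src_bar a
  have hne := T.quiver.bar_ne a
  rcases a with p | d
  · exact key p ha
  · revert hb hs hne
    obtain ⟨x, hx⟩ : ∃ x, x = T.quiver.bar (Sum.inr d) := ⟨_, rfl⟩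
    rw [← hx]
    rcases x with p | d'
    · exact fun h1 h2 _ => key p (h1.trans h2.symm)
    · exact fun _ h2 h3 => h3 (congrArg Sum.inr (Subtype.ext h2))

namespace TwoRegularQuiver

open scoped Classical
open GadgetVertex

variable {Q : TwoRegularQuiver} (hQ : Q.NoDoubleLoop)

theorem strip_mem (h : Q.MovedArrow) (m : Fin 5) : strip h m ∈ Set.range (gadgetCorner (h, m)) := by
  rw [range_gadgetCorner]
  exact Or.inl rfl

theorem strip_add_two_mem (h : Q.MovedArrow) (m : Fin 5) :
    strip h (m + 2) ∈ Set.range (gadgetCorner (h, m)) := by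
  rw [range_gadgetCorner]
  exact Or.inr (Or.inr rfl)

/-- Two triangles with a common corner. -/
def Meets (t t' : Q.MovedArrow × Fin 5) : Prop := ∃ i j, gadgetCorner t i = gadgetCorner t' j

theorem meets_of_mem {t t' : Q.MovedArrow × Fin 5} {w : Q.GadgetVertex}
    (h : w ∈ Set.range (gadgetCorner t)) (h' : w ∈ Set.range (gadgetCorner t')) : Meets t t' := by
  obtain ⟨i, hi⟩ := h
  obtain ⟨j, hj⟩ := h'
  exact ⟨i, j, hi.trans hj.symm⟩

theorem Meets.symm {t t' : Q.MovedArrow × Fin 5} (h : Meets t t') : Meets t' t := by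
  obtain ⟨i, j, h⟩ := h
  exact ⟨j, i, h.symm⟩

theorem reflTransGen_meets_symm {t t' : Q.MovedArrow × Fin 5}
    (h : Relation.ReflTransGen Meets t t') : Relation.ReflTransGen Meets t' t := by
  induction h with
  | refl => exact .refl
  | tail _ h ih => exact .head h.symm ih

theorem reflTransGen_meets_zero (h : Q.MovedArrow) (m : Fin 5) :
    Relation.ReflTransGen Meets (h, 0) (h, m) := by
  have h2 : Meets (h, 0) (h, 2) := meets_of_mem (strip_add_two_mem h 0) (strip_mem h 2)
  have h4 : Meets (h, 2) (h, 4) := meets_of_mem (strip_add_two_mem h 2) (strip_mem h 4)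
  have h1 : Meets (h, 1) (h, 3) := meets_of_mem (strip_add_two_mem h 1) (strip_mem h 3)
  have h0 : Meets (h, 0) (h, 1) := by
    refine meets_of_mem (w := strip h 1) ?_ (strip_mem h 1)
    rw [range_gadgetCorner]
    exact Or.inr (Or.inl rfl)
  fin_cases m
  · exact .refl
  · exact .single h0
  · exact .single h2
  · exact .tail (.single h0) h1
  · exact .tail (.single h2) h4

theorem meets_of_src_eq {h k : Q.MovedArrow} (hk : Q.src h.1 = Q.src k.1) :
    Meets (h, 0) (k, 0) :=
  meets_of_mem (strip_mem h 0) <| by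
    have := strip_mem k 0
    rwa [show strip h ((0 : Fin 5) : ℕ) = strip k ((0 : Fin 5) : ℕ) from congrArg L hk]

theorem meets_movedPerm (h : Q.MovedArrow) : Meets (h, 4) (Q.movedPerm h, 0) :=
  meets_of_mem (strip_add_two_mem h 4) (strip_mem (Q.movedPerm h) 0)

theorem Connected.reflTransGen_meets (hc : Q.Connected) (t t' : Q.MovedArrow × Fin 5) :
    Relation.ReflTransGen Meets t t' := by
  suffices key : ∀ h k : Q.MovedArrow, Relation.ReflTransGen Meets (h, 0) (k, 0) from
    (reflTransGen_meets_symm (reflTransGen_meets_zero t.1 t.2)).trans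
      ((key t.1 t'.1).trans (reflTransGen_meets_zero t'.1 t'.2))
  intro h k
  -- The condition concerns all moved arrows at the source of a, since a itself may be f-fixed. It
  -- passes to g a: either f a = a and the source is unchanged, or the strip of a ends at the
  -- segment where g a starts.
  refine hc {a | ∀ k : Q.MovedArrow, Q.src k.1 = Q.src a →
    Relation.ReflTransGen Meets (h, 0) (k, 0)} ⟨h.1, fun k hk => .single (meets_of_src_eq hk.symm)⟩
    (fun a ha => ⟨fun k hk => ha k (hk.trans (Q.src_bar a)), fun k hk => ?_⟩) k.1 k rfl
  by_cases hf : Q.f a = a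
  · exact ha k (hk.trans (by rw [g, hf, src_bar]))
  · exact (ha ⟨a, hf⟩ rfl).trans <| (reflTransGen_meets_zero _ 4).trans <|
      .head (meets_movedPerm _) (.single (meets_of_src_eq (by
        rw [hk, coe_movedPerm, g, src_bar])))

/-- The complex built from strips of triangles for the moved arrows. -/
def NoDoubleLoop.gadget (hQ : Q.NoDoubleLoop) (hc : Q.Connected) (a : Q.Arrow) :
    SurfaceComplex Q.GadgetVertex (Q.MovedArrow × Fin 5) where
  corner := gadgetCorner
  corner_injective t := by
    have h := movedPerm_ne t.1
    have key : ∀ m : Fin 5, strip t.1 (m + 2) ≠ strip t.1 m ∧ strip t.1 (m + 2) ≠ strip t.1 (m + 1) ∧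
        strip t.1 m ≠ strip t.1 (m + 1) := by
      intro m
      fin_cases m <;> (simp [strip]; try first | exact h | exact h.symm)
    obtain ⟨h1, h2, h3⟩ := key t.2
    intro i j hij
    fin_cases i <;> fin_cases j <;>
      first
        | rfl | exact absurd hij h1 | exact absurd hij h2 | exact absurd hij h3
        | exact absurd hij.symm h1 | exact absurd hij.symm h2 | exact absurd hij.symm h3
  eq_of_range_subset := gadget_eq_of_range_subset
  size := hQ.linkSize
  size_pos := hQ.linkSize_pos
  link := hQ.linkPoint
  link_inj := hQ.linkPoint_inj
  link_ne v j _ := hQ.linkPoint_ne v j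
  exists_link := hQ.exists_link
  exists_triangle := hQ.exists_triangle
  connected := hc.reflTransGen_meets
  nonempty := ⟨(hQ.exists_moved (Q.src a)).choose, 0⟩

variable (hc : Q.Connected) (a₀ : Q.Arrow)

theorem NoDoubleLoop.coe_side_zero (h : Q.MovedArrow) (m : Fin 5) :
    ((hQ.gadget hc a₀).side (h, m) 0).1 = {strip h m, strip h (m + 1)} := rfl

theorem NoDoubleLoop.coe_side_one (h : Q.MovedArrow) (m : Fin 5) :
    ((hQ.gadget hc a₀).side (h, m) 1).1 = {strip h (m + 1), strip h (m + 2)} := rfl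

/-- The edge of the complex corresponding to a vertex of `Q`. -/
def NoDoubleLoop.segment (i : Q.Vertex) : (hQ.gadget hc a₀).Edge :=
  ⟨{L i, R i}, (hQ.fst i, 0), 0, by
    have := hQ.coe_side_zero hc a₀ (hQ.fst i) 0
    refine Eq.trans ?_ this.symm
    show _ = ({L (Q.src (hQ.fst i).1), R (Q.src (hQ.fst i).1)} : Set Q.GadgetVertex)
    rw [hQ.src_fst]⟩

/-- The surface with the triangulation by the strips. -/
abbrev NoDoubleLoop.gadgetSurface : DirectedTriangulatedSurface := (hQ.gadget hc a₀).surface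

/-- Only triangle 0 of a strip contains a whole segment, and bar a is the only moved arrow at the
source of a. -/
theorem NoDoubleLoop.segment_mem_boundaryEdges {a : Q.Arrow} (ha : Q.f a = a) :
    hQ.segment hc a₀ (Q.src a) ∈ (hQ.gadgetSurface hc a₀).boundaryEdges := by
  refine ((hQ.gadget hc a₀).mem_boundaryEdges_surface _).2 ?_
  rw [SurfaceComplex.ncard_sides, Set.ncard_eq_one]
  refine ⟨(⟨Q.bar a, hQ.f_bar_ne ha⟩, 0), ?_⟩
  ext t
  obtain ⟨k, m⟩ := t
  show ({L (Q.src a), R (Q.src a)} : Set Q.GadgetVertex) ⊆ Set.range (gadgetCorner (k, m)) ↔ _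
  rw [range_gadgetCorner]
  simp only [Set.insert_subset_iff, Set.singleton_subset_iff, Set.mem_insert_iff,
    Set.mem_singleton_iff]
  constructor
  · intro h
    have key : m = 0 ∧ Q.src k.1 = Q.src a := by
      fin_cases m <;> simp [strip] at h ⊢
      exact h.symm
    obtain ⟨rfl, hk⟩ := key
    obtain h1 | h1 := eq_or_eq_bar hk
    · exact absurd ha (h1 ▸ k.2)
    · exact Prod.ext (Subtype.ext h1) rfl
  · intro h
    obtain ⟨rfl, rfl⟩ := Prod.ext_iff.1 h
    simp [strip, src_bar]

/-- The arrow of the surface quiver for a side of a triangle. -/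
def NoDoubleLoop.sideArrow (h : Q.MovedArrow) (m : Fin 5) (i : Fin 3) :
    (hQ.gadgetSurface hc a₀).quiver.Arrow := Sum.inl ((h, m), i)

/-- The border loop of the surface quiver for an arrow fixed by `f`. -/
def NoDoubleLoop.borderArrow {a : Q.Arrow} (ha : Q.f a = a) :
    (hQ.gadgetSurface hc a₀).quiver.Arrow :=
  Sum.inr ⟨_, hQ.segment_mem_boundaryEdges hc a₀ ha⟩

/-- The arrow of the surface quiver corresponding to an arrow of `Q`. -/
def NoDoubleLoop.surfaceArrow (a : Q.Arrow) : (hQ.gadgetSurface hc a₀).quiver.Arrow :=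
  if h : Q.f a = a then hQ.borderArrow hc a₀ h else hQ.sideArrow hc a₀ ⟨a, h⟩ 0 0

theorem NoDoubleLoop.surfaceArrow_of_fixed {a : Q.Arrow} (ha : Q.f a = a) :
    hQ.surfaceArrow hc a₀ a = hQ.borderArrow hc a₀ ha := dif_pos ha

theorem NoDoubleLoop.surfaceArrow_of_moved (h : Q.MovedArrow) :
    hQ.surfaceArrow hc a₀ h.1 = hQ.sideArrow hc a₀ h 0 0 := dif_neg h.2

theorem NoDoubleLoop.segment_injective : Function.Injective (hQ.segment hc a₀) := fun i j h => by
  have h1 : ({L i, R i} : Set Q.GadgetVertex) = {L j, R j} := congrArg Subtype.val h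
  have h2 : L i ∈ ({L j, R j} : Set Q.GadgetVertex) := by rw [← h1]; simp
  simpa using h2

theorem NoDoubleLoop.src_surfaceArrow (a : Q.Arrow) :
    (hQ.gadgetSurface hc a₀).quiver.src (hQ.surfaceArrow hc a₀ a) =
      hQ.segment hc a₀ (Q.src a) := by
  by_cases h : Q.f a = a
  · rw [surfaceArrow_of_fixed _ _ _ h]
    rfl
  · exact congrArg _ (hQ.surfaceArrow_of_moved hc a₀ ⟨a, h⟩)

theorem NoDoubleLoop.surfaceArrow_injective : Function.Injective (hQ.surfaceArrow hc a₀) := by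
  intro a b h
  by_cases ha : Q.f a = a
  · rw [hQ.surfaceArrow_of_fixed hc a₀ ha] at h
    by_cases hb : Q.f b = b
    · rw [hQ.surfaceArrow_of_fixed hc a₀ hb] at h
      have h1 : Q.src a = Q.src b :=
        hQ.segment_injective hc a₀ (congrArg Subtype.val (Sum.inr_injective h))
      obtain h2 | h2 := eq_or_eq_bar h1
      · exact h2
      · rw [h2] at ha
        exact absurd ha (hQ.f_bar_ne hb)
    · rw [hQ.surfaceArrow_of_moved hc a₀ ⟨b, hb⟩] at h
      cases h
  · rw [hQ.surfaceArrow_of_moved hc a₀ ⟨a, ha⟩] at h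
    by_cases hb : Q.f b = b
    · rw [hQ.surfaceArrow_of_fixed hc a₀ hb] at h
      cases h
    · rw [hQ.surfaceArrow_of_moved hc a₀ ⟨b, hb⟩] at h
      exact congrArg (fun p : (Q.MovedArrow × Fin 5) × Fin 3 => p.1.1.1) (Sum.inl_injective h)

theorem NoDoubleLoop.bar_surfaceArrow (a : Q.Arrow) :
    (hQ.gadgetSurface hc a₀).quiver.bar (hQ.surfaceArrow hc a₀ a) =
      hQ.surfaceArrow hc a₀ (Q.bar a) :=
  bar_eq_of_ne (by rw [src_surfaceArrow, src_surfaceArrow, src_bar]) fun h =>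
    Q.bar_ne a (hQ.surfaceArrow_injective hc a₀ h)

theorem NoDoubleLoop.f_sideArrow (h : Q.MovedArrow) (m : Fin 5) (i : Fin 3) :
    (hQ.gadgetSurface hc a₀).quiver.f (hQ.sideArrow hc a₀ h m i) =
      hQ.sideArrow hc a₀ h m (i + 1) := rfl

theorem NoDoubleLoop.src_sideArrow (h : Q.MovedArrow) (m : Fin 5) (i : Fin 3) :
    (hQ.gadgetSurface hc a₀).quiver.src (hQ.sideArrow hc a₀ h m i) =
      (hQ.gadget hc a₀).side (h, m) i := rfl

theorem NoDoubleLoop.sideArrow_ne {h h' : Q.MovedArrow} {m m' : Fin 5} {i i' : Fin 3}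
    (hi : i ≠ i') : hQ.sideArrow hc a₀ h m i ≠ hQ.sideArrow hc a₀ h' m' i' := fun e =>
  hi (congrArg Prod.snd (Sum.inl_injective e))

theorem NoDoubleLoop.g_sideArrow_zero (h : Q.MovedArrow) (m m' : Fin 5) (hm : (m : ℕ) + 1 = m') :
    (hQ.gadgetSurface hc a₀).quiver.g (hQ.sideArrow hc a₀ h m 0) =
      hQ.sideArrow hc a₀ h m' 0 := by
  rw [g, f_sideArrow]
  refine bar_eq_of_ne ?_ (hQ.sideArrow_ne hc a₀ (by decide))
  rw [src_sideArrow, src_sideArrow]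
  refine Subtype.ext ?_
  rw [coe_side_zero]
  refine Eq.trans ?_ (hQ.coe_side_one hc a₀ h m).symm
  rw [← hm]

/-- The end of a strip is glued to the edge {c, L} of the first triangle of the next strip; there
the path enters through side 2. -/
theorem NoDoubleLoop.g_sideArrow_four (h : Q.MovedArrow) :
    (hQ.gadgetSurface hc a₀).quiver.g (hQ.sideArrow hc a₀ h 4 0) =
      hQ.sideArrow hc a₀ (Q.movedPerm h) 0 2 := by
  rw [g, f_sideArrow]
  refine bar_eq_of_ne ?_ (hQ.sideArrow_ne hc a₀ (by decide))
  exact Subtype.ext rfl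

theorem NoDoubleLoop.g_sideArrow_two (h : Q.MovedArrow) :
    (hQ.gadgetSurface hc a₀).quiver.g (hQ.sideArrow hc a₀ (Q.movedPerm h) 0 2) =
      hQ.surfaceArrow hc a₀ (Q.g h.1) := by
  rw [g, f_sideArrow]
  exact (congrArg _ (hQ.surfaceArrow_of_moved hc a₀ (Q.movedPerm h)).symm).trans
    (hQ.bar_surfaceArrow hc a₀ _)

theorem NoDoubleLoop.iterate_g_sideArrow (h : Q.MovedArrow) (m : Fin 5) :
    (hQ.gadgetSurface hc a₀).quiver.g^[m] (hQ.sideArrow hc a₀ h 0 0) =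
      hQ.sideArrow hc a₀ h m 0 := by
  obtain ⟨m, hm⟩ := m
  induction m with
  | zero => rfl
  | succ m ih =>
    rw [show ((⟨m + 1, hm⟩ : Fin 5) : ℕ) = m + 1 from rfl, Function.iterate_succ_apply']
    exact (congrArg _ (ih (by omega))).trans (hQ.g_sideArrow_zero hc a₀ h _ _ rfl)

theorem NoDoubleLoop.iterate_g_five (h : Q.MovedArrow) :
    (hQ.gadgetSurface hc a₀).quiver.g^[5] (hQ.sideArrow hc a₀ h 0 0) =
      hQ.sideArrow hc a₀ (Q.movedPerm h) 0 2 := by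
  rw [Function.iterate_succ_apply']
  exact (congrArg _ (hQ.iterate_g_sideArrow hc a₀ h 4)).trans (hQ.g_sideArrow_four hc a₀ h)

theorem NoDoubleLoop.side_ne_segment (h : Q.MovedArrow) (m : Fin 5) (hm : m ≠ 0) (i : Q.Vertex) :
    hQ.segment hc a₀ i ≠ (hQ.gadget hc a₀).side (h, m) 0 := by
  intro e
  have h1 : ({L i, R i} : Set Q.GadgetVertex) = {strip h m, strip h (m + 1)} :=
    congrArg Subtype.val e
  have h2 : R i ∈ ({strip h m, strip h (m + 1)} : Set Q.GadgetVertex) := by rw [← h1]; simp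
  have h3 : L i ∈ ({strip h m, strip h (m + 1)} : Set Q.GadgetVertex) := by rw [← h1]; simp
  fin_cases m <;> simp [strip] at h2 h3 hm

theorem NoDoubleLoop.side_two_ne_segment (h : Q.MovedArrow) (i : Q.Vertex) :
    hQ.segment hc a₀ i ≠ (hQ.gadget hc a₀).side (h, 0) 2 := by
  intro e
  have h1 : ({L i, R i} : Set Q.GadgetVertex) = {c h, L (Q.src h.1)} := congrArg Subtype.val e
  have h2 : R i ∈ ({c h, L (Q.src h.1)} : Set Q.GadgetVertex) := by rw [← h1]; simp
  simp at h2

/-- The quiver `Q` inside the surface quiver of its complex. -/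
def NoDoubleLoop.firstReturn : FirstReturn Q (hQ.gadgetSurface hc a₀).quiver where
  ι := hQ.segment hc a₀
  ι_injective := hQ.segment_injective hc a₀
  τ := hQ.surfaceArrow hc a₀
  τ_injective := hQ.surfaceArrow_injective hc a₀
  -- Five steps across the strip of h and one step inside the first triangle of the next strip. A
  -- border loop is followed immediately by the image of g h.
  time h := if Q.f h = h then 1 else 6
  time_pos h := by split_ifs <;> norm_num
  src_τ := hQ.src_surfaceArrow hc a₀
  iterate_time h := by
    split_ifs with hf
    · have : (hQ.gadgetSurface hc a₀).quiver.f (hQ.surfaceArrow hc a₀ h) =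
          hQ.surfaceArrow hc a₀ h := by
        rw [surfaceArrow_of_fixed _ _ _ hf]
        rfl
      rw [Function.iterate_one, g, this, bar_surfaceArrow, g, hf]
    · rw [Function.iterate_succ_apply']
      refine Eq.trans (congrArg _ ?_) (hQ.g_sideArrow_two hc a₀ ⟨h, hf⟩)
      exact (congrArg _ (hQ.surfaceArrow_of_moved hc a₀ ⟨h, hf⟩)).trans
        (hQ.iterate_g_five hc a₀ ⟨h, hf⟩)
  notMem_range h j h0 hj := by
    rintro ⟨i, hi⟩
    split_ifs at hj with hf
    · omega
    · rw [hQ.surfaceArrow_of_moved hc a₀ ⟨h, hf⟩] at hi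
      obtain rfl | hj' : j = 5 ∨ j < 5 := by omega
      · rw [iterate_g_five] at hi
        exact hQ.side_two_ne_segment hc a₀ _ i hi
      · have := hQ.iterate_g_sideArrow hc a₀ ⟨h, hf⟩ ⟨j, hj'⟩
        dsimp only at this
        rw [this] at hi
        exact hQ.side_ne_segment hc a₀ _ _ (fun e => h0.ne' (congrArg Fin.val e)) i hi
  time_of_fixed h hf := if_pos hf

theorem NoDoubleLoop.exists_surface {K : Type*} [Field K] {m : Q.WeightFunction}
    {b : Q.border → K} (hQ : Q.NoDoubleLoop) (hc : Q.Connected) (hb : b ≠ 0) {A : Type*} [Ring A]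
    [Algebra K A] (φ : A ≃ₐ[K] Q.algebra m b) :
    ∃ (T : DirectedTriangulatedSurface) (m : T.quiver.WeightFunction) (b : T.quiver.border → K),
        T.HasBoundary ∧ T.NoSelfFolded ∧ b ≠ 0 ∧
          IsIsoIdempotentAlgebra K A (T.quiver.algebra m b) := by
  obtain ⟨v, hv⟩ := Function.ne_iff.1 hb
  obtain ⟨a₀, h₀, hf₀⟩ := v.2
  let F := hQ.firstReturn hc a₀
  -- The strips have many further boundary edges; on these the border function is extended by zero.
  let b' : (hQ.gadgetSurface hc a₀).quiver.border → K := fun w =>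
    if h : ∃ v : Q.border, F.ι v = w then b h.choose else 0
  have hb' : ∀ (v : Q.border) (w : (hQ.gadgetSurface hc a₀).quiver.border), F.ι v = w.1 →
      b' w = b v := by
    intro v w h
    have hex : ∃ v : Q.border, F.ι v = w := ⟨v, h⟩
    rw [show b' w = b hex.choose from dif_pos hex]
    exact congrArg b (Subtype.ext (F.ι_injective (hex.choose_spec.trans h.symm)))
  refine ⟨hQ.gadgetSurface hc a₀, F.weight m, b', SurfaceComplex.surface_hasBoundary _,
    SurfaceComplex.surface_noSelfFolded _, fun h => hv ?_, ?_⟩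
  · rw [← hb' v ⟨_, F.τ a₀, rfl, F.f_τ hf₀⟩ ((congrArg F.ι h₀.symm).trans (F.src_τ a₀).symm), h]
    rfl
  · exact F.isIsoIdempotentAlgebra hQ (SurfaceComplex.surface_noSelfFolded _).noDoubleLoop
      (F.weight_τ m) (fun h hf => hb' ⟨_, h, rfl, hf⟩ _ (F.src_τ h).symm) φ

end TwoRegularQuiver

end

/-! ### The Grothendieck group of a local algebra, and transport of the socle. -/

noncomputable section

/-! ### The Grothendieck group of a local algebra -/

section GrothendieckRank

universe v

variable {A : Type v} [Ring A]

/-- The class of a module in the Grothendieck group. -/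
def GrothendieckK0.of (M : FinRightMod A) : GrothendieckK0 A :=
  QuotientAddGroup.mk (FreeAbelianGroup.of M)

theorem GrothendieckK0.of_eq_add {L M N : FinRightMod A} (i : L.1 →ₗ[Aᵐᵒᵖ] M.1)
    (p : M.1 →ₗ[Aᵐᵒᵖ] N.1) (hi : Function.Injective i) (hp : Function.Surjective p)
    (h : Function.Exact i p) : of M = of L + of N := by
  have h1 : FreeAbelianGroup.of M - FreeAbelianGroup.of L - FreeAbelianGroup.of N ∈
      grothendieckRelations A := AddSubgroup.subset_closure ⟨L, M, N, i, p, hi, hp, h, rfl⟩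
  have h2 : (QuotientAddGroup.mk (FreeAbelianGroup.of M - FreeAbelianGroup.of L -
    FreeAbelianGroup.of N) : FreeAbelianGroup (FinRightMod A) ⧸ grothendieckRelations A) = 0 :=
    (QuotientAddGroup.eq_zero_iff _).2 h1
  have h3 : of M - of L - of N = 0 := h2
  rw [sub_sub, sub_eq_zero] at h3
  exact h3

theorem GrothendieckK0.of_eq_zero (M : FinRightMod A) [Subsingleton M.1] : of M = 0 := by
  have h := of_eq_add (L := M) (M := M) (N := M) LinearMap.id LinearMap.id
    Function.injective_id Function.surjective_id
    (fun x => ⟨fun _ => ⟨x, rfl⟩, fun _ => Subsingleton.elim _ _⟩)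
  exact left_eq_add.1 h

theorem GrothendieckK0.of_eq_of_equiv {M N : FinRightMod A} (φ : M.1 ≃ₗ[Aᵐᵒᵖ] N.1) :
    of M = of N := by
  let Z : FinRightMod A := ⟨ModuleCat.of Aᵐᵒᵖ PUnit, inferInstanceAs (Module.Finite Aᵐᵒᵖ PUnit.{v + 1})⟩
  have : Subsingleton Z.1 := inferInstanceAs (Subsingleton PUnit.{v + 1})
  rw [of_eq_add (L := Z) 0 φ.toLinearMap (fun _ _ _ => Subsingleton.elim _ _) φ.surjective
    (fun x => ⟨fun h => ⟨0, ?_⟩, ?_⟩), of_eq_zero Z, zero_add]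
  · exact (map_zero _).trans ((LinearEquiv.map_eq_zero_iff φ).1 h).symm
  · rintro ⟨y, rfl⟩
    exact map_zero φ

theorem GrothendieckK0.of_mem_zmultiples [IsNoetherianRing Aᵐᵒᵖ] {s : GrothendieckK0 A}
    (hs : ∀ M : FinRightMod A, IsSimpleModule Aᵐᵒᵖ M.1 → of M = s) {M : Type v} [AddCommGroup M]
    [Module Aᵐᵒᵖ M] (hM : IsFiniteLength Aᵐᵒᵖ M) (hf : Module.Finite Aᵐᵒᵖ (ModuleCat.of Aᵐᵒᵖ M)) :
    of ⟨ModuleCat.of Aᵐᵒᵖ M, hf⟩ ∈ AddSubgroup.zmultiples s := by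
  induction hM with
  | @of_subsingleton M _ _ hM =>
    rw [@of_eq_zero _ _ ⟨ModuleCat.of Aᵐᵒᵖ M, hf⟩ hM]
    exact zero_mem _
  | @of_simple_quotient M _ _ N hsimple _ ih =>
    have : Module.Finite Aᵐᵒᵖ M := hf
    have : Module.Finite Aᵐᵒᵖ N := inferInstance
    have : Module.Finite Aᵐᵒᵖ (M ⧸ N) := inferInstance
    let M' : FinRightMod A := ⟨ModuleCat.of Aᵐᵒᵖ M, hf⟩
    let L' : FinRightMod A := ⟨ModuleCat.of Aᵐᵒᵖ N, inferInstanceAs (Module.Finite Aᵐᵒᵖ N)⟩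
    let N' : FinRightMod A := ⟨ModuleCat.of Aᵐᵒᵖ (M ⧸ N),
      inferInstanceAs (Module.Finite Aᵐᵒᵖ (M ⧸ N))⟩
    let i : L'.1 →ₗ[Aᵐᵒᵖ] M'.1 := N.subtype
    let p : M'.1 →ₗ[Aᵐᵒᵖ] N'.1 := N.mkQ
    have h : of M' = of L' + of N' := of_eq_add i p N.injective_subtype N.mkQ_surjective
      (LinearMap.exact_subtype_mkQ N)
    show of M' ∈ _
    rw [h, hs N' hsimple]
    exact add_mem (ih _) (AddSubgroup.mem_zmultiples s)

/-- Modules of finite length are filtered by simple ones, so the common class of all simple modules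
generates the group. -/
theorem GrothendieckK0.rank_le_one [IsArtinianRing Aᵐᵒᵖ]
    (h : ∀ M N : FinRightMod A, IsSimpleModule Aᵐᵒᵖ M.1 → IsSimpleModule Aᵐᵒᵖ N.1 →
      Nonempty (M.1 ≃ₗ[Aᵐᵒᵖ] N.1)) : Module.rank ℤ (GrothendieckK0 A) ≤ 1 := by
  obtain ⟨s, hs⟩ : ∃ s : GrothendieckK0 A, ∀ M : FinRightMod A, IsSimpleModule Aᵐᵒᵖ M.1 →
      of M = s := by
    by_cases hex : ∃ M : FinRightMod A, IsSimpleModule Aᵐᵒᵖ M.1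
    · obtain ⟨M, hM⟩ := hex
      exact ⟨of M, fun N hN => of_eq_of_equiv (h N M hN hM).some⟩
    · exact ⟨0, fun M hM => absurd ⟨M, hM⟩ hex⟩
  have hsurj : Function.Surjective (LinearMap.toSpanSingleton ℤ (GrothendieckK0 A) s) := by
    intro x
    suffices hx : x ∈ AddSubgroup.zmultiples s from AddSubgroup.mem_zmultiples_iff.1 hx
    obtain ⟨x, rfl⟩ := QuotientAddGroup.mk_surjective x
    induction x using FreeAbelianGroup.induction_on with
    | zero => exact zero_mem _
    | of M =>
      have := M.2
      exact of_mem_zmultiples hs (isFiniteLength_iff_isNoetherian_isArtinian.2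
        ⟨inferInstance, inferInstance⟩) (M := M.1) M.2
    | neg M ih => exact neg_mem ih
    | add x y hx hy => exact add_mem hx hy
  have := LinearMap.lift_rank_le_of_surjective _ hsurj
  rwa [Module.rank_self, Cardinal.lift_one, Cardinal.lift_le_one_iff] at this

/-- The right ideal of the elements killing a vector of a simple module is determined by a
multiplicative functional with nil kernel. -/
theorem smul_eq_zero_iff_of_isNilpotent {K : Type*} [Field K] [Algebra K A] (ε : A →ₐ[K] K)
    (hε : ∀ x, ε x = 0 → IsNilpotent x) {M : Type*} [AddCommGroup M] [Module Aᵐᵒᵖ M]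
    [IsSimpleModule Aᵐᵒᵖ M] {s : M} (hs : s ≠ 0) (a : Aᵐᵒᵖ) : a • s = 0 ↔ ε a.unop = 0 := by
  have key : ∀ a : Aᵐᵒᵖ, ε a.unop = 0 → a • s = 0 := by
    intro a ha
    by_contra hne
    obtain ⟨c, hc⟩ := IsSimpleModule.toSpanSingleton_surjective Aᵐᵒᵖ hne s
    rw [LinearMap.toSpanSingleton_apply, smul_smul] at hc
    have hn : IsNilpotent (c * a) := by
      rw [← MulOpposite.op_unop (c * a)]
      obtain ⟨n, hn⟩ := hε (c * a).unop (by rw [MulOpposite.unop_mul, map_mul, ha, zero_mul])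
      exact ⟨n, by rw [← MulOpposite.op_pow, hn, MulOpposite.op_zero]⟩
    refine hs ((hn.isUnit_one_sub.smul_eq_zero).1 ?_)
    rw [sub_smul, one_smul, hc, sub_self]
  refine ⟨fun h => ?_, key a⟩
  by_contra hne
  have hu : IsUnit (algebraMap K Aᵐᵒᵖ (ε a.unop)) := (IsUnit.mk0 _ hne).map _
  refine hs (hu.smul_eq_zero.1 ?_)
  have h0 := key (algebraMap K Aᵐᵒᵖ (ε a.unop) - a) (by
    rw [MulOpposite.unop_sub, MulOpposite.algebraMap_apply, MulOpposite.unop_op, map_sub,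
      AlgHom.commutes]
    exact sub_self _)
  rw [sub_smul, h, sub_zero] at h0
  exact h0

/-- The kernel of ε is nil, so every simple module is the quotient of A by it. -/
theorem rank_grothendieckK0_le_one {K : Type*} [Field K] [Algebra K A] [FiniteDimensional K A]
    (ε : A →ₐ[K] K) (hε : ∀ x, ε x = 0 → IsNilpotent x) :
    Module.rank ℤ (GrothendieckK0 A) ≤ 1 := by
  have : FiniteDimensional K Aᵐᵒᵖ := Module.Finite.equiv (MulOpposite.opLinearEquiv K)
  have : IsArtinianRing Aᵐᵒᵖ := IsArtinianRing.of_finite K Aᵐᵒᵖ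
  refine GrothendieckK0.rank_le_one fun M N hM hN => ?_
  have key : ∀ (M : FinRightMod A) (_ : IsSimpleModule Aᵐᵒᵖ M.1), ∃ φ : Aᵐᵒᵖ →ₗ[Aᵐᵒᵖ] M.1,
      Function.Surjective φ ∧ ∀ a, φ a = 0 ↔ ε a.unop = 0 := by
    intro M hM
    obtain ⟨s, hs⟩ := @exists_ne _ (IsSimpleModule.nontrivial Aᵐᵒᵖ M.1) 0
    exact ⟨LinearMap.toSpanSingleton Aᵐᵒᵖ M.1 s,
      IsSimpleModule.toSpanSingleton_surjective Aᵐᵒᵖ hs, smul_eq_zero_iff_of_isNilpotent ε hε hs⟩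
  obtain ⟨φ, hφ, h1⟩ := key M hM
  obtain ⟨ψ, hψ, h2⟩ := key N hN
  have hker : LinearMap.ker φ = LinearMap.ker ψ := by
    ext a
    rw [LinearMap.mem_ker, LinearMap.mem_ker, h1, h2]
  exact ⟨(φ.quotKerEquivOfSurjective hφ).symm.trans <|
    (Submodule.quotEquivOfEq _ _ hker).trans (ψ.quotKerEquivOfSurjective hψ)⟩

end GrothendieckRank

/-! ### Transport of the socle -/

theorem map_mem_rightSocle {A B : Type*} [Ring A] [Ring B] (φ : A ≃+* B) {x : A}
    (hx : x ∈ rightSocle A) : φ x ∈ rightSocle B := by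
  let σ : Aᵐᵒᵖ ≃+* Bᵐᵒᵖ := RingEquiv.op φ
  have := RingHomInvPair.of_ringEquiv σ
  have := RingHomInvPair.of_ringEquiv_symm σ
  let e : A ≃ₛₗ[(σ : Aᵐᵒᵖ →+* Bᵐᵒᵖ)] B :=
    { φ with map_smul' := fun c a => map_mul φ a c.unop }
  have h : rightSocle A ≤ (rightSocle B).comap e.toLinearMap := by
    refine sSup_le fun I hI => Submodule.map_le_iff_le_comap.1 (le_sSup ?_)
    exact isSimpleModule_iff_isAtom.2
      ((OrderIso.isAtom_iff (Submodule.orderIsoMapComap e) I).2 (isSimpleModule_iff_isAtom.1 hI))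
  exact h hx

theorem map_mem_rightSocle_iff {A B : Type*} [Ring A] [Ring B] (φ : A ≃+* B) {x : A} :
    φ x ∈ rightSocle B ↔ x ∈ rightSocle A :=
  ⟨fun h => by simpa using map_mem_rightSocle φ.symm h, map_mem_rightSocle φ⟩

/-- The projection of an algebra modulo its socle. -/
def socleMk (K A : Type*) [Field K] [Ring A] [Algebra K A] :
    A →ₐ[K] (socleIdeal A).ringCon.Quotient :=
  { (socleIdeal A).ringCon.mk' with commutes' := fun _ => rfl }

theorem socleMk_surjective (K A : Type*) [Field K] [Ring A] [Algebra K A] :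
    Function.Surjective (socleMk K A) := (socleIdeal A).ringCon.mk'_surjective

theorem socleMk_eq_zero_iff {K A : Type*} [Field K] [Ring A] [Algebra K A] {x : A} :
    socleMk K A x = 0 ↔ x ∈ rightSocle A := by
  refine ((socleIdeal A).ringCon.eq).trans ?_
  rw [← TwoSidedIdeal.mem_iff]
  exact TwoSidedIdeal.mem_mk' _ _ _ _ _ _ _

end

/-! ### Common socle quotients, and Brauer graph algebras as B(Q, f, m, 0). -/

noncomputable section

/-! ### Socle equivalent algebras -/

section SocleEquivalent

variable {K : Type*} [Field K] {A : Type*} [Ring A] [Algebra K A]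

theorem SocleEquivalent.exists_common_quotient {B Λ : Type*} [Ring B] [Algebra K B] [Ring Λ]
    [Algebra K Λ] (h : SocleEquivalent K A B) (Φ : Λ ≃ₐ[K] B) :
    ∃ (π : A →ₐ[K] (socleIdeal B).ringCon.Quotient) (ρ : Λ →ₐ[K] (socleIdeal B).ringCon.Quotient),
      Function.Surjective π ∧ Function.Surjective ρ ∧ (∀ x, π x = 0 ↔ x ∈ rightSocle A) ∧
        ∀ y, ρ y = 0 ↔ y ∈ rightSocle Λ := by
  obtain ⟨ψ⟩ := h
  refine ⟨(ψ : (socleIdeal A).ringCon.Quotient →ₐ[K] (socleIdeal B).ringCon.Quotient).comp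
    (socleMk K A), (socleMk K B).comp (Φ : Λ →ₐ[K] B),
    ψ.surjective.comp (socleMk_surjective K A), (socleMk_surjective K B).comp Φ.surjective,
    fun x => ?_, fun y => ?_⟩
  · rw [AlgHom.comp_apply, ← socleMk_eq_zero_iff (K := K)]
    exact map_eq_zero_iff ψ ψ.injective
  · rw [AlgHom.comp_apply, socleMk_eq_zero_iff]
    exact map_mem_rightSocle_iff Φ.toRingEquiv

/-- If ε x ≠ 0, a scalar multiple of x differs from 1 by a nilpotent element and is a unit, so the
socle would contain 1. -/
theorem apply_eq_zero_of_mem_rightSocle (ε : A →ₐ[K] K) (hε : ∀ x, ε x = 0 → IsNilpotent x)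
    (h1 : (1 : A) ∉ rightSocle A) {x : A} (hx : x ∈ rightSocle A) : ε x = 0 := by
  by_contra hne
  have hn : IsNilpotent (1 - x * algebraMap K A (ε x)⁻¹) := hε _ (by
    rw [map_sub, map_one, map_mul, AlgHom.commutes]
    exact sub_eq_zero.2 (mul_inv_cancel₀ hne).symm)
  obtain ⟨u, hu⟩ := hn.isUnit_one_sub
  rw [sub_sub_cancel] at hu
  refine h1 ?_
  rw [← u.mul_inv, hu]
  exact Submodule.mul_mem_of_op _ (Submodule.mul_mem_of_op _ hx _) _

theorem exists_algHom_of_common_quotient {Λ C : Type*} [Ring Λ] [Algebra K Λ] [Ring C]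
    [Algebra K C] (π : A →ₐ[K] C) (ρ : Λ →ₐ[K] C) (hρ : Function.Surjective ρ) (ε : Λ →ₐ[K] K)
    (h : ∀ y, ρ y = 0 → ε y = 0) : ∃ ε' : A →ₐ[K] K, ∀ x y, π x = ρ y → ε' x = ε y := by
  choose σ hσ using hρ
  have key : ∀ y z, ρ y = ρ z → ε y = ε z := fun y z hyz => by
    rw [← sub_eq_zero, ← map_sub]
    exact h _ (by rw [map_sub, hyz, sub_self])
  refine ⟨{ toFun := fun x => ε (σ (π x))
            map_one' := ?_, map_mul' := fun x y => ?_, map_zero' := ?_, map_add' := fun x y => ?_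
            commutes' := fun c => ?_ }, fun x y hxy => key _ _ ((hσ _).trans hxy)⟩
  · rw [← map_one ε]
    exact key _ _ (by rw [hσ, map_one, map_one])
  · rw [← map_mul]
    exact key _ _ (by rw [hσ, map_mul, map_mul, hσ, hσ])
  · rw [← map_zero ε]
    exact key _ _ (by rw [hσ, map_zero, map_zero])
  · rw [← map_add]
    exact key _ _ (by rw [hσ, map_add, map_add, hσ, hσ])
  · rw [← AlgHom.commutes ε]
    exact key _ _ (by rw [hσ, AlgHom.commutes, AlgHom.commutes])

end SocleEquivalent

/-- Locality passes from Λ to A: ε vanishes on the socle, hence factors through C and pulls back to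
A. An element of its kernel has a power in the socle of A, which has square zero. -/
theorem rank_grothendieckK0_le_one_of_common_quotient {K A Λ C : Type*} [Field K] [Ring A]
    [Algebra K A] [FiniteDimensional K A] [Ring Λ] [Algebra K Λ] [Ring C] [Algebra K C]
    {π : A →ₐ[K] C} {ρ : Λ →ₐ[K] C} (hρ : Function.Surjective ρ)
    (hπ0 : ∀ x, π x = 0 ↔ x ∈ rightSocle A) (hρ0 : ∀ y, ρ y = 0 ↔ y ∈ rightSocle Λ)
    (hsq : ∀ x ∈ rightSocle A, ∀ y ∈ rightSocle A, x * y = 0) (h1 : (1 : Λ) ∉ rightSocle Λ)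
    (ε : Λ →ₐ[K] K) (hε : ∀ x, ε x = 0 → IsNilpotent x) :
    Module.rank ℤ (GrothendieckK0 A) ≤ 1 := by
  obtain ⟨ε', hε'⟩ := exists_algHom_of_common_quotient π ρ hρ ε fun y hy =>
    apply_eq_zero_of_mem_rightSocle ε hε h1 ((hρ0 y).1 hy)
  refine rank_grothendieckK0_le_one ε' fun x hx => ?_
  obtain ⟨y, hy⟩ := hρ (π x)
  obtain ⟨n, hn⟩ := hε y (by rw [← hε' x y hy.symm, hx])
  refine ⟨n + n, ?_⟩
  have hmem : x ^ n ∈ rightSocle A := by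
    rw [← hπ0, map_pow, ← hy, ← map_pow, hn, map_zero]
  rw [pow_add]
  exact hsq _ hmem _ hmem

namespace TwoRegularQuiver

open BasisIndex
open scoped Classical

variable {K : Type*} [Field K] {Q : TwoRegularQuiver} (m : Q.WeightFunction)

theorem socElt_ne_zero (b : Q.border → K) (v : Q.Vertex) : socElt m b v ≠ 0 := fun h => by
  have h1 := coords_socElt m b v
  rw [h, map_zero, eq_comm, Finsupp.single_eq_zero] at h1
  exact one_ne_zero h1

/-- The socle annihilates the nil kernel of the augmentation, which contains the nonzero element
`socElt m 0 v`. -/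
theorem one_notMem_rightSocle (K : Type*) [Field K] (v : Q.Vertex) :
    (1 : Q.algebra m (0 : Q.border → K)) ∉ rightSocle (Q.algebra m (0 : Q.border → K)) := by
  intro h
  refine socElt_ne_zero m (0 : Q.border → K) v ?_
  rw [← one_mul (socElt m (0 : Q.border → K) v)]
  refine rightSocle_mul_eq_zero (J := {y | augmentation m 0 y = 0}) ?_ ?_ ?_ h
    (augmentation_socElt m 0 v)
  · intro j (hj : augmentation m 0 j = 0) c
    show augmentation m 0 (j * c) = 0
    rw [map_mul, hj, zero_mul]
  · intro j (hj : augmentation m 0 j = 0) c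
    show augmentation m 0 (c * j) = 0
    rw [map_mul, hj, mul_zero]
  · exact fun j hj => augmentation_isNilpotent m 0 (.inr rfl) hj

theorem exists_algHom_isNilpotent (K : Type*) [Field K] [Subsingleton Q.Vertex] (v : Q.Vertex) :
    ∃ ε : Q.algebra m (0 : Q.border → K) →ₐ[K] K, ∀ y, ε y = 0 → IsNilpotent y := by
  refine ⟨(Pi.evalAlgHom K (fun _ => K) v).comp (augmentation m 0), fun y hy => ?_⟩
  refine augmentation_isNilpotent m 0 (.inr rfl) (funext fun w => ?_)
  rw [Subsingleton.elim w v]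
  exact hy

end TwoRegularQuiver

namespace BrauerGraph

variable (Γ : BrauerGraph)

theorem other_ne (h : Γ.Edge × Bool) : Γ.other h ≠ h := fun e => by
  have := congrArg Prod.snd e
  simp [other] at this

/-- The involution exchanging the two half-edges of each edge. -/
def otherPerm : Equiv.Perm (Γ.Edge × Bool) where
  toFun := Γ.other
  invFun := Γ.other
  left_inv h := by simp [other]
  right_inv h := by simp [other]

theorem ncard_edge (e : Γ.Edge) : {h : Γ.Edge × Bool | h.1 = e}.ncard = 2 := by
  rw [Set.ncard_eq_two]
  refine ⟨(e, false), (e, true), by simp, ?_⟩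
  ext ⟨e', c⟩
  cases c <;> simp

/-- The Brauer quiver as a `2`-regular quiver with a permutation `f` such that `g = next`. -/
def twoRegularQuiver : TwoRegularQuiver where
  toFinQuiver := Γ.quiver
  f := Γ.next.trans Γ.otherPerm
  src_f _ := rfl
  out_two := Γ.ncard_edge

theorem bar_twoRegularQuiver (h : Γ.Edge × Bool) : Γ.twoRegularQuiver.bar h = Γ.other h :=
  TwoRegularQuiver.bar_eq_of_ne rfl (Γ.other_ne h)

theorem g_twoRegularQuiver (h : Γ.Edge × Bool) : Γ.twoRegularQuiver.g h = Γ.next h :=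
  (Γ.bar_twoRegularQuiver (Γ.other (Γ.next h))).trans (Γ.otherPerm.left_inv _)

theorem vert_next (h : Γ.Edge × Bool) : Γ.vert (Γ.next h) = Γ.vert h :=
  (Γ.sameCycle_iff _ _).1 (Equiv.Perm.sameCycle_apply_left.2 (.refl _ _))

/-- The multiplicities of a Brauer graph as a weight function. -/
def weight : Γ.twoRegularQuiver.WeightFunction where
  toFun h := Γ.mult (Γ.vert h)
  pos _ := Γ.mult_pos _
  map_g h := congrArg Γ.mult ((congrArg Γ.vert (Γ.g_twoRegularQuiver h)).trans (Γ.vert_next h))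

/-- Closure under `next` fills the whole cycle around a vertex, and closure under `other` passes to
the opposite end of each edge; connectedness of the graph does the rest. -/
theorem mem_of_closed {s : Set (Γ.Edge × Bool)} (hs : s.Nonempty) (hbar : ∀ h ∈ s, Γ.other h ∈ s)
    (hnext : ∀ h ∈ s, Γ.next h ∈ s) (k : Γ.Edge × Bool) : k ∈ s := by
  obtain ⟨h₀, hs₀⟩ := hs
  have hpow : ∀ n : ℕ, ∀ h ∈ s, (Γ.next ^ n) h ∈ s := by
    intro n
    induction n with
    | zero => exact fun h hh => hh
    | succ n ih => exact fun h hh => ih _ (hnext h hh)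
  have hvert : ∀ h ∈ s, ∀ k, Γ.vert h = Γ.vert k → k ∈ s := by
    intro h hh k hk
    obtain ⟨n, -, -, rfl⟩ := ((Γ.sameCycle_iff h k).2 hk).exists_pow_eq'
    exact hpow n h hh
  have hstep : ∀ v w, Relation.EqvGen
      (fun x y => ∃ e : Γ.Edge, Γ.vert (e, false) = x ∧ Γ.vert (e, true) = y) v w →
      ((∀ h, Γ.vert h = v → h ∈ s) ↔ ∀ h, Γ.vert h = w → h ∈ s) := by
    intro v w hvw
    induction hvw with
    | rel x y hxy =>
      obtain ⟨e, rfl, rfl⟩ := hxy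
      exact ⟨fun h' k hk => hvert _ (hbar _ (h' (e, false) rfl)) k hk.symm,
        fun h' k hk => hvert _ (hbar _ (h' (e, true) rfl)) k hk.symm⟩
    | refl => exact Iff.rfl
    | symm _ _ _ ih => exact ih.symm
    | trans _ _ _ _ _ ih ih' => exact ih.trans ih'
  exact (hstep _ _ (Γ.connected (Γ.vert h₀) (Γ.vert k))).1
    (fun h hh => hvert h₀ hs₀ h hh.symm) k rfl

theorem connected_twoRegularQuiver : Γ.twoRegularQuiver.Connected := fun _ hs h k =>
  Γ.mem_of_closed hs (fun a ha => Γ.bar_twoRegularQuiver a ▸ (h a ha).1)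
    (fun a ha => Γ.g_twoRegularQuiver a ▸ (h a ha).2) k

/-- If both arrows at an edge were loops, these two arrows would be closed under bar and g, and by
connectedness there would be no other edge. -/
theorem noDoubleLoop_twoRegularQuiver [Nontrivial Γ.Edge] : Γ.twoRegularQuiver.NoDoubleLoop := by
  intro a h1 h2
  obtain ⟨e, he⟩ := exists_ne (α := Γ.Edge) (Γ.twoRegularQuiver.src a)
  refine he (Γ.connected_twoRegularQuiver {h | Γ.twoRegularQuiver.src h = Γ.twoRegularQuiver.src a}
    ⟨a, rfl⟩ (fun h hh => ⟨(TwoRegularQuiver.src_bar _ _).trans hh, ?_⟩) (e, false))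
  show Γ.twoRegularQuiver.src (Γ.twoRegularQuiver.g h) = _
  rw [TwoRegularQuiver.src_g]
  obtain rfl | rfl := TwoRegularQuiver.eq_or_eq_bar hh
  · exact h1
  · exact h2

section Algebra

variable (K : Type*) [Field K]

theorem cyclePow_twoRegularQuiver (h : Γ.Edge × Bool) :
    Γ.twoRegularQuiver.cyclePow K Γ.weight h = Γ.cyclePow K h :=
  congrArg (fun σ => Γ.quiver.cycle K σ h ^ Γ.mult (Γ.vert h)) (funext Γ.g_twoRegularQuiver)

/-- Two arrows that do not follow the cyclic order are h and f h. If f h = h, the required zero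
relation is the border relation with b = 0. -/
theorem mkAlgHom_eq_of_rel {x y : Γ.quiver.PathAlgebra K} (h : BrauerGraph.Rel K Γ x y) :
    RingQuot.mkAlgHom K (TwoRegularQuiver.Rel Γ.twoRegularQuiver Γ.weight
        (0 : Γ.twoRegularQuiver.border → K)) x =
      RingQuot.mkAlgHom K (TwoRegularQuiver.Rel Γ.twoRegularQuiver Γ.weight
        (0 : Γ.twoRegularQuiver.border → K)) y := by
  cases h with
  | zero h k hk hne =>
    have hf : k = Γ.twoRegularQuiver.f h := by
      obtain h1 | h1 := TwoRegularQuiver.eq_or_eq_bar (Q := Γ.twoRegularQuiver) (a := Γ.next h)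
        (b := k) hk.symm
      · exact absurd h1 hne
      · exact h1.trans (Γ.bar_twoRegularQuiver _)
    subst hf
    by_cases hh : Γ.twoRegularQuiver.f h = h
    · have := RingQuot.mkAlgHom_rel K (TwoRegularQuiver.Rel.border (m := Γ.weight)
        (b := (0 : Γ.twoRegularQuiver.border → K)) h hh)
      rw [Pi.zero_apply, zero_smul] at this
      rwa [hh]
    · exact RingQuot.mkAlgHom_rel K (TwoRegularQuiver.Rel.zero (Q := Γ.twoRegularQuiver)
        (m := Γ.weight) (b := (0 : Γ.twoRegularQuiver.border → K)) h hh)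
  | comm h =>
    have := RingQuot.mkAlgHom_rel K (TwoRegularQuiver.Rel.comm (m := Γ.weight)
        (b := (0 : Γ.twoRegularQuiver.border → K)) h)
    rwa [bar_twoRegularQuiver, cyclePow_twoRegularQuiver, cyclePow_twoRegularQuiver] at this

theorem mkAlgHom_eq_of_twoRegularQuiver_rel {x y : Γ.twoRegularQuiver.PathAlgebra K}
    (h : TwoRegularQuiver.Rel Γ.twoRegularQuiver Γ.weight
      (0 : Γ.twoRegularQuiver.border → K) x y) :
    RingQuot.mkAlgHom K (BrauerGraph.Rel K Γ) x = RingQuot.mkAlgHom K (BrauerGraph.Rel K Γ) y := by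
  have h0 : ∀ h, RingQuot.mkAlgHom K (BrauerGraph.Rel K Γ)
      (Γ.quiver.arrow K h * Γ.quiver.arrow K (Γ.twoRegularQuiver.f h)) =
        RingQuot.mkAlgHom K (BrauerGraph.Rel K Γ) 0 := fun h =>
    RingQuot.mkAlgHom_rel K (BrauerGraph.Rel.zero h (Γ.twoRegularQuiver.f h) rfl
      (Γ.other_ne (Γ.next h)))
  cases h with
  | zero a h => exact h0 a
  | border a h =>
    have := h0 a
    rw [h] at this
    rw [Pi.zero_apply, zero_smul]
    exact this
  | comm a =>
    have := RingQuot.mkAlgHom_rel K (BrauerGraph.Rel.comm (K := K) a)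
    have hbar := (congrArg (Γ.twoRegularQuiver.cyclePow K Γ.weight)
      (Γ.bar_twoRegularQuiver a)).trans (Γ.cyclePow_twoRegularQuiver K (Γ.other a))
    exact (congrArg (RingQuot.mkAlgHom K (BrauerGraph.Rel K Γ))
      (Γ.cyclePow_twoRegularQuiver K a)).trans (this.trans
        (congrArg (RingQuot.mkAlgHom K (BrauerGraph.Rel K Γ)) hbar.symm))

/-- A Brauer graph algebra is the algebra `B(Q, f, m, 0)` of its quiver. -/
def algEquiv : Γ.twoRegularQuiver.algebra Γ.weight
    (0 : Γ.twoRegularQuiver.border → K) ≃ₐ[K] Γ.algebra K :=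
  AlgEquiv.ofAlgHom
    (RingQuot.liftAlgHom K ⟨RingQuot.mkAlgHom K (BrauerGraph.Rel K Γ),
      fun _ _ h => Γ.mkAlgHom_eq_of_twoRegularQuiver_rel K h⟩)
    (RingQuot.liftAlgHom K ⟨RingQuot.mkAlgHom K (TwoRegularQuiver.Rel Γ.twoRegularQuiver Γ.weight
      (0 : Γ.twoRegularQuiver.border → K)), fun _ _ h => Γ.mkAlgHom_eq_of_rel K h⟩)
    (AlgHom.ext fun x => by
      obtain ⟨x, rfl⟩ := RingQuot.mkAlgHom_surjective K _ x
      rw [AlgHom.comp_apply]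
      exact (congrArg _ (RingQuot.liftAlgHom_mkAlgHom_apply _ _ _ _)).trans
        (RingQuot.liftAlgHom_mkAlgHom_apply _ _ _ _))
    (AlgHom.ext fun x => by
      obtain ⟨x, rfl⟩ := RingQuot.mkAlgHom_surjective K _ x
      rw [AlgHom.comp_apply]
      exact (congrArg _ (RingQuot.liftAlgHom_mkAlgHom_apply _ _ _ _)).trans
        (RingQuot.liftAlgHom_mkAlgHom_apply _ _ _ _))

end Algebra

end BrauerGraph

end

/-! ### The main theorem. -/

theorem theorem2 (K : Type*) [Field K] [IsAlgClosed K]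
    (A : Type*) [Ring A] [Algebra K A] [FiniteDimensional K A]
    (hsymm : HasSymmetrizingForm K A) (hindec : IsIndecomposableAlgebra A)
    (hrank : 2 ≤ Module.rank ℤ (GrothendieckK0 A))
    (Γ : BrauerGraph) (hsoc : SocleEquivalent K A (Γ.algebra K))
    (hniso : ¬ Nonempty (A ≃ₐ[K] Γ.algebra K)) :
    CharP K 2 ∧
      ∃ (T : DirectedTriangulatedSurface) (m : T.quiver.WeightFunction) (b : T.quiver.border → K),
        T.HasBoundary ∧ T.NoSelfFolded ∧ b ≠ 0 ∧
          IsIsoIdempotentAlgebra K A (T.quiver.algebra m b) := by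
  obtain ⟨π, ρ, hπ, hρ, hπ0, hρ0⟩ := hsoc.exists_common_quotient
    (Λ := Γ.twoRegularQuiver.algebra Γ.weight (0 : Γ.twoRegularQuiver.border → K)) (Γ.algEquiv K)
  obtain ⟨e₀⟩ := Γ.nonemptyEdge
  have h1 := TwoRegularQuiver.one_notMem_rightSocle Γ.weight K e₀
  -- If A were its own socle, the common quotient would be zero, and 1 would lie in the socle of the
  -- Brauer graph algebra.
  have htop : rightSocle A ≠ ⊤ := fun h => h1 <| by
    rw [← hρ0, map_one, ← map_one π, hπ0, h]
    exact Submodule.mem_top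
  have hsq := fun x hx y hy => mul_eq_zero_of_mem_rightSocle hsymm hindec htop (x := x) (y := y)
    hx hy
  -- With a single edge the Brauer graph algebra is local, hence so is A, and the rank of K₀ is at
  -- most one.
  have hnt : Nontrivial Γ.Edge := by
    by_contra hn
    have : Subsingleton Γ.twoRegularQuiver.Vertex := not_nontrivial_iff_subsingleton.1 hn
    obtain ⟨ε, hε⟩ := TwoRegularQuiver.exists_algHom_isNilpotent Γ.weight K e₀
    have := hrank.trans (rank_grothendieckK0_le_one_of_common_quotient hρ hπ0 hρ0 hsq h1 ε hε)
    exact absurd this (by norm_num)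
  obtain ⟨B, hassoc, hB, hnd⟩ := hsymm
  let S : TwoRegularQuiver.SocleLift Γ.weight A (socleIdeal (Γ.algebra K)).ringCon.Quotient :=
    { π := π
      ρ := ρ
      π_surj := hπ
      ρ_surj := hρ
      π_ker := hπ0 _
      ρ_ker := hρ0 _
      -- The trace t(x) = B(x, 1), from which associativity recovers B(x, y) = t(xy).
      t := LinearMap.flip B 1
      t_comm := fun x y => by
        rw [LinearMap.flip_apply, LinearMap.flip_apply, hassoc, hassoc, mul_one, mul_one, hB]
      t_nondeg := fun x hx => hnd.1 x fun y => by
        rw [← mul_one y, ← hassoc]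
        exact hx y
      sq_zero := hsq
      noDoubleLoop := Γ.noDoubleLoop_twoRegularQuiver }
  obtain ⟨b, ⟨φ⟩, hb⟩ := S.exists_algEquiv Γ.connected_twoRegularQuiver
  have hb0 : b ≠ 0 := by
    rintro rfl
    exact hniso ⟨φ.trans (Γ.algEquiv K)⟩
  refine ⟨CharTwo.of_one_ne_zero_of_two_eq_zero one_ne_zero (by_contra fun h2 => hb0 (hb h2)), ?_⟩
  exact Γ.noDoubleLoop_twoRegularQuiver.exists_surface Γ.connected_twoRegularQuiver hb0 φ
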